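/- Let $m,n\in\mathbb Z_{\ge 0}$, $(m,n)\neq(0,0)$, let $A_{m,n}=\mathbb C[t_1,\dots,t_m]\otimes\Lambda(n)$, let $W=W_{m,n}$ be the Lie superalgebra of super-derivations of $A_{m,n}$, and let $\mathfrak h=\mathrm{span}\{d_i=t_i\partial_i\mid 1\le i\le m\}$. All modules are $\mathbb Z/2$-graded modules over $\mathbb C$, all submodules are graded, and weights, weight modules (modules on which $\mathfrak h$ acts diagonalizably) and supports $\operatorname{supp}$ are taken with respect to $\mathfrak h$. Let $\epsilon_1,\dots,\epsilon_m\in\mathfrak h^*$ be the basis dual to $d_1,\dots,d_m$. Let $\Delta\subset\mathfrak h^*\setminus\{0\}$ be the set of roots of $W$, let $W_\alpha$ ($\alpha\in\Delta\cup\{0\}$) be the weight spaces of the adjoint module, and let $\Delta'=\{\epsilon_i-\epsilon_j,\ \epsilon_i,\ -\epsilon_i\mid i\ne j\}$ be the root system of $\mathfrak{sl}_{m+1}\subset W_{m,0}$, with invariant form $(\cdot,\cdot)$ on $\mathfrak h^*$ normalized by $(\epsilon_i,\epsilon_i)=2$ and $(\epsilon_i,\epsilon_j)=1$ for $i\neq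 j$. Let $M$ be a simple weight $W$-module with finite-dimensional weight spaces on which $W$ does not act by zero. For $\lambda\in\operatorname{supp}M$ put $K_\lambda=\{\alpha\in\Delta'\mid\lambda+\alpha\notin\operatorname{supp}M\}$; $\lambda$ is called extremal if $K_\lambda$ is not a proper subset of $K_\mu$ for any $\mu\in\operatorname{supp}M$. Let $\Delta'^F$ (resp. $\Delta'^I$) be the set of $\alpha\in\Delta'$ such that $\{q\in\mathbb R\mid\lambda+q\alpha\in\operatorname{supp}M\}$ is bounded in both directions (resp. unbounded in both directions), and let $\Delta'^{F,0}_\lambda=\{\alpha\in\Delta'^F\mid(\lambda,\alpha)=0\}$. A triangular decomposition of $\Delta'^{F,0}_\lambda$ is a disjoint decomposition $\Delta'^{F,0}_\lambda=P\sqcup Q$ with $\langle -P\cup Q\rangle_{\mathbb R_+}\cap\langle -Q\cup P\rangle_{\mathbb R_+}=\{0\}$. Given such a decomposition, put ${}^\lambda\Delta'^+=(K_\lambda\setminus(K_\lambda\cap -K_\lambda))\cup P$ and $${}^\lambda\Delta^0=\Delta\cap\langle\Delta'^I\rangle_{\mathbb Z},\qquad {}^\lambda\Delta^+=\big(\Delta\cap\langle{}^\lambda\Delta'^+\cup\Delta'^I\rangle_{\mathbb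 Z_+}\big)\setminus{}^\lambda\Delta^0,$$ $${}^\lambda\mathfrak p=W_0\oplus\bigoplus_{\alpha\in{}^\lambda\Delta^0\sqcup{}^\lambda\Delta^+}W_\alpha,\qquad \hat{\mathfrak k}=W_0\oplus\bigoplus_{\alpha\in{}^\lambda\Delta^0}W_\alpha ,$$ so that $\hat{\mathfrak k}$ is the Levi subalgebra of ${}^\lambda\mathfrak p$. Theorem. There is an extremal $\lambda\in\operatorname{supp}M$ such that for every triangular decomposition of $\Delta'^{F,0}_\lambda$ the following hold. First, $\lambda+\alpha\notin\operatorname{supp}M$ for all $\alpha\in{}^\lambda\Delta^+$. Moreover, there is a simple weight ${}^\lambda\mathfrak p$-module $N$ with $\operatorname{supp}N=\lambda+\langle\Delta'^I\rangle_{\mathbb Z}$ such that $M$ is the unique simple quotient of $\mathrm{Ind}_{{}^\lambda\mathfrak p}^{W}N=U(W)\otimes_{U({}^\lambda\mathfrak p)}N$ (that is, the induced module has exactly one maximal submodule, and the quotient by it is isomorphic to $M$). Furthermore, this $N$ is simple and bounded (weight spaces of uniformly bounded finite dimension) as a module over $\hat{\mathfrak k}$, and $\dim N_\mu=\dim N_\nu$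 for all $\mu,\nu\in\operatorname{supp}N$. -/

import Mathlib

open scoped TensorProduct DirectSum

universe u v w

noncomputable section

namespace CartanW

/-! ### Superspaces -/

/-- The sign `(-1)^i` for `i ∈ ℤ/2`. -/
def sgn (i : ZMod 2) : ℂ := if i = 0 then 1 else -1

theorem sgn_zero : sgn 0 = 1 := by simp [sgn]

theorem sgn_one : sgn 1 = -1 := by simp [sgn]

theorem zmod2_cases (i : ZMod 2) : i = 0 ∨ i = 1 := by
  revert i; decide

theorem sgn_mul_self (i : ZMod 2) : sgn i * sgn i = 1 := by
  rcases zmod2_cases i with rfl | rfl <;> simp [sgn]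

theorem sgn_add (i j : ZMod 2) : sgn (i + j) = sgn i * sgn j := by
  have h2 : (1 : ZMod 2) + 1 = 0 := by decide
  rcases zmod2_cases i with rfl | rfl <;> rcases zmod2_cases j with rfl | rfl <;>
    simp [sgn, h2]

/-- A `ℤ/2`-gradation `V = V₀ ⊕ V₁` of a complex vector space. -/
structure Superspace (V : Type u) [AddCommGroup V] [Module ℂ V] where
  part : ZMod 2 → Submodule ℂ V
  isCompl : IsCompl (part 0) (part 1)

namespace Superspace

variable {V : Type u} [AddCommGroup V] [Module ℂ V]

/-- The parity involution `v ↦ (-1)^{|v|} v`. -/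
def parity (γ : Superspace V) : V →ₗ[ℂ] V :=
  (γ.part 0).projection (γ.part 1) γ.isCompl - (γ.part 1).projection (γ.part 0) γ.isCompl.symm

theorem parity_apply (γ : Superspace V) {i : ZMod 2} {x : V} (hx : x ∈ γ.part i) :
    γ.parity x = sgn i • x := by
  rcases zmod2_cases i with rfl | rfl
  · have h := (Submodule.projection_apply_eq_zero_iff γ.isCompl.symm).2 hx
    simp [parity, sgn, h, Submodule.projection_apply_of_mem_left γ.isCompl hx]
  · have h := (Submodule.projection_apply_eq_zero_iff γ.isCompl).2 hx
    simp [parity, sgn, h, Submodule.projection_apply_of_mem_left γ.isCompl.symm hx]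

theorem exists_add (γ : Superspace V) (x : V) :
    ∃ y ∈ γ.part 0, ∃ z ∈ γ.part 1, y + z = x := by
  have hx : x ∈ γ.part 0 ⊔ γ.part 1 := by rw [γ.isCompl.sup_eq_top]; trivial
  exact Submodule.mem_sup.1 hx

theorem parity_parity (γ : Superspace V) (x : V) : γ.parity (γ.parity x) = x := by
  obtain ⟨y, hy, z, hz, rfl⟩ := γ.exists_add x
  simp [γ.parity_apply hy, γ.parity_apply hz, sgn]

/-- The gradation of `V` into the eigenspaces of an involution `σ`:
`V_i = {v | σ v = (-1)^i v}`. -/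
def ofInvolution (σ : V →ₗ[ℂ] V) (hσ : ∀ v, σ (σ v) = v) : Superspace V where
  part i := LinearMap.ker (σ - sgn i • LinearMap.id)
  isCompl := by
    constructor
    · rw [Submodule.disjoint_def]
      intro x h0 h1
      simp only [LinearMap.mem_ker, LinearMap.sub_apply,
        LinearMap.id_apply, sgn_zero, sgn_one, one_smul, neg_smul, sub_neg_eq_add] at h0 h1
      have h : (2 : ℂ) • x = 0 := by
        rw [two_smul]
        nth_rewrite 1 [sub_eq_zero.1 h0 |>.symm]
        rw [add_comm]
        simpa [add_comm] using h1
      simpa using h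
    · rw [codisjoint_iff, eq_top_iff]
      intro x _
      refine Submodule.mem_sup.2 ⟨(2⁻¹ : ℂ) • (x + σ x), ?_, (2⁻¹ : ℂ) • (x - σ x), ?_, ?_⟩
      · simp [sgn, hσ, add_comm]
      · simp only [LinearMap.mem_ker, LinearMap.sub_apply, LinearMap.smul_apply,
          LinearMap.id_apply, sgn_one, map_smul, map_sub, hσ]
        module
      · module

theorem mem_ofInvolution {σ : V →ₗ[ℂ] V} {hσ : ∀ v, σ (σ v) = v} {i : ZMod 2} {v : V} :
    v ∈ (ofInvolution σ hσ).part i ↔ σ v = sgn i • v := by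
  simp [ofInvolution, sub_eq_zero]

end Superspace

/-! ### Lie superalgebras of operators and their modules -/

/-- A Lie sub-superalgebra `g = g₀ ⊕ g₁` of the general linear Lie superalgebra of a superspace:
`g_i` consists of operators of parity `i`, and `g` is closed under the supercommutator
`[f, f'] = f f' - (-1)^{|f||f'|} f' f`. -/
structure LieSuper {V : Type u} [AddCommGroup V] [Module ℂ V] (γ : Superspace V) where
  part : ZMod 2 → Submodule ℂ (Module.End ℂ V)
  parity_mem : ∀ {i j : ZMod 2} {f : Module.End ℂ V} {v : V},
    f ∈ part i → v ∈ γ.part j → f v ∈ γ.part (i + j)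
  bracket_mem : ∀ {i j : ZMod 2} {f f' : Module.End ℂ V},
    f ∈ part i → f' ∈ part j → f * f' - sgn (i * j) • (f' * f) ∈ part (i + j)

section Modules

variable {V : Type u} [AddCommGroup V] [Module ℂ V] {γ : Superspace V}

namespace LieSuper

/-- The superbracket of two homogeneous elements. -/
def bracket (g : LieSuper γ) {i j : ZMod 2} (x : g.part i) (y : g.part j) : g.part (i + j) :=
  ⟨x.1 * y.1 - sgn (i * j) • (y.1 * x.1), g.bracket_mem x.2 y.2⟩

/-- `k` is a sub-superalgebra of `g`. -/
def IsSub (k g : LieSuper γ) : Prop := ∀ i, k.part i ≤ g.part i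

/-- The inclusion of a sub-superalgebra. -/
def incl {k g : LieSuper γ} (h : k.IsSub g) (i : ZMod 2) : k.part i →ₗ[ℂ] g.part i :=
  Submodule.inclusion (h i)

end LieSuper

/-- A (`ℤ/2`-graded) module structure on `M` over the Lie superalgebra `g`. -/
structure SuperModule (g : LieSuper γ) (M : Type v) [AddCommGroup M] [Module ℂ M] where
  grading : Superspace M
  act : ∀ i : ZMod 2, g.part i →ₗ[ℂ] Module.End ℂ M
  act_mem : ∀ {i j : ZMod 2} (x : g.part i) {v : M},
    v ∈ grading.part j → act i x v ∈ grading.part (i + j)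
  act_bracket : ∀ {i j : ZMod 2} (x : g.part i) (y : g.part j),
    act (i + j) (g.bracket x y) = act i x * act j y - sgn (i * j) • (act j y * act i x)

namespace SuperModule

variable {g k : LieSuper γ}
variable {M : Type v} [AddCommGroup M] [Module ℂ M] {N : Type w} [AddCommGroup N] [Module ℂ N]

/-- Restriction of a module to a sub-superalgebra. -/
def restrict (ρ : SuperModule g M) (h : k.IsSub g) : SuperModule k M where
  grading := ρ.grading
  act i := ρ.act i ∘ₗ LieSuper.incl h i
  act_mem x _ hv := ρ.act_mem (LieSuper.incl h _ x) hv
  act_bracket x y := ρ.act_bracket (LieSuper.incl h _ x) (LieSuper.incl h _ y)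

/-- `X` is a (`ℤ/2`-graded) submodule. -/
def IsSubmodule (ρ : SuperModule g M) (X : Submodule ℂ M) : Prop :=
  (∀ v ∈ X, ∃ v₀ ∈ X ⊓ ρ.grading.part 0, ∃ v₁ ∈ X ⊓ ρ.grading.part 1, v₀ + v₁ = v) ∧
    ∀ (i : ZMod 2) (x : g.part i), ∀ v ∈ X, ρ.act i x v ∈ X

/-- `ρ` is simple: nonzero, without graded submodules other than `0` and itself. -/
def IsSimple (ρ : SuperModule g M) : Prop :=
  Nontrivial M ∧ ∀ X : Submodule ℂ M, ρ.IsSubmodule X → X = ⊥ ∨ X = ⊤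

/-- `ρ` is trivial: `g` acts by zero. -/
def IsTrivial (ρ : SuperModule g M) : Prop :=
  ∀ (i : ZMod 2) (x : g.part i), ρ.act i x = 0

/-- `X` is a maximal submodule (maximal among the proper graded submodules). -/
def IsMaximalSubmodule (ρ : SuperModule g M) (X : Submodule ℂ M) : Prop :=
  ρ.IsSubmodule X ∧ X ≠ ⊤ ∧ ∀ Y, ρ.IsSubmodule Y → X ≤ Y → Y = X ∨ Y = ⊤

/-- `φ` is an (even) homomorphism of `g`-modules. -/
def IsHom (ρ : SuperModule g M) (η : SuperModule g N) (φ : M →ₗ[ℂ] N) : Prop :=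
  (∀ (i : ZMod 2), ∀ v ∈ ρ.grading.part i, φ v ∈ η.grading.part i) ∧
    ∀ (i : ZMod 2) (x : g.part i) (v : M), φ (ρ.act i x v) = η.act i x (φ v)

/-- `η` is the unique simple quotient of `ρ`: `η` is simple, and it is the quotient of `ρ` by a
submodule which is the only maximal submodule of `ρ`. -/
def HasUniqueSimpleQuotient (ρ : SuperModule g M) (η : SuperModule g N) : Prop :=
  η.IsSimple ∧ ∃ φ : M →ₗ[ℂ] N, ρ.IsHom η φ ∧ Function.Surjective φ ∧
    ∀ X : Submodule ℂ M, ρ.IsMaximalSubmodule X ↔ X = LinearMap.ker φ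

end SuperModule

/-! ### Enveloping superalgebra and induced modules -/

/-- The defining relations `x y - (-1)^{|x||y|} y x = [x, y]` of the enveloping algebra, in the
tensor algebra of the superspace `g = g₀ ⊕ g₁`. -/
inductive EnvRel (g : LieSuper γ) :
    TensorAlgebra ℂ (⨁ i, g.part i) → TensorAlgebra ℂ (⨁ i, g.part i) → Prop
  | bracket {i j : ZMod 2} (x : g.part i) (y : g.part j) :
      EnvRel g
        (TensorAlgebra.ι ℂ (DirectSum.lof ℂ (ZMod 2) (fun i => g.part i) i x) *
            TensorAlgebra.ι ℂ (DirectSum.lof ℂ (ZMod 2) (fun i => g.part i) j y) -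
          sgn (i * j) •
            (TensorAlgebra.ι ℂ (DirectSum.lof ℂ (ZMod 2) (fun i => g.part i) j y) *
              TensorAlgebra.ι ℂ (DirectSum.lof ℂ (ZMod 2) (fun i => g.part i) i x)))
        (TensorAlgebra.ι ℂ
          (DirectSum.lof ℂ (ZMod 2) (fun i => g.part i) (i + j) (g.bracket x y)))

/-- The universal enveloping algebra `U(g)`. -/
def Env (g : LieSuper γ) : Type u := RingQuot (EnvRel g)

namespace Env

variable (g : LieSuper γ)

instance : Ring (Env g) := inferInstanceAs (Ring (RingQuot (EnvRel g)))

instance : Algebra ℂ (Env g) := inferInstanceAs (Algebra ℂ (RingQuot (EnvRel g)))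

/-- The quotient map from the tensor algebra of `g`. -/
def mk : TensorAlgebra ℂ (⨁ i, g.part i) →ₐ[ℂ] Env g := RingQuot.mkAlgHom ℂ (EnvRel g)

/-- The canonical map `g_i → U(g)`. -/
def ι (i : ZMod 2) : g.part i →ₗ[ℂ] Env g :=
  (mk g).toLinearMap ∘ₗ TensorAlgebra.ι ℂ ∘ₗ
    DirectSum.lof ℂ (ZMod 2) (fun i => g.part i) i

theorem ι_bracket {i j : ZMod 2} (x : g.part i) (y : g.part j) :
    ι g (i + j) (g.bracket x y) = ι g i x * ι g j y - sgn (i * j) • (ι g j y * ι g i x) := by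
  have h : mk g _ = mk g _ := RingQuot.mkAlgHom_rel ℂ (EnvRel.bracket (g := g) x y)
  simpa [ι] using h.symm

/-- The parity involution of `U(g)`, with `x ↦ (-1)^{|x|} x` on `g`. -/
def parity : Env g →ₐ[ℂ] Env g :=
  RingQuot.liftAlgHom ℂ
    ⟨TensorAlgebra.lift ℂ (DirectSum.toModule ℂ (ZMod 2) (Env g) fun i => sgn i • ι g i), by
      rintro _ _ ⟨x, y⟩
      rename_i i j
      simp only [map_sub, map_mul, map_smul, TensorAlgebra.lift_ι_apply,
        DirectSum.toModule_lof, LinearMap.smul_apply, ι_bracket, sgn_add, smul_mul_smul_comm,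
        smul_sub, smul_comm (sgn (i * j)), mul_comm (sgn j)]⟩

theorem parity_ι (i : ZMod 2) (x : g.part i) : parity g (ι g i x) = sgn i • ι g i x := by
  have e : parity g (ι g i x) = TensorAlgebra.lift ℂ
      (DirectSum.toModule ℂ (ZMod 2) (Env g) fun i => sgn i • ι g i)
      (TensorAlgebra.ι ℂ (DirectSum.lof ℂ (ZMod 2) (fun i => g.part i) i x)) :=
    RingQuot.liftAlgHom_mkAlgHom_apply ℂ _ _ _
  rw [e]
  simp

theorem parity_parity (u : Env g) : parity g (parity g u) = u := by
  have h : (parity g).comp (parity g) = AlgHom.id ℂ (Env g) := by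
    apply RingQuot.ringQuot_ext'
    apply TensorAlgebra.hom_ext
    apply DirectSum.linearMap_ext
    intro i
    ext x
    have := parity_ι g i x
    simp only [ι, LinearMap.comp_apply, AlgHom.toLinearMap_apply] at this
    change parity g (parity g (mk g _)) = mk g _
    rw [this, map_smul, this, smul_smul, sgn_mul_self, one_smul]
  exact DFunLike.congr_fun h u

end Env

section Ind

variable {p g : LieSuper γ} (h : p.IsSub g) {N : Type w} [AddCommGroup N] [Module ℂ N]
  (η : SuperModule p N)

/-- The relations `u x ⊗ v = u ⊗ x v` (`u ∈ U(g)`, `x ∈ p`, `v ∈ N`) in `U(g) ⊗ N`. As `p`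
generates `U(p)`, these are the relations of the tensor product over `U(p)`. -/
def indRel : Submodule ℂ (Env g ⊗[ℂ] N) :=
  Submodule.span ℂ {z | ∃ (u : Env g) (i : ZMod 2) (x : p.part i) (v : N),
    z = (u * Env.ι g i (LieSuper.incl h i x)) ⊗ₜ[ℂ] v - u ⊗ₜ[ℂ] (η.act i x v)}

/-- The space `U(g) ⊗_{U(p)} N` of the induced module. -/
abbrev IndSpace : Type (max u w) := (Env g ⊗[ℂ] N) ⧸ indRel h η

theorem indRel_parity :
    indRel h η ≤ (indRel h η).comap
      (TensorProduct.map (Env.parity g).toLinearMap η.grading.parity) := by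
  rw [indRel, Submodule.span_le]
  rintro _ ⟨u, i, x, v, rfl⟩
  have key : ∀ (j : ZMod 2) (v : N), v ∈ η.grading.part j →
      TensorProduct.map (Env.parity g).toLinearMap η.grading.parity
        ((u * Env.ι g i (LieSuper.incl h i x)) ⊗ₜ[ℂ] v - u ⊗ₜ[ℂ] (η.act i x v)) ∈
          indRel h η := by
    intro j v hv
    have e : TensorProduct.map (Env.parity g).toLinearMap η.grading.parity
        ((u * Env.ι g i (LieSuper.incl h i x)) ⊗ₜ[ℂ] v - u ⊗ₜ[ℂ] (η.act i x v)) =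
        (sgn i * sgn j) • (((Env.parity g u) * Env.ι g i (LieSuper.incl h i x)) ⊗ₜ[ℂ] v -
          (Env.parity g u) ⊗ₜ[ℂ] (η.act i x v)) := by
      simp only [map_sub, TensorProduct.map_tmul, AlgHom.toLinearMap_apply, map_mul,
        Env.parity_ι, η.grading.parity_apply hv, η.grading.parity_apply (η.act_mem x hv),
        sgn_add, mul_smul_comm, TensorProduct.smul_tmul', TensorProduct.tmul_smul, smul_sub,
        smul_smul, mul_comm (sgn j)]
    rw [e]
    exact Submodule.smul_mem _ _ (Submodule.subset_span ⟨_, i, x, v, rfl⟩)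
  obtain ⟨a, ha, b, hb, rfl⟩ := η.grading.exists_add v
  have := Submodule.add_mem _ (key 0 a ha) (key 1 b hb)
  rw [SetLike.mem_coe, Submodule.mem_comap]
  rw [← map_add] at this
  have e : (u * Env.ι g i (LieSuper.incl h i x)) ⊗ₜ[ℂ] (a + b) - u ⊗ₜ[ℂ] (η.act i x (a + b)) =
      ((u * Env.ι g i (LieSuper.incl h i x)) ⊗ₜ[ℂ] a - u ⊗ₜ[ℂ] (η.act i x a)) +
        ((u * Env.ι g i (LieSuper.incl h i x)) ⊗ₜ[ℂ] b - u ⊗ₜ[ℂ] (η.act i x b)) := by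
    rw [map_add, TensorProduct.tmul_add, TensorProduct.tmul_add]
    abel
  rw [e]
  exact this

/-- The parity involution of the induced module, `u ⊗ v ↦ (-1)^{|u| + |v|} u ⊗ v`. -/
def indParity : IndSpace h η →ₗ[ℂ] IndSpace h η :=
  (indRel h η).mapQ (indRel h η)
    (TensorProduct.map (Env.parity g).toLinearMap η.grading.parity) (indRel_parity h η)

theorem indParity_indParity (z : IndSpace h η) : indParity h η (indParity h η z) = z := by
  obtain ⟨z, rfl⟩ := Submodule.mkQ_surjective _ z
  induction z using TensorProduct.induction_on with
  | zero => rw [map_zero, map_zero, map_zero]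
  | add a b ha hb => rw [map_add, map_add, map_add, ha, hb]
  | tmul u v => simp [indParity, Env.parity_parity, Superspace.parity_parity]

theorem indRel_mulLeft (a : Env g) :
    indRel h η ≤ (indRel h η).comap (LinearMap.rTensor N (LinearMap.mulLeft ℂ a)) := by
  rw [indRel, Submodule.span_le]
  rintro _ ⟨u, i, x, v, rfl⟩
  refine Submodule.subset_span ⟨a * u, i, x, v, ?_⟩
  simp [mul_assoc]

/-- Left multiplication by `a ∈ U(g)` on `U(g) ⊗_{U(p)} N`. -/
def indMul (a : Env g) : Module.End ℂ (IndSpace h η) :=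
  (indRel h η).mapQ (indRel h η) (LinearMap.rTensor N (LinearMap.mulLeft ℂ a))
    (indRel_mulLeft h η a)

theorem indMul_mk (a u : Env g) (v : N) :
    indMul h η a ((indRel h η).mkQ (u ⊗ₜ[ℂ] v)) = (indRel h η).mkQ ((a * u) ⊗ₜ[ℂ] v) := by
  simp [indMul]

theorem ind_ext {X : Type*} [AddCommGroup X] [Module ℂ X] {f f' : IndSpace h η →ₗ[ℂ] X}
    (hf : ∀ u v, f ((indRel h η).mkQ (u ⊗ₜ[ℂ] v)) = f' ((indRel h η).mkQ (u ⊗ₜ[ℂ] v))) :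
    f = f' := by
  apply Submodule.linearMap_qext
  apply TensorProduct.ext'
  exact hf

theorem indMul_parity (i : ZMod 2) (x : g.part i) (z : IndSpace h η) :
    indParity h η (indMul h η (Env.ι g i x) z) =
      sgn i • indMul h η (Env.ι g i x) (indParity h η z) := by
  have e : indParity h η ∘ₗ indMul h η (Env.ι g i x) =
      sgn i • (indMul h η (Env.ι g i x) ∘ₗ indParity h η) := by
    apply ind_ext
    intro u v
    simp [indParity, indMul, Env.parity_ι, ← TensorProduct.smul_tmul']
  exact LinearMap.congr_fun e z

/-- The induced module `Ind_p^g N = U(g) ⊗_{U(p)} N`. -/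
def ind : SuperModule g (IndSpace h η) where
  grading := Superspace.ofInvolution (indParity h η) (indParity_indParity h η)
  act i :=
    { toFun := fun x => indMul h η (Env.ι g i x)
      map_add' := by
        intro x y
        apply ind_ext
        intro u v
        simp [indMul, add_mul, TensorProduct.add_tmul]
      map_smul' := by
        intro c x
        apply ind_ext
        intro u v
        simp [indMul, ← TensorProduct.smul_tmul'] }
  act_mem := by
    intro i j x z hz
    rw [Superspace.mem_ofInvolution] at hz ⊢
    simp [indMul_parity, hz, sgn_add, smul_smul]
  act_bracket := by
    intro i j x y
    apply ind_ext
    intro u v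
    simp [indMul, Env.ι_bracket, sub_mul, TensorProduct.sub_tmul, ← TensorProduct.smul_tmul',
      mul_assoc]

end Ind

end Modules

/-! ### The Lie superalgebra `W_{m,n}` -/

/-- `A_{m,n} = ℂ[t₁, …, t_m] ⊗ Λ(n)`. -/
def A (m n : ℕ) : Type := MvPolynomial (Fin m) ℂ ⊗[ℂ] ExteriorAlgebra ℂ (Fin n → ℂ)

instance (m n : ℕ) : Ring (A m n) :=
  inferInstanceAs (Ring (MvPolynomial (Fin m) ℂ ⊗[ℂ] ExteriorAlgebra ℂ (Fin n → ℂ)))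

instance (m n : ℕ) : Algebra ℂ (A m n) :=
  inferInstanceAs (Algebra ℂ (MvPolynomial (Fin m) ℂ ⊗[ℂ] ExteriorAlgebra ℂ (Fin n → ℂ)))

/-- The identification of `ℂ[t] ⊗ Λ(n)` with `A_{m,n}`. -/
def toA (m n : ℕ) :
    (MvPolynomial (Fin m) ℂ ⊗[ℂ] ExteriorAlgebra ℂ (Fin n → ℂ)) ≃ₗ[ℂ] A m n :=
  LinearEquiv.refl ℂ (MvPolynomial (Fin m) ℂ ⊗[ℂ] ExteriorAlgebra ℂ (Fin n → ℂ))

theorem toA_mul (m n : ℕ) (x y : MvPolynomial (Fin m) ℂ ⊗[ℂ] ExteriorAlgebra ℂ (Fin n → ℂ)) :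
    toA m n (x * y) = toA m n x * toA m n y := rfl

theorem toA_one (m n : ℕ) : toA m n 1 = 1 := rfl

/-- The subspace `ℂ[t] ⊗ Λ(n)_j` of `ℂ[t] ⊗ Λ(n)`. -/
def Tpart (m n : ℕ) (j : ZMod 2) :
    Submodule ℂ (MvPolynomial (Fin m) ℂ ⊗[ℂ] ExteriorAlgebra ℂ (Fin n → ℂ)) :=
  LinearMap.range (LinearMap.lTensor (MvPolynomial (Fin m) ℂ)
    (CliffordAlgebra.evenOdd (0 : QuadraticForm ℂ (Fin n → ℂ)) j).subtype)

/-- The part of `A_{m,n}` of parity `j`: `ℂ[t] ⊗ Λ(n)_j`. -/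
def Apart (m n : ℕ) (j : ZMod 2) : Submodule ℂ (A m n) :=
  (Tpart m n j).map (toA m n).toLinearMap

theorem Tpart_isCompl (m n : ℕ) : IsCompl (Tpart m n 0) (Tpart m n 1) := by
  have hc := CliffordAlgebra.evenOdd_isCompl (0 : QuadraticForm ℂ (Fin n → ℂ))
  have key : ∀ {i j : ZMod 2} (h : IsCompl
      (CliffordAlgebra.evenOdd (0 : QuadraticForm ℂ (Fin n → ℂ)) i)
      (CliffordAlgebra.evenOdd (0 : QuadraticForm ℂ (Fin n → ℂ)) j)), ∀ z ∈ Tpart m n j,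
      LinearMap.lTensor (MvPolynomial (Fin m) ℂ) (Submodule.projection _ _ h) z = 0 := by
    rintro i j h _ ⟨z, rfl⟩
    have e : (Submodule.projection _ _ h) ∘ₗ
        (CliffordAlgebra.evenOdd (0 : QuadraticForm ℂ (Fin n → ℂ)) j).subtype = 0 := by
      refine LinearMap.ext fun x => ?_
      exact (Submodule.projection_apply_eq_zero_iff h).2 x.2
    rw [← LinearMap.comp_apply, ← LinearMap.lTensor_comp, e]
    simp
  have key' : ∀ {i j : ZMod 2} (h : IsCompl
      (CliffordAlgebra.evenOdd (0 : QuadraticForm ℂ (Fin n → ℂ)) i)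
      (CliffordAlgebra.evenOdd (0 : QuadraticForm ℂ (Fin n → ℂ)) j)) (z),
      LinearMap.lTensor (MvPolynomial (Fin m) ℂ) (Submodule.projection _ _ h) z ∈
        Tpart m n i := by
    intro i j h z
    refine ⟨LinearMap.lTensor (MvPolynomial (Fin m) ℂ) (Submodule.projectionOnto _ _ h) z, ?_⟩
    rw [← LinearMap.comp_apply, ← LinearMap.lTensor_comp]
    rfl
  have hid : Submodule.projection _ _ hc + Submodule.projection _ _ hc.symm =
      LinearMap.id := by
    refine LinearMap.ext fun x => ?_
    simpa using Submodule.projection_add_projection_eq_self hc x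
  have hsum : ∀ z, LinearMap.lTensor (MvPolynomial (Fin m) ℂ) (Submodule.projection _ _ hc) z +
      LinearMap.lTensor (MvPolynomial (Fin m) ℂ) (Submodule.projection _ _ hc.symm) z = z := by
    intro z
    rw [← LinearMap.add_apply, ← LinearMap.lTensor_add, hid]
    simp
  constructor
  · rw [Submodule.disjoint_def]
    intro z h0 h1
    rw [← hsum z, key hc z h1, key hc.symm z h0, add_zero]
  · rw [codisjoint_iff, eq_top_iff]
    intro z _
    exact Submodule.mem_sup.2 ⟨_, key' hc z, _, key' hc.symm z, hsum z⟩

theorem Apart_isCompl (m n : ℕ) : IsCompl (Apart m n 0) (Apart m n 1) :=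
  (Tpart_isCompl m n).map (Submodule.orderIsoMapComap (toA m n))

/-- The superspace `A_{m,n}`. -/
def Agrading (m n : ℕ) : Superspace (A m n) := ⟨Apart m n, Apart_isCompl m n⟩

/-- The super-derivations of parity `i` of `A_{m,n}`: the operators `D` of parity `i` with
`D(ab) = D(a) b + (-1)^{i|a|} a D(b)`. -/
def Wpart (m n : ℕ) (i : ZMod 2) : Submodule ℂ (Module.End ℂ (A m n)) where
  carrier := {D | (∀ j, ∀ a ∈ Apart m n j, D a ∈ Apart m n (i + j)) ∧
    ∀ j, ∀ a ∈ Apart m n j, ∀ b, D (a * b) = D a * b + sgn (i * j) • (a * D b)}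
  add_mem' := by
    rintro D D' ⟨h1, h2⟩ ⟨h1', h2'⟩
    refine ⟨fun j a ha => Submodule.add_mem _ (h1 j a ha) (h1' j a ha), fun j a ha b => ?_⟩
    simp only [LinearMap.add_apply, h2 j a ha b, h2' j a ha b, add_mul, mul_add, smul_add]
    abel
  zero_mem' := by simp
  smul_mem' := by
    rintro c D ⟨h1, h2⟩
    refine ⟨fun j a ha => Submodule.smul_mem _ _ (h1 j a ha), fun j a ha b => ?_⟩
    simp only [LinearMap.smul_apply, h2 j a ha b, smul_add, smul_mul_assoc, mul_smul_comm]
    rw [smul_comm c]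

/-- The Lie superalgebra `W_{m,n}` of super-derivations of `A_{m,n}`. -/
def W (m n : ℕ) : LieSuper (Agrading m n) where
  part := Wpart m n
  parity_mem hf hv := hf.1 _ _ hv
  bracket_mem := by
    rintro i j f f' ⟨h1, h2⟩ ⟨h1', h2'⟩
    refine ⟨fun k a ha => ?_, fun k a ha b => ?_⟩
    · have e1 := h1 _ _ (h1' k a ha)
      have e2 := h1' _ _ (h1 k a ha)
      rw [show j + (i + k) = i + j + k by ring] at e2
      rw [← add_assoc] at e1
      exact Submodule.sub_mem _ e1 (Submodule.smul_mem _ _ e2)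
    · simp only [LinearMap.sub_apply, LinearMap.smul_apply, Module.End.mul_apply,
        h2 k a ha b, h2' k a ha b, map_add, map_smul, h2 _ _ (h1' k a ha), h2' _ _ (h1 k a ha),
        h2 k a ha, h2' k a ha, mul_add, add_mul, sgn_add, sub_mul, mul_sub, smul_add, smul_sub,
        smul_smul, smul_mul_assoc, mul_smul_comm]
      rw [mul_comm j i]
      have hs := sgn_mul_self (i * j)
      match_scalars <;> first
        | ring1
        | linear_combination (-sgn (j * k)) * hs

/-- The operator `t_i ∂/∂t_i ⊗ 1` on `ℂ[t] ⊗ Λ(n)`. -/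
def dT (m n : ℕ) (i : Fin m) :
    Module.End ℂ (MvPolynomial (Fin m) ℂ ⊗[ℂ] ExteriorAlgebra ℂ (Fin n → ℂ)) :=
  LinearMap.rTensor (ExteriorAlgebra ℂ (Fin n → ℂ))
    (LinearMap.mulLeft ℂ (MvPolynomial.X i) ∘ₗ (MvPolynomial.pderiv i).toLinearMap)

/-- The even derivation `d_i = t_i ∂/∂t_i` of `A_{m,n}`, for `i ≤ m`. -/
def d (m n : ℕ) (i : Fin m) : Module.End ℂ (A m n) :=
  (toA m n).toLinearMap ∘ₗ dT m n i ∘ₗ (toA m n).symm.toLinearMap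

theorem d_toA (m n : ℕ) (i : Fin m) (x) : d m n i (toA m n x) = toA m n (dT m n i x) := by
  simp [d]

theorem dT_tmul (m n : ℕ) (i : Fin m) (f : MvPolynomial (Fin m) ℂ)
    (ω : ExteriorAlgebra ℂ (Fin n → ℂ)) :
    dT m n i (f ⊗ₜ[ℂ] ω) = (MvPolynomial.X i * MvPolynomial.pderiv i f) ⊗ₜ[ℂ] ω := rfl

theorem dT_mul (m n : ℕ) (i : Fin m)
    (a b : MvPolynomial (Fin m) ℂ ⊗[ℂ] ExteriorAlgebra ℂ (Fin n → ℂ)) :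
    dT m n i (a * b) = dT m n i a * b + a * dT m n i b := by
  induction a using TensorProduct.induction_on with
  | zero => simp
  | add x y hx hy => simp only [add_mul, map_add, hx, hy]; abel
  | tmul f ω =>
    induction b using TensorProduct.induction_on with
    | zero => simp
    | add x y hx hy => simp only [mul_add, map_add, hx, hy]; abel
    | tmul f' ω' =>
      simp only [dT_tmul, Algebra.TensorProduct.tmul_mul_tmul, Derivation.leibniz,
        smul_eq_mul, ← TensorProduct.add_tmul]
      congr 1
      ring

theorem d_mem (m n : ℕ) (i : Fin m) : d m n i ∈ (W m n).part 0 := by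
  refine ⟨?_, fun j a _ b => ?_⟩
  · rintro j _ ⟨_, ⟨z, rfl⟩, rfl⟩
    rw [zero_add]
    refine ⟨_, ⟨LinearMap.rTensor _ (LinearMap.mulLeft ℂ (MvPolynomial.X i) ∘ₗ
      (MvPolynomial.pderiv i).toLinearMap) z, rfl⟩, ?_⟩
    rw [LinearEquiv.coe_coe, d_toA, dT, ← LinearMap.comp_apply, ← LinearMap.comp_apply,
      LinearMap.lTensor_comp_rTensor, LinearMap.rTensor_comp_lTensor]
  · obtain ⟨a, rfl⟩ := (toA m n).surjective a
    obtain ⟨b, rfl⟩ := (toA m n).surjective b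
    rw [← toA_mul, d_toA, dT_mul, map_add, toA_mul, toA_mul, d_toA, d_toA]
    simp [sgn]

theorem pderiv_comm_aux {m : ℕ} (i k : Fin m) (f : MvPolynomial (Fin m) ℂ) :
    MvPolynomial.X k * MvPolynomial.pderiv k (MvPolynomial.X i * MvPolynomial.pderiv i f) =
      MvPolynomial.X i * MvPolynomial.pderiv i (MvPolynomial.X k * MvPolynomial.pderiv k f) := by
  induction f using MvPolynomial.induction_on' with
  | add p q hp hq => simp only [map_add, mul_add, hp, hq]
  | monomial s c =>
    rw [MvPolynomial.X_mul_pderiv_monomial, MvPolynomial.X_mul_pderiv_monomial, map_nsmul,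
      map_nsmul, mul_smul_comm, mul_smul_comm, MvPolynomial.X_mul_pderiv_monomial,
      MvPolynomial.X_mul_pderiv_monomial, smul_comm]

theorem dT_comm (m n : ℕ) (i k : Fin m) (x) :
    dT m n k (dT m n i x) = dT m n i (dT m n k x) := by
  induction x using TensorProduct.induction_on with
  | zero => simp only [map_zero]
  | add x y hx hy => rw [map_add, map_add, map_add, map_add, hx, hy]
  | tmul f ω => rw [dT_tmul, dT_tmul, dT_tmul, dT_tmul, pderiv_comm_aux]

theorem d_comm (m n : ℕ) (i k : Fin m) : d m n k * d m n i = d m n i * d m n k := by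
  refine LinearMap.ext fun x => ?_
  obtain ⟨x, rfl⟩ := (toA m n).surjective x
  simp only [Module.End.mul_apply, d_toA, dT_comm m n i k]

/-! ### Weights

A weight `λ ∈ 𝔥*`, where `𝔥 = span {d₁, …, d_m}`, is given by its values `λ(d_i)`; the dual basis
`ε₁, …, ε_m` is the standard basis of `ℂ^m`. -/

/-- The space `𝔥*` of weights. -/
abbrev Wt (m : ℕ) : Type := Fin m → ℂ

/-- `g` contains the Cartan subalgebra `𝔥`. -/
def HasCartan {m n : ℕ} (g : LieSuper (Agrading m n)) : Prop := ∀ i, d m n i ∈ g.part 0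

section Weights

variable {m n : ℕ} {g : LieSuper (Agrading m n)} (hg : HasCartan g)
  {M : Type v} [AddCommGroup M] [Module ℂ M] (ρ : SuperModule g M)

/-- The weight space `M_μ`. -/
def weightSpace (μ : Wt m) : Submodule ℂ M :=
  ⨅ i : Fin m, LinearMap.ker (ρ.act 0 ⟨d m n i, hg i⟩ - μ i • LinearMap.id)

theorem mem_weightSpace {μ : Wt m} {v : M} :
    v ∈ weightSpace hg ρ μ ↔ ∀ i, ρ.act 0 ⟨d m n i, hg i⟩ v = μ i • v := by
  simp [weightSpace, sub_eq_zero]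

/-- The support of `M`. -/
def supp : Set (Wt m) := {μ | weightSpace hg ρ μ ≠ ⊥}

/-- `M` is a weight module (`𝔥` acts diagonalizably). -/
def IsWeight : Prop := ⨆ μ, weightSpace hg ρ μ = ⊤

/-- `M` is a weight module with finite-dimensional weight spaces. -/
def IsHarishChandra : Prop :=
  IsWeight hg ρ ∧ ∀ μ, FiniteDimensional ℂ (weightSpace hg ρ μ)

/-- `M` is a weight module whose weight spaces have uniformly bounded dimensions. -/
def IsBounded : Prop :=
  IsHarishChandra hg ρ ∧ ∃ c : ℕ, ∀ μ, Module.finrank ℂ (weightSpace hg ρ μ) ≤ c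

end Weights

/-! ### Roots -/

/-- The elements of parity `j` of `W_α`: those of weight `α` for the adjoint action of `𝔥`. -/
def rootSpace (m n : ℕ) (α : Wt m) (j : ZMod 2) : Submodule ℂ (Module.End ℂ (A m n)) where
  carrier := {x | x ∈ (W m n).part j ∧ ∀ i, d m n i * x - x * d m n i = α i • x}
  add_mem' := by
    rintro x y ⟨hx, hx'⟩ ⟨hy, hy'⟩
    refine ⟨Submodule.add_mem _ hx hy, fun i => ?_⟩
    rw [smul_add, ← hx', ← hy', mul_add, add_mul]
    abel
  zero_mem' := ⟨Submodule.zero_mem _, by simp⟩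
  smul_mem' := by
    rintro c x ⟨hx, hx'⟩
    refine ⟨Submodule.smul_mem _ _ hx, fun i => ?_⟩
    rw [smul_comm, ← hx', mul_smul_comm, smul_mul_assoc, smul_sub]

theorem rootSpace_bracket {m n : ℕ} {α β : Wt m} {i j : ZMod 2} {x y : Module.End ℂ (A m n)}
    (hx : x ∈ rootSpace m n α i) (hy : y ∈ rootSpace m n β j) :
    x * y - sgn (i * j) • (y * x) ∈ rootSpace m n (α + β) (i + j) := by
  refine ⟨(W m n).bracket_mem hx.1 hy.1, fun k => ?_⟩
  have e1 : d m n k * x = x * d m n k + α k • x := by rw [← hx.2 k]; abel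
  have e2 : d m n k * y = y * d m n k + β k • y := by rw [← hy.2 k]; abel
  have e3 : d m n k * (x * y) = x * y * d m n k + (α k + β k) • (x * y) := by
    rw [← mul_assoc, e1, add_mul, mul_assoc, e2, mul_add, smul_mul_assoc, mul_smul_comm,
      mul_assoc, add_smul]
    abel
  have e4 : d m n k * (y * x) = y * x * d m n k + (α k + β k) • (y * x) := by
    rw [← mul_assoc, e2, add_mul, mul_assoc, e1, mul_add, smul_mul_assoc, mul_smul_comm,
      mul_assoc, add_smul]
    abel
  rw [mul_sub, mul_smul_comm, e3, e4, sub_mul, smul_mul_assoc, Pi.add_apply]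
  module

/-- The set `Δ` of roots of `W_{m,n}`. -/
def Root (m n : ℕ) : Set (Wt m) := {α | α ≠ 0 ∧ ∃ j, rootSpace m n α j ≠ ⊥}

/-- The Lie superalgebra `⨁_{α ∈ T} W_α`, for a set `T ⊆ 𝔥*` such that a sum of two elements of
`T` which is a root or zero is in `T`. -/
def ofRoots {m n : ℕ} (T : Set (Wt m))
    (hT : ∀ α ∈ T, ∀ β ∈ T, α + β ∈ insert 0 (Root m n) → α + β ∈ T) :
    LieSuper (Agrading m n) where
  part j := ⨆ α ∈ T, rootSpace m n α j
  parity_mem := by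
    intro i j f v hf hv
    have : (⨆ α ∈ T, rootSpace m n α i) ≤ (W m n).part i := iSup₂_le fun α _ x hx => hx.1
    exact (W m n).parity_mem (this hf) hv
  bracket_mem := by
    intro i j f f' hf hf'
    have key : ∀ α ∈ T, ∀ β ∈ T, ∀ x ∈ rootSpace m n α i, ∀ y ∈ rootSpace m n β j,
        x * y - sgn (i * j) • (y * x) ∈ ⨆ α ∈ T, rootSpace m n α (i + j) := by
      intro α hα β hβ x hx y hy
      have hxy := rootSpace_bracket hx hy
      by_cases h : α + β ∈ insert 0 (Root m n)
      · exact Submodule.mem_iSup_of_mem (α + β)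
          (Submodule.mem_iSup_of_mem (hT α hα β hβ h) hxy)
      · have hb : rootSpace m n (α + β) (i + j) = ⊥ := by
          by_contra hne
          exact h (Set.mem_insert_iff.2
            (or_iff_not_imp_left.2 fun h0 => ⟨h0, _, hne⟩))
        rw [hb, Submodule.mem_bot] at hxy
        rw [hxy]
        exact Submodule.zero_mem _
    have step : ∀ α ∈ T, ∀ x ∈ rootSpace m n α i,
        x * f' - sgn (i * j) • (f' * x) ∈ ⨆ α ∈ T, rootSpace m n α (i + j) := by
      intro α hα x hx
      have hle : (⨆ β ∈ T, rootSpace m n β j) ≤ (⨆ α ∈ T, rootSpace m n α (i + j)).comap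
          (LinearMap.mulLeft ℂ x - sgn (i * j) • LinearMap.mulRight ℂ x) :=
        iSup₂_le fun β hβ y hy => key α hα β hβ x hx y hy
      exact hle hf'
    have hle : (⨆ α ∈ T, rootSpace m n α i) ≤ (⨆ α ∈ T, rootSpace m n α (i + j)).comap
        (LinearMap.mulRight ℂ f' - sgn (i * j) • LinearMap.mulLeft ℂ f') :=
      iSup₂_le fun α hα x hx => step α hα x hx
    exact hle hf

theorem ofRoots_isSub {m n : ℕ} {T T' : Set (Wt m)} {hT hT'} (h : T ⊆ T') :
    (ofRoots (n := n) T hT).IsSub (ofRoots T' hT') :=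
  fun i => biSup_mono (f := fun α => rootSpace m n α i) fun _ hα => h hα

theorem ofRoots_isSub_W {m n : ℕ} {T : Set (Wt m)} {hT} :
    (ofRoots (n := n) T hT).IsSub (W m n) :=
  fun i => iSup₂_le fun α _ x (hx : x ∈ rootSpace m n α i) => hx.1

theorem ofRoots_hasCartan {m n : ℕ} {T : Set (Wt m)} {hT} (h0 : 0 ∈ T) :
    HasCartan (ofRoots (n := n) T hT) := by
  intro i
  have h : d m n i ∈ rootSpace m n 0 0 := ⟨d_mem m n i, fun k => by simp [d_comm m n i k]⟩
  exact Submodule.mem_iSup_of_mem (p := fun α => ⨆ _ : α ∈ T, rootSpace m n α 0) 0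
    (Submodule.mem_iSup_of_mem (p := fun _ : (0 : Wt m) ∈ T => rootSpace m n 0 0) h0 h)

theorem W_hasCartan (m n : ℕ) : HasCartan (W m n) := d_mem m n

section Parabolic

variable {m : ℕ}

/-- `ε_i ∈ 𝔥*`. -/
def ε (i : Fin m) : Wt m := Pi.single i 1

/-- The root set `Δ' = {ε_i - ε_j, ε_i, -ε_i | i ≠ j}` of `𝔰𝔩_{m+1} ⊆ W_{m,0}`. -/
def Root' (m : ℕ) : Set (Wt m) :=
  {α | (∃ i j, i ≠ j ∧ α = ε i - ε j) ∨ (∃ i, α = ε i) ∨ ∃ i, α = -ε i}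

/-- The invariant bilinear form `(·, ·)` on `𝔥*` (as the Cartan subalgebra of `𝔰𝔩_{m+1}`), with
`(ε_i, ε_i) = 2` and `(ε_i, ε_j) = 1` for `i ≠ j`. For a root `α ∈ Δ'`, `(μ, α)` is the value of `μ`
at the coroot of `α`. -/
def form (μ ν : Wt m) : ℂ := ∑ i, μ i * ν i + (∑ i, μ i) * ∑ i, ν i

/-! In what follows `S` is the support of a module. -/

variable (S : Set (Wt m)) (μ : Wt m)

/-- The set `{q ∈ ℝ | μ + q α ∈ S}`. -/
def rootString (α : Wt m) : Set ℝ := {q | μ + (q : ℂ) • α ∈ S}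

/-- `Δ'^F`: the roots of `Δ'` in whose direction the support is bounded on both sides. -/
def RootF : Set (Wt m) :=
  {α | α ∈ Root' m ∧ BddAbove (rootString S μ α) ∧ BddBelow (rootString S μ α)}

/-- `Δ'^I`: the roots of `Δ'` in whose direction the support is unbounded on both sides. -/
def RootI : Set (Wt m) :=
  {α | α ∈ Root' m ∧ ¬BddAbove (rootString S μ α) ∧ ¬BddBelow (rootString S μ α)}

/-- `K_μ = {α ∈ Δ' | μ + α ∉ S}`. -/
def K : Set (Wt m) := {α | α ∈ Root' m ∧ μ + α ∉ S}

/-- `μ ∈ S` is extremal: `K_μ` is not a proper subset of any `K_ν`, `ν ∈ S`. -/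
def IsExtremal : Prop := μ ∈ S ∧ ∀ ν ∈ S, ¬K S μ ⊂ K S ν

/-- `Δ'^{F,0} = {α ∈ Δ'^F | (μ, α) = 0}`. -/
def RootF0 : Set (Wt m) := {α | α ∈ RootF S μ ∧ form μ α = 0}

/-- `R = P ⊔ Q` is a triangular decomposition of the set `R`: the cones generated by `-P ∪ Q` and
by `-Q ∪ P` meet only in `0`. -/
def IsTriangular (R P Q : Set (Wt m)) : Prop :=
  R = P ∪ Q ∧ Disjoint P Q ∧
    (Submodule.span NNReal ({α | -α ∈ P} ∪ Q) : Set (Wt m)) ∩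
      (Submodule.span NNReal ({α | -α ∈ Q} ∪ P) : Set (Wt m)) = {0}

variable (P : Set (Wt m))

/-- The set `Δ'^+` of positive roots determined by the positive part `P` of a triangular
decomposition of `Δ'^{F,0}`: the union of `K_μ \ (K_μ ∩ -K_μ)` and `P`. -/
def posRoot' : Set (Wt m) := {α | α ∈ K S μ ∧ -α ∉ K S μ} ∪ P

/-- `Δ⁰ = Δ ∩ ⟨Δ'^I⟩_ℤ`. -/
def zeroRoot (n : ℕ) : Set (Wt m) := Root m n ∩ AddSubgroup.closure (RootI S μ)

/-- `Δ⁺ = (Δ ∩ ⟨Δ'^+ ⊔ Δ'^I⟩_{ℤ₊}) \ Δ⁰`. -/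
def posRoot (n : ℕ) : Set (Wt m) :=
  (Root m n ∩ AddSubmonoid.closure (posRoot' S μ P ∪ RootI S μ)) \ zeroRoot S μ n

theorem neg_mem_Root' {α : Wt m} (h : α ∈ Root' m) : -α ∈ Root' m := by
  rcases h with ⟨i, j, hij, rfl⟩ | ⟨i, rfl⟩ | ⟨i, rfl⟩
  · exact Or.inl ⟨j, i, hij.symm, by simp⟩
  · exact Or.inr (Or.inr ⟨i, rfl⟩)
  · exact Or.inr (Or.inl ⟨i, by simp⟩)

theorem rootString_neg (α : Wt m) : rootString S μ (-α) = -rootString S μ α := by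
  ext q
  simp [rootString]

theorem neg_mem_RootI {α : Wt m} (h : α ∈ RootI S μ) : -α ∈ RootI S μ := by
  refine ⟨neg_mem_Root' h.1, ?_, ?_⟩
  · rw [rootString_neg, bddAbove_neg]; exact h.2.2
  · rw [rootString_neg, bddBelow_neg]; exact h.2.1

theorem closure_RootI_le :
    (AddSubgroup.closure (RootI S μ)).toAddSubmonoid ≤
      AddSubmonoid.closure (posRoot' S μ P ∪ RootI S μ) := by
  rw [AddSubgroup.closure_toAddSubmonoid, AddSubmonoid.closure_le]
  rintro α (h | h)
  · exact AddSubmonoid.subset_closure (Or.inr h)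
  · refine AddSubmonoid.subset_closure (Or.inr ?_)
    simpa using neg_mem_RootI S μ (α := -α) h

theorem zeroRoot_closed (n : ℕ) :
    ∀ α ∈ insert 0 (zeroRoot S μ n), ∀ β ∈ insert 0 (zeroRoot S μ n),
      α + β ∈ insert 0 (Root m n) → α + β ∈ insert 0 (zeroRoot S μ n) := by
  have h : ∀ α ∈ insert 0 (zeroRoot S μ n), α ∈ AddSubgroup.closure (RootI S μ) := by
    rintro α (rfl | h)
    · exact zero_mem _
    · exact h.2
  intro α hα β hβ hab
  rcases hab with h0 | hr
  · exact Or.inl h0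
  · exact Or.inr ⟨hr, add_mem (h α hα) (h β hβ)⟩

theorem parabolic_closed (n : ℕ) :
    ∀ α ∈ insert 0 (zeroRoot S μ n ∪ posRoot S μ P n),
      ∀ β ∈ insert 0 (zeroRoot S μ n ∪ posRoot S μ P n),
        α + β ∈ insert 0 (Root m n) → α + β ∈ insert 0 (zeroRoot S μ n ∪ posRoot S μ P n) := by
  have h : ∀ α ∈ insert 0 (zeroRoot S μ n ∪ posRoot S μ P n),
      α ∈ AddSubmonoid.closure (posRoot' S μ P ∪ RootI S μ) := by
    rintro α (rfl | h | h)
    · exact zero_mem _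
    · exact closure_RootI_le S μ P h.2
    · exact h.1.2
  intro α hα β hβ hab
  rcases hab with h0 | hr
  · exact Or.inl h0
  · refine Or.inr ?_
    by_cases hz : α + β ∈ zeroRoot S μ n
    · exact Or.inl hz
    · exact Or.inr ⟨⟨hr, add_mem (h α hα) (h β hβ)⟩, hz⟩

/-- The parabolic subalgebra `𝔭 = W_0 ⊕ ⨁_{α ∈ Δ⁰ ⊔ Δ⁺} W_α`. -/
def parabolic (n : ℕ) : LieSuper (Agrading m n) :=
  ofRoots (insert 0 (zeroRoot S μ n ∪ posRoot S μ P n)) (parabolic_closed S μ P n)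

/-- The Levi subalgebra `W_0 ⊕ ⨁_{α ∈ Δ⁰} W_α` of the parabolic subalgebra. -/
def levi (n : ℕ) : LieSuper (Agrading m n) :=
  ofRoots (insert 0 (zeroRoot S μ n)) (zeroRoot_closed S μ n)

theorem parabolic_isSub (n : ℕ) : (parabolic S μ P n).IsSub (W m n) := ofRoots_isSub_W

theorem levi_isSub (n : ℕ) : (levi S μ n).IsSub (parabolic S μ P n) :=
  ofRoots_isSub (Set.insert_subset_insert Set.subset_union_left)

theorem parabolic_hasCartan (n : ℕ) : HasCartan (parabolic S μ P n) :=
  ofRoots_hasCartan (Set.mem_insert _ _)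

theorem levi_hasCartan (n : ℕ) : HasCartan (levi S μ n) :=
  ofRoots_hasCartan (Set.mem_insert _ _)

end Parabolic

end CartanW

end

/-! Let S be the support of M. With one extra node of weight `0`, the roots of `𝔰𝔩_{m+1}` are the
differences of the weights of `m + 1` nodes, so a direction in `Δ'` is an ordered pair of distinct
nodes. The root vectors `∂_j` and `t_i ∂_j` (`i ≠ j`) are ad-nilpotent on `W`, hence act on the
simple module M injectively or locally nilpotently. In the first case S is stable under the shift by
the root; in the second, 𝔰𝔩₂-theory and finite-dimensionality bound S in that direction. For `∂_i`
there is more: if it is locally nilpotent and M is nontrivial, then S is stable under `+ε_i`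
(`IsSimple.add_ε_of_nilpotent`). Together this is `SuppShape`: every direction is shift-stable or
bounded, the pairs bounded on both sides are of the form `ε_a - ε_b`, and along those S is made of
𝔰𝔩₂-strings, hence invariant under the transposition of `a` and `b`.

The remaining argument about S is combinatorial. Call a root strict if S is stable under its
negative but not under the root itself. A weight reached with the largest possible number of strict
roots, and then of largest length among those, blocks all strict roots and all finite roots on which
it is nonnegative; enlarging its set K to a maximal one makes it extremal (`exists_extremal`).
Suppose such a weight plus a sum of positive roots and roots of `Δ'^I` lies in S. Strict summands
can be cancelled because S is stable under their negatives, finite ones by the string property, and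
what survives contradicts blocking unless the sum is in the lattice R generated by `Δ'^I`
(`IsBlocked.add_not_mem`).

A root of W is a nonnegative integral combination of the `ε_k` minus the weight of one node. A
triangular decomposition makes the nodes totally preordered, and a lexicographic order built from
this preorder shows that a root outside the parabolic set lies in a set closed under addition,
stable under R and disjoint from R (`IsBlocked.exists_negative`). This is the triangular structure
of W needed here.

Now N is the sum of the weight spaces of M over the coset `λ + R`. Positive root spaces kill it. A
subspace of N stable under the parabolic generates a W-submodule which, modulo that subspace, has
only weights in the negative set (`exists_submodule`); this replaces the PBW theorem. It yields both
the simplicity of N over the Levi subalgebra and the uniqueness of the maximal submodule of the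
induced module. The weight spaces of N have equal dimension because root vectors in the directions
of `Δ'^I` act bijectively. -/

noncomputable section

namespace CartanW

/-! ### Nodes, shifts, and the shape of the support -/

section Combinatorics

variable {m : ℕ}

/-- The weights `ε_i`, together with `ε_none = 0`. -/
def nodeWt : Option (Fin m) → Wt m
  | none => 0
  | some i => ε i

/-- The elements of `Δ'` are the differences of distinct `nodeWt`s. -/
def nodeRoot (i j : Option (Fin m)) : Wt m := nodeWt i - nodeWt j

theorem nodeRoot_some (a b : Fin m) : nodeRoot (some a) (some b) = ε a - ε b := rfl

theorem neg_nodeRoot (i j : Option (Fin m)) : -nodeRoot i j = nodeRoot j i := by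
  simp [nodeRoot]

theorem nodeRoot_add (i j k : Option (Fin m)) : nodeRoot i j + nodeRoot j k = nodeRoot i k := by
  simp [nodeRoot]

theorem nodeRoot_self (i : Option (Fin m)) : nodeRoot i i = 0 := by simp [nodeRoot]

theorem mem_Root'_iff {α : Wt m} : α ∈ Root' m ↔ ∃ i j, i ≠ j ∧ α = nodeRoot i j := by
  constructor
  · rintro (⟨i, j, hij, rfl⟩ | ⟨i, rfl⟩ | ⟨i, rfl⟩)
    · exact ⟨some i, some j, by simpa using hij, rfl⟩
    · exact ⟨some i, none, by simp, by simp [nodeRoot, nodeWt]⟩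
    · exact ⟨none, some i, by simp, by simp [nodeRoot, nodeWt]⟩
  · rintro ⟨i | i, j | j, hij, rfl⟩
    · exact absurd rfl hij
    · exact Or.inr (Or.inr ⟨j, by simp [nodeRoot, nodeWt]⟩)
    · exact Or.inr (Or.inl ⟨i, by simp [nodeRoot, nodeWt]⟩)
    · exact Or.inl ⟨i, j, by simpa using hij, rfl⟩

theorem nodeWt_apply (i : Option (Fin m)) (a : Fin m) :
    nodeWt i a = if i = some a then 1 else 0 := by
  rcases i with _ | i
  · simp [nodeWt]
  · by_cases h : i = a
    · subst h; simp [nodeWt, ε]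
    · simp [nodeWt, ε, h, Ne.symm h]

theorem ε_apply (i a : Fin m) : ε i a = if i = a then 1 else 0 := by
  have := nodeWt_apply (some i) a
  simpa [nodeWt] using this

theorem exists_nodeRoot_coord {i j : Option (Fin m)} (h : i ≠ j) :
    ∃ a, nodeRoot i j a = 1 ∨ nodeRoot i j a = -1 := by
  rcases i with _ | i
  · rcases j with _ | j
    · exact absurd rfl h
    · exact ⟨j, Or.inr (by simp [nodeRoot, nodeWt_apply])⟩
  · exact ⟨i, Or.inl (by simp [nodeRoot, nodeWt_apply, Ne.symm h])⟩

theorem nodeRoot_ne_zero {i j : Option (Fin m)} (h : i ≠ j) : nodeRoot i j ≠ 0 := by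
  intro h0
  obtain ⟨a, ha⟩ := exists_nodeRoot_coord h
  simp [h0] at ha

theorem finite_Root' : (Root' m).Finite := by
  have : Root' m ⊆ Set.range fun p : Option (Fin m) × Option (Fin m) => nodeRoot p.1 p.2 := by
    intro α hα
    obtain ⟨i, j, -, rfl⟩ := mem_Root'_iff.1 hα
    exact ⟨(i, j), rfl⟩
  exact (Set.finite_range _).subset this

/-- The integral weight with given coordinates. -/
def intWt : (Fin m → ℤ) →+ Wt m where
  toFun z i := (z i : ℂ)
  map_zero' := by ext; simp
  map_add' := by intros; ext; simp

theorem intWt_apply (z : Fin m → ℤ) (i : Fin m) : intWt z i = (z i : ℂ) := rfl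

theorem intWt_injective : Function.Injective (intWt (m := m)) := by
  intro z z' h
  ext i
  have := congrFun h i
  simpa [intWt_apply] using this

/-- The coordinates of `nodeWt`. -/
def nodeInt (i : Option (Fin m)) : Fin m → ℤ := fun a => if i = some a then 1 else 0

theorem intWt_nodeInt (i : Option (Fin m)) : intWt (nodeInt i) = nodeWt i := by
  ext a
  rw [intWt_apply, nodeInt, nodeWt_apply]
  split_ifs <;> simp

theorem nodeWt_swap {a b : Fin m} {k : Option (Fin m)} :
    nodeWt k ∘ Equiv.swap a b = nodeWt (k.map (Equiv.swap a b)) := by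
  ext i
  simp only [Function.comp_apply, nodeWt_apply]
  rcases k with _ | k
  · simp
  · simp [← Equiv.swap_apply_eq_iff]

/-- `S` is stable under the translation by `nodeRoot i j`. -/
def ShiftClosed (S : Set (Wt m)) (i j : Option (Fin m)) : Prop :=
  ∀ μ ∈ S, μ + nodeRoot i j ∈ S

theorem ShiftClosed.refl (S : Set (Wt m)) (i : Option (Fin m)) : ShiftClosed S i i := by
  intro μ hμ
  simpa [nodeRoot_self] using hμ

theorem ShiftClosed.trans {S : Set (Wt m)} {i j k : Option (Fin m)} (h : ShiftClosed S i j)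
    (h' : ShiftClosed S j k) : ShiftClosed S i k := by
  intro μ hμ
  rw [← nodeRoot_add i j k, ← add_assoc]
  exact h' _ (h _ hμ)

theorem ShiftClosed.nsmul {S : Set (Wt m)} {i j : Option (Fin m)} (h : ShiftClosed S i j)
    {μ : Wt m} (hμ : μ ∈ S) (k : ℕ) : μ + k • nodeRoot i j ∈ S := by
  induction k with
  | zero => simpa using hμ
  | succ k ih =>
    rw [succ_nsmul, ← add_assoc]
    exact h _ ih

/-- `S` is stable under neither of the translations by `±nodeRoot i j`. -/
def FinPair (S : Set (Wt m)) (i j : Option (Fin m)) : Prop :=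
  ¬ShiftClosed S i j ∧ ¬ShiftClosed S j i

theorem FinPair.symm {S : Set (Wt m)} {i j : Option (Fin m)} (h : FinPair S i j) :
    FinPair S j i := ⟨h.2, h.1⟩

theorem FinPair.ne {S : Set (Wt m)} {i j : Option (Fin m)} (h : FinPair S i j) : i ≠ j := by
  rintro rfl
  exact h.1 (ShiftClosed.refl S i)

/-- The properties of the support of a simple nontrivial weight module which determine its
shape. -/
structure SuppShape (S : Set (Wt m)) : Prop where
  nonempty : S.Nonempty
  integral : ∀ μ ∈ S, ∀ ν ∈ S, ∃ z, ν = μ + intWt z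
  closed_or_bounded : ∀ i j, i ≠ j → ShiftClosed S i j ∨
    ∀ μ, ∃ B : ℕ, ∀ k : ℕ, B ≤ k → μ + k • nodeRoot i j ∉ S
  closed_none : ∀ i : Fin m, ShiftClosed S (some i) none ∨ ShiftClosed S none (some i)
  string : ∀ a b : Fin m, FinPair S (some a) (some b) → ∀ μ ∈ S, ∃ κ : ℤ, μ a - μ b = κ ∧
    ∀ t : ℕ, (t : ℤ) ≤ κ → μ - t • nodeRoot (some a) (some b) ∈ S

namespace SuppShape

variable {S : Set (Wt m)} (hS : SuppShape S)
include hS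

/-- By `closed_none` the node `none` is in no finite pair, so every reflection in a finite root is a
transposition of two coordinates. -/
theorem exists_some {i j : Option (Fin m)} (h : FinPair S i j) :
    ∃ a b, i = some a ∧ j = some b := by
  rcases i with _ | i <;> rcases j with _ | j
  · exact absurd rfl h.ne
  · rcases hS.closed_none j with h' | h'
    · exact absurd h' h.2
    · exact absurd h' h.1
  · rcases hS.closed_none i with h' | h'
    · exact absurd h' h.1
    · exact absurd h' h.2
  · exact ⟨i, j, rfl, rfl⟩

theorem sub_mem {a b : Fin m} (h : FinPair S (some a) (some b)) {μ : Wt m} (hμ : μ ∈ S)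
    (hlt : 0 < (μ a - μ b).re) : μ - (ε a - ε b) ∈ S := by
  obtain ⟨κ, hκ, hs⟩ := hS.string a b h μ hμ
  rw [hκ] at hlt
  have h1 : (0 : ℤ) < κ := by simpa using hlt
  simpa [nodeRoot_some] using hs 1 (by push_cast; omega)

/-- The 𝔰𝔩₂-reflection: for `κ = μ a - μ b ≥ 0` the last element `μ - κ (ε_a - ε_b)` of the string
is `μ` with its coordinates `a` and `b` exchanged. For `κ ≤ 0` the roles of `a` and `b` are
exchanged. -/
theorem swap_mem {a b : Fin m} (h : FinPair S (some a) (some b)) {μ : Wt m} (hμ : μ ∈ S) :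
    μ ∘ Equiv.swap a b ∈ S := by
  have key : ∀ a b : Fin m, FinPair S (some a) (some b) → ∀ κ : ℤ, μ a - μ b = κ → 0 ≤ κ →
      (∀ t : ℕ, (t : ℤ) ≤ κ → μ - t • nodeRoot (some a) (some b) ∈ S) →
        μ ∘ Equiv.swap a b ∈ S := by
    intro a b h κ hκ h0 hs
    have hab : a ≠ b := fun e => h.ne (by rw [e])
    have := hs κ.toNat (by simp [h0])
    convert this using 1
    have hk : ((κ.toNat : ℕ) : ℂ) = μ a - μ b := by
      rw [hκ]; exact_mod_cast Int.toNat_of_nonneg h0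
    ext i
    rw [Function.comp_apply, Pi.sub_apply, Pi.smul_apply, nsmul_eq_mul, hk, nodeRoot_some,
      Pi.sub_apply, ε_apply, ε_apply]
    by_cases hia : i = a
    · subst hia; simp [hab.symm]
    · by_cases hib : i = b
      · subst hib; simp [hab]
      · simp [Equiv.swap_apply_of_ne_of_ne hia hib, Ne.symm hia, Ne.symm hib]
  obtain ⟨κ, hκ, hs⟩ := hS.string a b h μ hμ
  obtain ⟨κ', hκ', hs'⟩ := hS.string b a h.symm μ hμ
  rcases le_total 0 κ with h0 | h0
  · exact key a b h κ hκ h0 hs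
  · have : κ' = -κ := by
      have : (κ' : ℂ) = -κ := by rw [← hκ, ← hκ']; ring
      exact_mod_cast this
    rw [Equiv.swap_comm]
    exact key b a h.symm κ' hκ' (by omega) hs'

theorem closed_swap {a b : Fin m} (h : FinPair S (some a) (some b)) {i j : Option (Fin m)}
    (hc : ShiftClosed S i j) :
    ShiftClosed S (i.map (Equiv.swap a b)) (j.map (Equiv.swap a b)) := by
  intro μ hμ
  have := hS.swap_mem h (hc _ (hS.swap_mem h hμ))
  convert this using 1
  have e : ∀ f g : Wt m, (f + g) ∘ Equiv.swap a b = f ∘ Equiv.swap a b + g ∘ Equiv.swap a b :=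
    fun _ _ => rfl
  have e' : ∀ f g : Wt m, (f - g) ∘ Equiv.swap a b = f ∘ Equiv.swap a b - g ∘ Equiv.swap a b :=
    fun _ _ => rfl
  rw [e, nodeRoot, nodeRoot, e', nodeWt_swap, nodeWt_swap]
  congr 1
  ext i
  simp

/-- The transposition of `i` and `j` preserves S and fixes the third node `k`. Hence the two nodes
of a finite pair are interchangeable with respect to any other node; this makes `FinPair` transitive
on distinct nodes. -/
theorem closed_left {i j k : Option (Fin m)} (h : FinPair S i j) (hki : k ≠ i) (hkj : k ≠ j)
    (hc : ShiftClosed S i k) : ShiftClosed S j k := by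
  obtain ⟨a, b, rfl, rfl⟩ := hS.exists_some h
  have := hS.closed_swap h hc
  rcases k with _ | k
  · simpa using this
  · have h1 : k ≠ a := by simpa using hki
    have h2 : k ≠ b := by simpa using hkj
    simpa [Equiv.swap_apply_of_ne_of_ne h1 h2] using this

theorem closed_right {i j k : Option (Fin m)} (h : FinPair S i j) (hki : k ≠ i) (hkj : k ≠ j)
    (hc : ShiftClosed S k i) : ShiftClosed S k j := by
  obtain ⟨a, b, rfl, rfl⟩ := hS.exists_some h
  have := hS.closed_swap h hc
  rcases k with _ | k
  · simpa using this
  · have h1 : k ≠ a := by simpa using hki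
    have h2 : k ≠ b := by simpa using hkj
    simpa [Equiv.swap_apply_of_ne_of_ne h1 h2] using this

theorem finPair_trans {i j k : Option (Fin m)} (h : FinPair S i j) (h' : FinPair S j k)
    (hik : i ≠ k) : FinPair S i k := by
  constructor
  · intro hc
    exact h'.1 (hS.closed_left h hik.symm h'.ne.symm hc)
  · intro hc
    exact h'.2 (hS.closed_right h hik.symm h'.ne.symm hc)

theorem bounded {i j : Option (Fin m)} (h : ¬ShiftClosed S i j) (μ : Wt m) :
    ∃ B : ℕ, ∀ k : ℕ, B ≤ k → μ + k • nodeRoot i j ∉ S := by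
  have hij : i ≠ j := by
    rintro rfl
    exact h (ShiftClosed.refl S i)
  exact (hS.closed_or_bounded i j hij).resolve_left h μ

end SuppShape

end Combinatorics

/-! ### Cancelling finite roots in a sum one at a time -/

section Undo

variable {m : ℕ}

/-- The sum of the roots indexed by a multiset of pairs. -/
def rootSum {ι : Type*} (f : ι → Option (Fin m)) (s : Multiset (ι × ι)) : Wt m :=
  (s.map fun p => nodeRoot (f p.1) (f p.2)).sum

theorem rootSum_zero {ι : Type*} (f : ι → Option (Fin m)) : rootSum f 0 = 0 := rfl

theorem rootSum_cons {ι : Type*} (f : ι → Option (Fin m)) (p : ι × ι) (s : Multiset (ι × ι)) :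
    rootSum f (p ::ₘ s) = nodeRoot (f p.1) (f p.2) + rootSum f s := by
  simp [rootSum]

theorem rootSum_replicate {ι : Type*} (f : ι → Option (Fin m)) (k : ℕ) (p : ι × ι) :
    rootSum f (Multiset.replicate k p) = k • nodeRoot (f p.1) (f p.2) := by
  simp [rootSum]

theorem rootSum_eq_intWt {ι : Type*} (f : ι → Option (Fin m)) (s : Multiset (ι × ι)) :
    ∃ z, rootSum f s = intWt z ∧ ∀ i, |z i| ≤ s.card := by
  induction s using Multiset.induction_on with
  | empty => exact ⟨0, by simp [rootSum_zero], by simp⟩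
  | cons p s ih =>
    obtain ⟨z, hz, hb⟩ := ih
    refine ⟨nodeInt (f p.1) - nodeInt (f p.2) + z, ?_, fun i => ?_⟩
    · rw [rootSum_cons, hz, map_add, map_sub, intWt_nodeInt, intWt_nodeInt, nodeRoot]
    · have h1 : |nodeInt (f p.1) i - nodeInt (f p.2) i| ≤ 1 := by
        simp only [nodeInt]; split_ifs <;> simp
      have h2 := abs_add_le (nodeInt (f p.1) i - nodeInt (f p.2) i) (z i)
      have h3 := hb i
      simp only [Pi.add_apply, Pi.sub_apply, Multiset.card_cons]
      push_cast
      linarith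

/-- No first entry of a pair in `s` is the second entry of a pair in `s`. -/
def NoOverlap (s : Multiset (Fin m × Fin m)) : Prop := ∀ p ∈ s, ∀ q ∈ s, p.1 ≠ q.2

theorem NoOverlap.mono {s t : Multiset (Fin m × Fin m)} (h : NoOverlap s) (hts : t ≤ s) :
    NoOverlap t := fun p hp q hq =>
  h p (Multiset.mem_of_le hts hp) q (Multiset.mem_of_le hts hq)

/-- Two pairs `(x, y)` and `(y, z)` can be merged into `(x, z)`, or dropped if `x = z`, without
changing the sum. Each merge lowers the number of pairs, so the process stops at a multiset without
overlaps. -/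
theorem exists_noOverlap {r : Fin m → Fin m → Prop} (hirr : ∀ a, ¬r a a)
    (htr : ∀ a b c, a ≠ c → r a b → r b c → r a c) (s : Multiset (Fin m × Fin m))
    (hs : ∀ p ∈ s, r p.1 p.2) :
    ∃ t : Multiset (Fin m × Fin m), (∀ p ∈ t, r p.1 p.2) ∧ NoOverlap t ∧
      rootSum some t = rootSum some s := by
  induction hn : s.card using Nat.strong_induction_on generalizing s with
  | _ n ih =>
  subst hn
  by_cases h : NoOverlap s
  · exact ⟨s, hs, h, rfl⟩
  · simp only [NoOverlap, not_forall, not_not] at h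
    obtain ⟨p, hp, q, hq, hpq⟩ := h
    have hne : q ≠ p := by
      rintro rfl
      have := hs q hq
      rw [hpq] at this
      exact hirr _ this
    obtain ⟨s, rfl⟩ := Multiset.exists_cons_of_mem hp
    have hq' : q ∈ s := (Multiset.mem_cons.1 hq).resolve_left hne
    obtain ⟨s, rfl⟩ := Multiset.exists_cons_of_mem hq'
    have hsum : rootSum some (p ::ₘ q ::ₘ s) = nodeRoot (some q.1) (some p.2) + rootSum some s := by
      rw [rootSum_cons, rootSum_cons, ← nodeRoot_add (some q.1) (some q.2) (some p.2), hpq]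
      abel
    by_cases hc : q.1 = p.2
    · obtain ⟨t, h1, h2, h3⟩ := ih s.card (by simp) s
        (fun x hx => hs x (by simp [hx])) rfl
      exact ⟨t, h1, h2, by rw [h3, hsum, hc, nodeRoot_self, zero_add]⟩
    · obtain ⟨t, h1, h2, h3⟩ := ih (s.card + 1) (by simp) ((q.1, p.2) ::ₘ s) (by
        intro x hx
        rcases Multiset.mem_cons.1 hx with rfl | hx
        · refine htr _ q.2 _ hc (hs q (by simp)) ?_
          rw [← hpq]
          exact hs p (by simp)
        · exact hs x (by simp [hx])) (by simp)
      exact ⟨t, h1, h2, by rw [h3, hsum, rootSum_cons]⟩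

theorem rootSum_re_nonneg {s : Multiset (Fin m × Fin m)} {a : Fin m} (h : ∀ q ∈ s, a ≠ q.2) :
    0 ≤ (rootSum some s a).re := by
  induction s using Multiset.induction_on with
  | empty => simp [rootSum_zero]
  | cons p s ih =>
    have h1 := ih fun q hq => h q (by simp [hq])
    have h2 : p.2 ≠ a := (h p (by simp)).symm
    simp only [rootSum_cons, nodeRoot, Pi.add_apply, Pi.sub_apply, nodeWt_apply,
      Option.some.injEq, h2, if_false, sub_zero, Complex.add_re]
    split_ifs <;> simp <;> linarith

theorem rootSum_re_nonpos {s : Multiset (Fin m × Fin m)} {a : Fin m} (h : ∀ q ∈ s, q.1 ≠ a) :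
    (rootSum some s a).re ≤ 0 := by
  induction s using Multiset.induction_on with
  | empty => simp [rootSum_zero]
  | cons p s ih =>
    have h1 := ih fun q hq => h q (by simp [hq])
    have h2 : p.1 ≠ a := h p (by simp)
    simp only [rootSum_cons, nodeRoot, Pi.add_apply, Pi.sub_apply, nodeWt_apply,
      Option.some.injEq, h2, if_false, zero_sub, Complex.add_re]
    split_ifs <;> simp <;> linarith

/-- The pair `p` itself contributes `1` and `-1` to its two coordinates. Without overlap, the other
pairs can only raise the coordinate `p.1` and lower the coordinate `p.2`. -/
theorem NoOverlap.two_le {s : Multiset (Fin m × Fin m)} (h : NoOverlap s) {p : Fin m × Fin m}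
    (hp : p ∈ s) : 2 ≤ (rootSum some s p.1 - rootSum some s p.2).re := by
  obtain ⟨t, rfl⟩ := Multiset.exists_cons_of_mem hp
  have h1 := rootSum_re_nonneg (s := t) (a := p.1) fun q hq => h p hp q (by simp [hq])
  have h2 := rootSum_re_nonpos (s := t) (a := p.2) fun q hq => h q (by simp [hq]) p hp
  have h3 : p.1 ≠ p.2 := h p hp p hp
  simp only [rootSum_cons, nodeRoot, Pi.add_apply, Pi.sub_apply, nodeWt_apply,
      Option.some.injEq, h3, h3.symm, if_false, if_true, Complex.add_re, Complex.sub_re]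
  norm_num
  linarith

namespace SuppShape

variable {S : Set (Wt m)} (hS : SuppShape S)
include hS

/-- Sums of roots without overlap can be undone one by one. -/
theorem undo {μ : Wt m} {s t : Multiset (Fin m × Fin m)} (hs : NoOverlap s)
    (hF : ∀ p ∈ s, FinPair S (some p.1) (some p.2) ∧ -2 < (μ p.1 - μ p.2).re)
    (hμ : μ + rootSum some s ∈ S) (hts : t ≤ s) : μ + rootSum some t ∈ S := by
  obtain ⟨u, rfl⟩ := Multiset.le_iff_exists_add.1 hts
  clear hts
  induction u using Multiset.induction_on with
  | empty => simpa using hμ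
  | cons p u ih =>
    have hp : p ∈ t + p ::ₘ u := by simp
    have hle : t + u ≤ t + p ::ₘ u := by
      rw [Multiset.add_cons]; exact Multiset.le_cons_self _ _
    refine ih (hs.mono hle) (fun q hq => hF q (Multiset.mem_of_le hle hq)) ?_
    have h1 := hs.two_le hp
    have h2 := (hF p hp).2
    -- The difference of the coordinates of `p` exceeds `-2` for `μ` and is at least `2` for the
    -- sum, so the total is positive and the string allows `p` to be subtracted.
    have := hS.sub_mem (hF p hp).1 hμ (by
      simp only [Pi.add_apply, Complex.sub_re, Complex.add_re] at h1 h2 ⊢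
      linarith)
    rw [Multiset.add_cons, rootSum_cons, nodeRoot_some] at this
    convert this using 1
    abel

end SuppShape

end Undo

/-! ### Existence of an extremal weight blocking all positive directions -/

section Extremal

variable {m : ℕ}

/-- `μ ∈ S` is blocked in all directions of `Δ'` in which it has to be blocked for an extremal
weight. -/
structure IsBlocked (S : Set (Wt m)) (μ : Wt m) : Prop where
  mem : μ ∈ S
  strict : ∀ i j, ShiftClosed S j i → ¬ShiftClosed S i j → μ + nodeRoot i j ∉ S
  fin : ∀ a b : Fin m, FinPair S (some a) (some b) → 0 ≤ (μ a - μ b).re →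
    μ + nodeRoot (some a) (some b) ∉ S

/-- The sum of the squares of the real parts of the coordinates. -/
def sqSum (μ : Wt m) : ℝ := ∑ i, (μ i).re ^ 2

theorem sqSum_nonneg (μ : Wt m) : 0 ≤ sqSum μ := Finset.sum_nonneg fun _ _ => sq_nonneg _

theorem sqSum_add (μ : Wt m) {a b : Fin m} (h : a ≠ b) :
    sqSum (μ + nodeRoot (some a) (some b)) = sqSum μ + 2 * (μ a - μ b).re + 2 := by
  have e : ∀ i, ((μ + nodeRoot (some a) (some b)) i).re ^ 2 = (μ i).re ^ 2 +
      ((if a = i then 2 * (μ i).re + 1 else 0) + (if b = i then -2 * (μ i).re + 1 else 0)) := by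
    intro i
    simp only [nodeRoot, Pi.add_apply, Pi.sub_apply, nodeWt_apply, Option.some.injEq]
    by_cases h1 : a = i
    · subst h1; simp [h.symm]; ring
    · by_cases h2 : b = i
      · subst h2; simp [h]; ring
      · simp [h1, h2]
  simp only [sqSum, e, Finset.sum_add_distrib, Finset.sum_ite_eq, Finset.mem_univ, if_true]
  simp
  ring

/-- Lengths are real, so optimal weights are chosen by the floor of `sqSum`, a natural number; a
change of length by at least `1` is visible there. -/
theorem floor_lt_floor {x y : ℝ} (hy : 0 ≤ x) (h : x + 1 ≤ y) : ⌊x⌋₊ < ⌊y⌋₊ := by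
  have := Nat.floor_mono h
  rw [Nat.floor_add_one hy] at this
  omega

theorem exists_max_of_bounded {p : ℕ → Prop} {B n : ℕ} (hn : p n) (hB : ∀ k, p k → k ≤ B) :
    ∃ k, p k ∧ ∀ l, p l → l ≤ k := by
  have hb : BddAbove {k | p k} := ⟨B, fun k hk => hB k hk⟩
  exact ⟨sSup {k | p k}, Nat.sSup_mem ⟨n, hn⟩ hb, fun l hl => le_csSup hb hl⟩

theorem card_le_of_count_le {ι : Type*} [Fintype ι] [DecidableEq ι] {s : Multiset ι}
    {B : ι → ℕ} (h : ∀ p ∈ s, s.count p ≤ B p) : s.card ≤ ∑ p, B p := by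
  rw [← Multiset.toFinset_sum_count_eq]
  calc ∑ p ∈ s.toFinset, s.count p ≤ ∑ p ∈ s.toFinset, B p :=
        Finset.sum_le_sum fun p hp => h p (Multiset.mem_toFinset.1 hp)
    _ ≤ ∑ p, B p := Finset.sum_le_sum_of_subset (Finset.subset_univ _)

theorem rootSum_sub_mem {S : Set (Wt m)} {μ : Wt m} {s t : Multiset (Option (Fin m) × Option (Fin m))}
    (hs : ∀ p ∈ s, ShiftClosed S p.2 p.1) (hμ : μ + rootSum id s ∈ S) (hts : t ≤ s) :
    μ + rootSum id t ∈ S := by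
  obtain ⟨u, rfl⟩ := Multiset.le_iff_exists_add.1 hts
  clear hts
  induction u using Multiset.induction_on with
  | empty => simpa using hμ
  | cons p u ih =>
    have hp : p ∈ t + p ::ₘ u := by simp
    have hle : t + u ≤ t + p ::ₘ u := by
      rw [Multiset.add_cons]; exact Multiset.le_cons_self _ _
    refine ih (fun q hq => hs q (Multiset.mem_of_le hle hq)) ?_
    have := hs p hp _ hμ
    rw [Multiset.add_cons, rootSum_cons, id, id, ← neg_nodeRoot p.1 p.2] at this
    convert this using 1
    abel

namespace SuppShape

variable {S : Set (Wt m)} (hS : SuppShape S)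
include hS

/-- In a weight with least floor of `sqSum`, a difference above `1` is an integer at least `2`, and
subtracting the root would shorten the weight. From a balanced weight every finite root satisfies
the hypothesis `-2 < …` of `undo`. -/
theorem exists_balanced :
    ∃ μ ∈ S, ∀ a b : Fin m, FinPair S (some a) (some b) → (μ a - μ b).re ≤ 1 := by
  classical
  have hex : ∃ n, ∃ μ ∈ S, ⌊sqSum μ⌋₊ = n := by
    obtain ⟨μ, hμ⟩ := hS.nonempty
    exact ⟨_, μ, hμ, rfl⟩
  obtain ⟨μ, hμ, hn⟩ := Nat.find_spec hex
  refine ⟨μ, hμ, fun a b h => ?_⟩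
  by_contra! hlt
  have hba : b ≠ a := fun e => h.ne (by rw [e])
  have hmem := hS.sub_mem h hμ (by linarith)
  have e : μ - (ε a - ε b) = μ + nodeRoot (some b) (some a) := by
    rw [nodeRoot_some]; abel
  rw [e] at hmem
  have h1 := Nat.find_min' hex ⟨_, hmem, rfl⟩
  rw [← hn] at h1
  obtain ⟨κ, hκ, -⟩ := hS.string a b h μ hμ
  have h2 : (2 : ℝ) ≤ (μ a - μ b).re := by
    rw [hκ] at hlt ⊢
    have : (1 : ℤ) < κ := by exact_mod_cast (by simpa using hlt : (1 : ℝ) < κ)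
    have : (2 : ℤ) ≤ κ := by omega
    simpa using (by exact_mod_cast this : (2 : ℝ) ≤ κ)
  have h3 := sqSum_add μ hba
  have h4 : sqSum (μ + nodeRoot (some b) (some a)) + 1 ≤ sqSum μ := by
    rw [h3]
    simp only [Complex.sub_re] at h2 ⊢
    linarith
  exact absurd (floor_lt_floor (sqSum_nonneg _) h4) (by omega)

/-- Only finitely many weights of S differ from a balanced one by finite roots. After removing
overlaps, `undo` isolates the copies of any single root, and their number is bounded by boundedness
in that one direction. -/
theorem exists_bound_fin {μ : Wt m} (hbal : ∀ a b : Fin m, FinPair S (some a) (some b) →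
    (μ a - μ b).re ≤ 1) :
    ∃ B : ℕ, ∀ s : Multiset (Fin m × Fin m), (∀ p ∈ s, FinPair S (some p.1) (some p.2)) →
      μ + rootSum some s ∈ S → ∃ z, rootSum some s = intWt z ∧ ∀ i, |z i| ≤ B := by
  classical
  have hB : ∀ p : Fin m × Fin m, ∃ B : ℕ, FinPair S (some p.1) (some p.2) →
      ∀ k : ℕ, B ≤ k → μ + k • nodeRoot (some p.1) (some p.2) ∉ S := by
    intro p
    by_cases h : FinPair S (some p.1) (some p.2)
    · obtain ⟨B, hB⟩ := hS.bounded h.1 μ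
      exact ⟨B, fun _ => hB⟩
    · exact ⟨0, fun h' => absurd h' h⟩
  choose B hB using hB
  refine ⟨∑ p, B p, fun s hs hμ => ?_⟩
  obtain ⟨t, ht, hno, hsum⟩ := exists_noOverlap
    (r := fun a b => FinPair S (some a) (some b)) (fun a h => h.ne rfl)
    (fun a b c hac h h' => hS.finPair_trans h h' (by simpa using hac)) s hs
  rw [← hsum] at hμ ⊢
  obtain ⟨z, hz, hb⟩ := rootSum_eq_intWt some t
  refine ⟨z, hz, fun i => (hb i).trans ?_⟩
  -- Undoing everything except the copies of `p` leaves a multiple of one root inside S, so the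
  -- multiplicity of `p` is below `B p`.
  have := card_le_of_count_le (s := t) (B := B) fun p hp => by
    by_contra! hlt
    have hle : Multiset.replicate (t.count p) p ≤ t := Multiset.le_count_iff_replicate_le.1 le_rfl
    have := hS.undo hno (fun q hq => ⟨ht q hq, by
      have := hbal _ _ (ht q hq).symm
      simp only [Complex.sub_re] at this ⊢
      linarith⟩) hμ hle
    rw [rootSum_replicate] at this
    exact hB p (ht p hp) _ hlt.le this
  exact_mod_cast this

/-- Strict roots can be cancelled freely, since S is stable under their negatives. Keeping only the
copies of one root bounds each multiplicity. -/
theorem exists_bound_strict (μ : Wt m) :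
    ∃ B : ℕ, ∀ s : Multiset (Option (Fin m) × Option (Fin m)),
      (∀ p ∈ s, ShiftClosed S p.2 p.1 ∧ ¬ShiftClosed S p.1 p.2) →
      μ + rootSum id s ∈ S → s.card ≤ B := by
  classical
  have hB : ∀ p : Option (Fin m) × Option (Fin m), ∃ B : ℕ, ¬ShiftClosed S p.1 p.2 →
      ∀ k : ℕ, B ≤ k → μ + k • nodeRoot p.1 p.2 ∉ S := by
    intro p
    by_cases h : ShiftClosed S p.1 p.2
    · exact ⟨0, fun h' => absurd h h'⟩
    · obtain ⟨B, hB⟩ := hS.bounded h μ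
      exact ⟨B, fun _ => hB⟩
  choose B hB using hB
  refine ⟨∑ p, B p, fun s hs hμ => card_le_of_count_le fun p hp => ?_⟩
  by_contra! hlt
  have hle : Multiset.replicate (s.count p) p ≤ s := Multiset.le_count_iff_replicate_le.1 le_rfl
  have := rootSum_sub_mem (fun q hq => (hs q hq).1) hμ hle
  rw [rootSum_replicate] at this
  exact hB p (hs p hp).2 _ hlt.le this

/-- Two successive maximisations over the weights obtained from a balanced weight by adding finite
and strict roots: first the number of strict roots, then the floor of the length among weights
attaining that number. -/
theorem exists_isBlocked : ∃ μ, IsBlocked S μ := by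
  classical
  obtain ⟨μ₀, hμ₀, hbal⟩ := hS.exists_balanced
  obtain ⟨B, hB⟩ := hS.exists_bound_fin hbal
  choose C hC using hS.exists_bound_strict
  -- The bound on the number of strict roots depends on the finite part, but the latter ranges over
  -- a finite set `Φ`; `D` is the resulting uniform bound.
  let Φ : Set (Wt m) := intWt '' Set.Icc (fun _ => -(B : ℤ)) (fun _ => (B : ℤ))
  have hΦ : Φ.Finite := (Set.finite_Icc _ _).image _
  obtain ⟨D, hD⟩ := (hΦ.image fun φ => C (μ₀ + φ)).bddAbove
  let rep : Wt m → ℕ → Prop := fun μ k => ∃ (s : Multiset (Fin m × Fin m))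
    (d : Multiset (Option (Fin m) × Option (Fin m))),
      (∀ p ∈ s, FinPair S (some p.1) (some p.2)) ∧
      (∀ p ∈ d, ShiftClosed S p.2 p.1 ∧ ¬ShiftClosed S p.1 p.2) ∧ d.card = k ∧
      μ = μ₀ + rootSum some s + rootSum id d
  have hfin : ∀ s : Multiset (Fin m × Fin m), ∀ d : Multiset (Option (Fin m) × Option (Fin m)),
      (∀ p ∈ s, FinPair S (some p.1) (some p.2)) →
      (∀ p ∈ d, ShiftClosed S p.2 p.1 ∧ ¬ShiftClosed S p.1 p.2) →
      μ₀ + rootSum some s + rootSum id d ∈ S →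
      ∃ z, rootSum some s = intWt z ∧ ∀ i, |z i| ≤ B := by
    intro s d hs hd hmem
    refine hB s hs ?_
    have := rootSum_sub_mem (fun q hq => (hd q hq).1) hmem (Multiset.zero_le d)
    simpa [rootSum_zero] using this
  have hcard : ∀ k, (∃ μ ∈ S, rep μ k) → k ≤ D := by
    rintro k ⟨_, hmem, s, d, hs, hd, rfl, rfl⟩
    obtain ⟨z, hz, hb⟩ := hfin s d hs hd hmem
    refine (hC _ d hd hmem).trans (hD ⟨_, ⟨z, ⟨fun i => ?_, fun i => ?_⟩, hz.symm⟩, rfl⟩)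
    · exact (abs_le.1 (hb i)).1
    · exact (abs_le.1 (hb i)).2
  obtain ⟨n, hn, hmax⟩ := exists_max_of_bounded (p := fun k => ∃ μ ∈ S, rep μ k) (n := 0)
    ⟨μ₀, hμ₀, 0, 0, by simp, by simp, rfl, by simp [rootSum_zero]⟩ hcard
  -- The finite part moves each coordinate by at most `B`, the `n` strict roots by at most `n`.
  have hsq : ∀ k, (∃ μ ∈ S, rep μ n ∧ ⌊sqSum μ⌋₊ = k) →
      k ≤ ⌊∑ i, (|(μ₀ i).re| + B + n) ^ 2⌋₊ := by
    rintro k ⟨_, hmem, ⟨s, d, hs, hd, hdn, rfl⟩, rfl⟩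
    refine Nat.floor_mono (Finset.sum_le_sum fun i _ => ?_)
    obtain ⟨z, hz, hb⟩ := hfin s d hs hd hmem
    obtain ⟨z', hz', hb'⟩ := rootSum_eq_intWt id d
    rw [hz, hz', ← sq_abs]
    refine pow_le_pow_left₀ (abs_nonneg _) ?_ 2
    have e : ((μ₀ + intWt z + intWt z') i).re = (μ₀ i).re + z i + z' i := by
      simp [intWt_apply]
    rw [e]
    have h1 : |(z i : ℝ)| ≤ B := by exact_mod_cast hb i
    have h2 : |(z' i : ℝ)| ≤ n := by rw [← hdn]; exact_mod_cast hb' i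
    linarith [abs_add_le ((μ₀ i).re + z i) (z' i), abs_add_le (μ₀ i).re (z i)]
  obtain ⟨μ₁, hμ₁, hrep₁⟩ := hn
  obtain ⟨k, ⟨μ, hμ, hrep, hk⟩, hkmax⟩ := exists_max_of_bounded
    (p := fun k => ∃ μ ∈ S, rep μ n ∧ ⌊sqSum μ⌋₊ = k) ⟨μ₁, hμ₁, hrep₁, rfl⟩ hsq
  obtain ⟨s, d, hs, hd, hdn, rfl⟩ := hrep
  -- An available strict root would raise the maximal count `n`. A finite root with nonnegative
  -- difference would keep the count and raise `sqSum` by at least `2`.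
  refine ⟨_, hμ, fun i j hji hij hmem => ?_, fun a b hab h0 hmem => ?_⟩
  · have := hmax (n + 1) ⟨_, hmem, s, (i, j) ::ₘ d, hs, by
      intro p hp
      rcases Multiset.mem_cons.1 hp with rfl | hp
      · exact ⟨hji, hij⟩
      · exact hd p hp, by simp [hdn], by rw [rootSum_cons]; simp only [id]; abel⟩
    omega
  · have hne : a ≠ b := fun e => hab.ne (by rw [e])
    have := hkmax _ ⟨_, hmem, ⟨(a, b) ::ₘ s, d, by
      intro p hp
      rcases Multiset.mem_cons.1 hp with rfl | hp
      · exact hab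
      · exact hs p hp, hd, hdn, by rw [rootSum_cons]; abel⟩, rfl⟩
    rw [← hk, sqSum_add _ hne] at this
    exact absurd (floor_lt_floor (sqSum_nonneg _) (by linarith)) (not_lt.2 this)

/-- One of the two signs of each finite root is blocked at `μ`, hence at `ν`. If `ν` admitted the
sign on which it is nonnegative, the other sign would be admitted too: by the string property when
the difference is positive, by reflection when it is zero. -/
theorem IsBlocked_of_K_le {μ ν : Wt m} (hμ : IsBlocked S μ) (hν : ν ∈ S) (h : K S μ ⊆ K S ν) :
    IsBlocked S ν := by
  refine ⟨hν, fun i j hji hij => ?_, fun a b hab h0 hmem => ?_⟩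
  · have hne : i ≠ j := by rintro rfl; exact hij hji
    exact (h ⟨mem_Root'_iff.2 ⟨i, j, hne, rfl⟩, hμ.strict i j hji hij⟩).2
  · have hr : ∀ a b : Fin m, FinPair S (some a) (some b) →
        nodeRoot (some a) (some b) ∈ Root' m := fun a b h => mem_Root'_iff.2 ⟨_, _, h.ne, rfl⟩
    have h1 : nodeRoot (some b) (some a) ∈ K S ν := by
      rcases le_total 0 (μ a - μ b).re with hle | hle
      · exact absurd hmem (h ⟨hr a b hab, hμ.fin a b hab hle⟩).2
      · refine h ⟨hr b a hab.symm, hμ.fin b a hab.symm ?_⟩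
        simp only [Complex.sub_re] at hle ⊢
        linarith
    obtain ⟨κ, hκ, hs⟩ := hS.string a b hab ν hν
    have h0' : 0 ≤ κ := by
      rw [hκ] at h0
      simpa using h0
    rcases h0'.eq_or_lt with rfl | hpos
    · have hsw := hS.swap_mem hab hmem
      refine h1.2 ?_
      convert hsw using 1
      have e : (ν + nodeRoot (some a) (some b)) ∘ Equiv.swap a b = ν ∘ Equiv.swap a b +
        (nodeWt (some a) ∘ Equiv.swap a b - nodeWt (some b) ∘ Equiv.swap a b) := rfl
      have e' : ν ∘ Equiv.swap a b = ν := by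
        have hab' : ν a = ν b := by simpa [sub_eq_zero] using hκ
        ext i
        by_cases hia : i = a
        · subst hia; simp [hab']
        · by_cases hib : i = b
          · subst hib; simp [hab']
          · simp [Equiv.swap_apply_of_ne_of_ne hia hib]
      rw [e, e', nodeWt_swap, nodeWt_swap]
      simp [nodeRoot]
    · have := hs 1 (by push_cast; omega)
      refine h1.2 ?_
      rw [← neg_nodeRoot, ← sub_eq_add_neg]
      simpa using this

/-- There are finitely many sets `K S ν`, as `Δ'` is finite. A maximal one above that of a blocked
weight gives an extremal weight, which is again blocked. -/
theorem exists_extremal : ∃ μ, IsExtremal S μ ∧ IsBlocked S μ := by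
  obtain ⟨μ₀, hμ₀⟩ := hS.exists_isBlocked
  have hfin : {k | ∃ ν ∈ S, k = K S ν}.Finite := by
    refine (finite_Root' (m := m)).finite_subsets.subset ?_
    rintro _ ⟨ν, -, rfl⟩ α hα
    exact hα.1
  obtain ⟨k, hle, ⟨⟨ν, hν, rfl⟩, hmax⟩⟩ := hfin.exists_le_maximal ⟨μ₀, hμ₀.mem, rfl⟩
  refine ⟨ν, ⟨hν, fun ξ hξ hlt => ?_⟩, hS.IsBlocked_of_K_le hμ₀ hν hle⟩
  exact hlt.2 (hmax ⟨ξ, hξ, rfl⟩ hlt.1)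

end SuppShape

end Extremal

/-! ### `Δ'^F` and `Δ'^I` through shifts; positive finite roots at a blocked weight -/

section Strings

variable {m : ℕ}

theorem form_nodeRoot (μ : Wt m) (a b : Fin m) :
    form μ (nodeRoot (some a) (some b)) = μ a - μ b := by
  have h1 : ∑ i, μ i * nodeRoot (some a) (some b) i = μ a - μ b := by
    simp [nodeRoot, nodeWt_apply, mul_sub, Finset.sum_sub_distrib]
  have h2 : ∑ i, nodeRoot (some a) (some b) i = 0 := by
    simp [nodeRoot, nodeWt_apply, Finset.sum_sub_distrib]
  rw [form, h1, h2, mul_zero, add_zero]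

namespace SuppShape

variable {S : Set (Wt m)} (hS : SuppShape S)
include hS

/-- Strings are indexed by real numbers, but S lies in one integral coset and a root has a
coordinate `±1`. Hence boundedness of a string reduces to the alternative for natural multiples in
`SuppShape`. -/
theorem rootString_int {μ : Wt m} (hμ : μ ∈ S) {i j : Option (Fin m)} (hij : i ≠ j) {q : ℝ}
    (hq : q ∈ rootString S μ (nodeRoot i j)) : ∃ k : ℤ, q = k := by
  obtain ⟨z, hz⟩ := hS.integral μ hμ _ hq
  obtain ⟨a, ha⟩ := exists_nodeRoot_coord hij
  have e := congrFun (add_left_cancel hz) a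
  simp only [Pi.smul_apply, smul_eq_mul, intWt_apply] at e
  rcases ha with ha | ha
  · refine ⟨z a, ?_⟩
    rw [ha, mul_one] at e
    exact_mod_cast e
  · refine ⟨-z a, ?_⟩
    rw [ha] at e
    have : (q : ℂ) = ((-z a : ℤ) : ℂ) := by push_cast; rw [← e]; ring
    exact_mod_cast this

theorem bddAbove_rootString {μ : Wt m} (hμ : μ ∈ S) {i j : Option (Fin m)} (hij : i ≠ j) :
    BddAbove (rootString S μ (nodeRoot i j)) ↔ ¬ShiftClosed S i j := by
  constructor
  · rintro ⟨B, hB⟩ hc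
    obtain ⟨k, hk⟩ := exists_nat_gt B
    have : (k : ℝ) ∈ rootString S μ (nodeRoot i j) := by
      change μ + ((k : ℝ) : ℂ) • nodeRoot i j ∈ S
      rw [Complex.ofReal_natCast, Nat.cast_smul_eq_nsmul]
      exact hc.nsmul hμ k
    exact absurd (hB this) (not_le.2 hk)
  · intro hc
    obtain ⟨B, hB⟩ := hS.bounded hc μ
    refine ⟨B, fun q hq => ?_⟩
    obtain ⟨k, rfl⟩ := hS.rootString_int hμ hij hq
    by_contra! hlt
    have h0 : (B : ℤ) < k := by exact_mod_cast hlt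
    obtain ⟨n, rfl⟩ := Int.eq_ofNat_of_zero_le (by omega : 0 ≤ k)
    refine hB n (by omega) ?_
    change μ + (((n : ℤ) : ℝ) : ℂ) • nodeRoot i j ∈ S at hq
    rwa [Int.cast_natCast, Complex.ofReal_natCast, Nat.cast_smul_eq_nsmul] at hq

theorem bddBelow_rootString {μ : Wt m} (hμ : μ ∈ S) {i j : Option (Fin m)} (hij : i ≠ j) :
    BddBelow (rootString S μ (nodeRoot i j)) ↔ ¬ShiftClosed S j i := by
  rw [← hS.bddAbove_rootString hμ hij.symm, ← neg_nodeRoot, rootString_neg, bddBelow_neg]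

theorem mem_RootF {μ : Wt m} (hμ : μ ∈ S) {α : Wt m} :
    α ∈ RootF S μ ↔ ∃ i j, FinPair S i j ∧ α = nodeRoot i j := by
  constructor
  · rintro ⟨h, ha, hb⟩
    obtain ⟨i, j, hij, rfl⟩ := mem_Root'_iff.1 h
    exact ⟨i, j, ⟨(hS.bddAbove_rootString hμ hij).1 ha, (hS.bddBelow_rootString hμ hij).1 hb⟩, rfl⟩
  · rintro ⟨i, j, h, rfl⟩
    exact ⟨mem_Root'_iff.2 ⟨i, j, h.ne, rfl⟩, (hS.bddAbove_rootString hμ h.ne).2 h.1,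
      (hS.bddBelow_rootString hμ h.ne).2 h.2⟩

theorem mem_RootI {μ : Wt m} (hμ : μ ∈ S) {α : Wt m} :
    α ∈ RootI S μ ↔ ∃ i j, i ≠ j ∧ ShiftClosed S i j ∧ ShiftClosed S j i ∧ α = nodeRoot i j := by
  constructor
  · rintro ⟨h, ha, hb⟩
    obtain ⟨i, j, hij, rfl⟩ := mem_Root'_iff.1 h
    rw [hS.bddAbove_rootString hμ hij, not_not] at ha
    rw [hS.bddBelow_rootString hμ hij, not_not] at hb
    exact ⟨i, j, hij, ha, hb, rfl⟩
  · rintro ⟨i, j, hij, ha, hb, rfl⟩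
    refine ⟨mem_Root'_iff.2 ⟨i, j, hij, rfl⟩, ?_, ?_⟩
    · rw [hS.bddAbove_rootString hμ hij, not_not]; exact ha
    · rw [hS.bddBelow_rootString hμ hij, not_not]; exact hb

theorem add_RootI_mem {μ : Wt m} (hμ : μ ∈ S) {γ : Wt m} (hγ : γ ∈ AddSubgroup.closure (RootI S μ)) :
    ∀ ν, ν ∈ S ↔ ν + γ ∈ S := by
  induction hγ using AddSubgroup.closure_induction with
  | mem x hx =>
    obtain ⟨i, j, -, h, h', rfl⟩ := (hS.mem_RootI hμ).1 hx
    refine fun ν => ⟨h ν, fun hν => ?_⟩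
    have := h' _ hν
    rwa [add_assoc, nodeRoot_add, nodeRoot_self, add_zero] at this
  | zero => simp
  | add x y _ _ hx hy =>
    intro ν
    rw [hx, hy, add_assoc]
  | neg x _ hx =>
    intro ν
    rw [hx (ν + -x), neg_add_cancel_right]

end SuppShape

/-- The node `i` is above the node `j` with respect to the positive roots determined by `μ`, `P`. -/
def NodeGE (S : Set (Wt m)) (μ : Wt m) (P : Set (Wt m)) (i j : Option (Fin m)) : Prop :=
  ShiftClosed S j i ∨ FinPair S i j ∧
    ((j.elim 0 μ).re < (i.elim 0 μ).re ∨ nodeRoot i j ∈ P)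

namespace IsBlocked

variable {S : Set (Wt m)} {μ : Wt m} (hμ : IsBlocked S μ)
include hμ

/-- The finite positive roots: pairs with nonnegative coordinate difference. -/
theorem not_mem_of_fin (hS : SuppShape S) {s : Multiset (Fin m × Fin m)}
    (hs : ∀ p ∈ s, FinPair S (some p.1) (some p.2) ∧ 0 ≤ (μ p.1 - μ p.2).re) :
    (rootSum some s ≠ 0 → μ + rootSum some s ∉ S) ∧
      ∀ i j, ShiftClosed S j i → ¬ShiftClosed S i j →
        μ + nodeRoot i j + rootSum some s ∉ S := by
  obtain ⟨t, ht, hno, hsum⟩ := exists_noOverlap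
    (r := fun a b => FinPair S (some a) (some b) ∧ 0 ≤ (μ a - μ b).re) (fun a h => h.1.ne rfl)
    (fun a b c hac h h' => ⟨hS.finPair_trans h.1 h'.1 (by simpa using hac), by
      have h1 := h.2
      have h2 := h'.2
      simp only [Complex.sub_re] at h1 h2 ⊢
      linarith⟩) s hs
  rw [← hsum]
  refine ⟨fun hne hmem => ?_, fun i j hji hij hmem => ?_⟩
  · have ht0 : t ≠ 0 := by
      rintro rfl
      exact hne (rootSum_zero _)
    obtain ⟨p, hp⟩ := Multiset.exists_mem_of_ne_zero ht0
    have := hS.undo hno (fun q hq => ⟨(ht q hq).1, by linarith [(ht q hq).2]⟩) hmem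
      (Multiset.singleton_le.2 hp)
    rw [← Multiset.cons_zero, rootSum_cons, rootSum_zero, add_zero] at this
    exact hμ.fin _ _ (ht p hp).1 (ht p hp).2 this
  · have := hS.undo (t := 0) hno (fun q hq => ⟨(ht q hq).1, ?_⟩) hmem (Multiset.zero_le _)
    · rw [rootSum_zero, add_zero] at this
      exact hμ.strict i j hji hij this
    · have h1 := (ht q hq).2
      have h2 := (ht q hq).1
      simp only [nodeRoot, Pi.add_apply, Pi.sub_apply, nodeWt_apply, Complex.sub_re,
        Complex.add_re] at h1 ⊢
      -- Adding `nodeRoot i j` lowers the difference along `q` by `2` only if `j = q.1` and `i =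
      -- q.2`, which is impossible for a finite pair. Otherwise it lowers it by at most `1`, and the
      -- bound `-2 < …` of `undo` survives.
      by_cases e1 : j = some q.1
      · by_cases e2 : i = some q.2
        · rw [e1, e2] at hji
          exact absurd hji h2.1
        · rw [if_neg e2]
          split_ifs <;> simp <;> linarith
      · rw [if_neg e1]
        split_ifs <;> simp <;> linarith

variable (hS : SuppShape S) {P Q : Set (Wt m)} (hPQ : IsTriangular (RootF0 S μ) P Q)
include hS hPQ

theorem mem_P {α : Wt m} (h : α ∈ P) :
    ∃ a b, FinPair S (some a) (some b) ∧ μ a = μ b ∧ α = nodeRoot (some a) (some b) := by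
  have : α ∈ RootF0 S μ := by rw [hPQ.1]; exact Or.inl h
  obtain ⟨i, j, hij, rfl⟩ := (hS.mem_RootF hμ.mem).1 this.1
  obtain ⟨a, b, rfl, rfl⟩ := hS.exists_some hij
  refine ⟨a, b, hij, ?_, rfl⟩
  have := this.2
  rwa [form_nodeRoot, sub_eq_zero] at this

theorem mem_P_or_Q {a b : Fin m} (h : FinPair S (some a) (some b)) (hab : μ a = μ b) :
    nodeRoot (some a) (some b) ∈ P ∨ nodeRoot (some a) (some b) ∈ Q := by
  have : nodeRoot (some a) (some b) ∈ P ∪ Q := by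
    rw [← hPQ.1]
    exact ⟨(hS.mem_RootF hμ.mem).2 ⟨_, _, h, rfl⟩, by rw [form_nodeRoot, hab, sub_self]⟩
  exact this

omit hμ hS in
theorem not_mem_cones {α : Wt m} (h0 : α ≠ 0)
    (h1 : α ∈ Submodule.span NNReal ({α | -α ∈ P} ∪ Q))
    (h2 : α ∈ Submodule.span NNReal ({α | -α ∈ Q} ∪ P)) : False := by
  have : α ∈ ({0} : Set (Wt m)) := by rw [← hPQ.2.2]; exact ⟨h1, h2⟩
  exact h0 this

/-- If both opposite roots were in Q, then the root would lie in both cones of the triangular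
decomposition. Together with `P_trans` this makes P a total order on nodes of finite pairs with
equal coordinates. -/
theorem P_total {a b : Fin m} (h : FinPair S (some a) (some b)) (hab : μ a = μ b) :
    nodeRoot (some a) (some b) ∈ P ∨ nodeRoot (some b) (some a) ∈ P := by
  by_contra! hn
  have h1 := (hμ.mem_P_or_Q hS hPQ h hab).resolve_left hn.1
  have h2 := (hμ.mem_P_or_Q hS hPQ h.symm hab.symm).resolve_left hn.2
  refine not_mem_cones hPQ (nodeRoot_ne_zero h.ne) (Submodule.subset_span (Or.inr h1))
    (Submodule.subset_span (Or.inl ?_))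
  change -nodeRoot (some a) (some b) ∈ Q
  rwa [neg_nodeRoot]

/-- Otherwise the root is in Q, hence in the first cone, while as a sum of two elements of P it is
in the second. -/
theorem P_trans {i j k : Option (Fin m)} (hik : FinPair S i k) (h1 : nodeRoot i j ∈ P)
    (h2 : nodeRoot j k ∈ P) (hv : (i.elim 0 μ) = (k.elim 0 μ)) : nodeRoot i k ∈ P := by
  obtain ⟨a, c, rfl, rfl⟩ := hS.exists_some hik
  refine (hμ.mem_P_or_Q hS hPQ hik hv).resolve_right fun hQ => ?_
  refine not_mem_cones hPQ (nodeRoot_ne_zero hik.ne) (Submodule.subset_span (Or.inr hQ)) ?_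
  rw [← nodeRoot_add _ j]
  exact Submodule.add_mem _ (Submodule.subset_span (Or.inr h1))
    (Submodule.subset_span (Or.inr h2))

end IsBlocked

end Strings

/-! ### Positive sums leave the support; a lexicographic order for the remaining roots -/

section Order

variable {m : ℕ}

/-- The linear form on integral weights with coefficients `c`. -/
def linForm (c : Option (Fin m) → ℤ) : (Fin m → ℤ) →+ ℤ where
  toFun z := ∑ a, c (some a) * z a
  map_zero' := by simp
  map_add' x y := by simp [mul_add, Finset.sum_add_distrib]

theorem linForm_apply (c : Option (Fin m) → ℤ) (z : Fin m → ℤ) :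
    linForm c z = ∑ a, c (some a) * z a := rfl

theorem linForm_nodeInt {c : Option (Fin m) → ℤ} (hc : c none = 0) (i : Option (Fin m)) :
    linForm c (nodeInt i) = c i := by
  rcases i with _ | i <;> simp [linForm_apply, nodeInt, hc]

/-- The integral weights which are negative for the lexicographic order defined by a sequence of
linear forms. -/
def lexNeg (c : ℕ → Option (Fin m) → ℤ) : Set (Wt m) :=
  {x | ∃ z, x = intWt z ∧ ∃ k, linForm (c k) z < 0 ∧ ∀ l < k, linForm (c l) z = 0}

theorem lexNeg_add {c : ℕ → Option (Fin m) → ℤ} {x y : Wt m} (hx : x ∈ lexNeg c)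
    (hy : y ∈ lexNeg c) : x + y ∈ lexNeg c := by
  obtain ⟨z, rfl, k, hk, hk'⟩ := hx
  obtain ⟨z', rfl, l, hl, hl'⟩ := hy
  refine ⟨z + z', by rw [map_add], min k l, ?_, fun p hp => ?_⟩
  · rw [map_add]
    rcases lt_trichotomy k l with h | rfl | h
    · rw [min_eq_left h.le, hl' k h, add_zero]; exact hk
    · rw [min_self]; omega
    · rw [min_eq_right h.le, hk' l h, zero_add]; exact hl
  · rw [map_add, hk' p (lt_min_iff.1 hp).1, hl' p (lt_min_iff.1 hp).2, add_zero]

theorem sum_nodeWt (a : Fin m → ℤ) : intWt a = ∑ k, a k • nodeWt (some k) := by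
  ext i
  simp [intWt_apply, nodeWt_apply]

theorem mem_of_add_strict {S : Set (Wt m)} {d ν : Wt m} (hd : d ∈ AddSubmonoid.closure
    {α | ∃ i j, ShiftClosed S j i ∧ ¬ShiftClosed S i j ∧ α = nodeRoot i j}) (hν : ν + d ∈ S) :
    ν ∈ S := by
  induction hd using AddSubmonoid.closure_induction generalizing ν with
  | mem x hx =>
    obtain ⟨i, j, h1, -, rfl⟩ := hx
    have := h1 _ hν
    rwa [add_assoc, nodeRoot_add, nodeRoot_self, add_zero] at this
  | zero => simpa using hν
  | add x y _ _ hx hy => exact hx (hy (by rwa [add_assoc]))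

namespace IsBlocked

variable {S : Set (Wt m)} {μ : Wt m} (hμ : IsBlocked S μ) (hS : SuppShape S) {P Q : Set (Wt m)}
  (hPQ : IsTriangular (RootF0 S μ) P Q)
include hμ hS hPQ

/-- A root in `K` is not shift-stable. If its negative is, it is strict. Otherwise the pair is
finite, and a negative difference would put `μ + α` in S by the string property. Elements of P have
difference `0`. -/
theorem posRoot'_cases {α : Wt m} (h : α ∈ posRoot' S μ P) :
    (∃ i j, ShiftClosed S j i ∧ ¬ShiftClosed S i j ∧ α = nodeRoot i j) ∨
      ∃ a b, (FinPair S (some a) (some b) ∧ 0 ≤ (μ a - μ b).re) ∧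
        α = nodeRoot (some a) (some b) := by
  rcases h with ⟨⟨hr, h1⟩, h2⟩ | h
  · obtain ⟨i, j, hij, rfl⟩ := mem_Root'_iff.1 hr
    have hn : ¬ShiftClosed S i j := fun hc => h1 (hc _ hμ.mem)
    by_cases hc : ShiftClosed S j i
    · exact Or.inl ⟨i, j, hc, hn, rfl⟩
    · have hF : FinPair S i j := ⟨hn, hc⟩
      obtain ⟨a, b, rfl, rfl⟩ := hS.exists_some hF
      refine Or.inr ⟨a, b, ⟨hF, ?_⟩, rfl⟩
      by_contra! hlt
      have := hS.sub_mem hF.symm hμ.mem (by simp only [Complex.sub_re] at hlt ⊢; linarith)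
      refine h1 ?_
      rw [← nodeRoot_some, sub_eq_add_neg, neg_nodeRoot] at this
      exact this
  · obtain ⟨a, b, hF, hab, rfl⟩ := hμ.mem_P hS hPQ h
    exact Or.inr ⟨a, b, ⟨hF, by simp [hab]⟩, rfl⟩

/-- Write the sum as strict part plus finite part plus lattice part; S is invariant under the last.
If there is no strict root, `undo` reduces a nonzero finite part to a single blocked root. Otherwise
all strict roots but one are cancelled, then the whole finite part, and a blocked strict root
remains. -/
theorem add_not_mem {β : Wt m}
    (hβ : β ∈ AddSubmonoid.closure (posRoot' S μ P ∪ RootI S μ))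
    (hβ' : β ∉ AddSubgroup.closure (RootI S μ)) : μ + β ∉ S := by
  have hle : posRoot' S μ P ∪ RootI S μ ⊆
      ({α | ∃ i j, ShiftClosed S j i ∧ ¬ShiftClosed S i j ∧ α = nodeRoot i j} ∪
        {α | ∃ a b, (FinPair S (some a) (some b) ∧ 0 ≤ (μ a - μ b).re) ∧
          α = nodeRoot (some a) (some b)}) ∪ RootI S μ :=
    Set.union_subset_union_left _ fun α hα => hμ.posRoot'_cases hS hPQ hα
  have hβ2 := AddSubmonoid.closure_mono hle hβ
  rw [AddSubmonoid.closure_union, AddSubmonoid.closure_union] at hβ2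
  obtain ⟨y, hy, γ, hγ, rfl⟩ := AddSubmonoid.mem_sup.1 hβ2
  obtain ⟨d, hd, f, hf, rfl⟩ := AddSubmonoid.mem_sup.1 hy
  have hγ' : γ ∈ AddSubgroup.closure (RootI S μ) := by
    have : AddSubmonoid.closure (RootI S μ) ≤
        (AddSubgroup.closure (RootI S μ)).toAddSubmonoid := by
      rw [AddSubmonoid.closure_le]
      exact AddSubgroup.subset_closure
    exact this hγ
  intro hmem
  rw [← add_assoc, ← hS.add_RootI_mem hμ.mem hγ', ← add_assoc] at hmem
  obtain ⟨l, hl, rfl⟩ := AddSubmonoid.exists_multiset_of_mem_closure hf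
  have hs : ∃ s : Multiset (Fin m × Fin m), (∀ p ∈ s, FinPair S (some p.1) (some p.2) ∧
      0 ≤ (μ p.1 - μ p.2).re) ∧ rootSum some s = l.sum := by
    clear hmem hβ hβ' hβ2 hy hf
    induction l using Multiset.induction_on with
    | empty => exact ⟨0, by simp, by simp [rootSum_zero]⟩
    | cons α l ih =>
      obtain ⟨s, h1, h2⟩ := ih fun x hx => hl x (by simp [hx])
      obtain ⟨a, b, h3, rfl⟩ := hl α (by simp)
      refine ⟨(a, b) ::ₘ s, fun p hp => ?_, by rw [rootSum_cons, h2, Multiset.sum_cons]⟩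
      rcases Multiset.mem_cons.1 hp with rfl | hp
      · exact h3
      · exact h1 p hp
  obtain ⟨s, hs, hsum⟩ := hs
  rw [← hsum] at hmem hβ'
  obtain ⟨hF0, hFD⟩ := hμ.not_mem_of_fin hS hs
  -- A nonzero strict part is reduced to its first root; the rest is absorbed by stability of S
  -- under the negatives.
  have hdcases : d = 0 ∨ ∃ i j, (ShiftClosed S j i ∧ ¬ShiftClosed S i j) ∧
      ∀ ν, ν + d ∈ S → ν + nodeRoot i j ∈ S := by
    clear hmem hβ' hβ hβ2 hy
    induction hd using AddSubmonoid.closure_induction_left with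
    | zero => exact Or.inl rfl
    | add_left x hx y hy _ =>
      obtain ⟨i, j, h1, h2, rfl⟩ := hx
      refine Or.inr ⟨i, j, ⟨h1, h2⟩, fun ν hν => ?_⟩
      exact mem_of_add_strict hy (by rwa [add_assoc])
  rcases hdcases with rfl | ⟨i, j, ⟨h1, h2⟩, hd'⟩
  · rw [add_zero] at hmem
    refine hF0 (fun h0 => hβ' ?_) hmem
    rw [h0, zero_add, zero_add]
    exact hγ'
  · rw [add_right_comm] at hmem
    have := hd' _ hmem
    rw [add_right_comm] at this
    exact hFD i j h1 h2 this

/-- The only delicate case is a finite pair with equal real parts. The difference is an integer, so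
the coordinates themselves agree, the root is in `Δ'^{F,0}`, and P decides. -/
theorem nodeGE_total (i j : Option (Fin m)) : NodeGE S μ P i j ∨ NodeGE S μ P j i := by
  by_cases h1 : ShiftClosed S j i
  · exact Or.inl (Or.inl h1)
  by_cases h2 : ShiftClosed S i j
  · exact Or.inr (Or.inl h2)
  have hF : FinPair S i j := ⟨h2, h1⟩
  obtain ⟨a, b, rfl, rfl⟩ := hS.exists_some hF
  rcases lt_trichotomy (μ a).re (μ b).re with h | h | h
  · exact Or.inr (Or.inr ⟨hF.symm, Or.inl h⟩)
  · obtain ⟨κ, hκ, -⟩ := hS.string a b hF μ hμ.mem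
    have h0 : (κ : ℝ) = 0 := by
      have := congrArg Complex.re hκ
      simpa [h] using this.symm
    have hab : μ a = μ b := by
      rw [← sub_eq_zero, hκ]
      exact_mod_cast h0
    rcases hμ.P_total hS hPQ hF hab with h' | h'
    · exact Or.inl (Or.inr ⟨hF, Or.inr h'⟩)
    · exact Or.inr (Or.inr ⟨hF.symm, Or.inr h'⟩)
  · exact Or.inl (Or.inr ⟨hF, Or.inl h⟩)

omit hμ in
theorem eq_of_mem_P {i j : Option (Fin m)} (h : nodeRoot i j ∈ P) (hF : FinPair S i j) :
    i.elim 0 μ = j.elim 0 μ := by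
  have hF0 : nodeRoot i j ∈ RootF0 S μ := by rw [hPQ.1]; exact Or.inl h
  obtain ⟨a, b, rfl, rfl⟩ := hS.exists_some hF
  have := hF0.2
  rwa [form_nodeRoot, sub_eq_zero] at this

theorem nodeGE_trans {i j k : Option (Fin m)} (h : NodeGE S μ P i j) (h' : NodeGE S μ P j k) :
    NodeGE S μ P i k := by
  by_cases hik : i = k
  · subst hik; exact Or.inl (ShiftClosed.refl S i)
  by_cases hij : i = j
  · rwa [hij]
  by_cases hjk : j = k
  · rwa [← hjk]
  -- When just one of the two relations comes from a finite pair, its nodes are interchangeable with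
  -- respect to the third, and the other relation is transferred along it.
  rcases h with h | ⟨hF, h⟩ <;> rcases h' with h' | ⟨hF', h'⟩
  · exact Or.inl (h'.trans h)
  · exact Or.inl (hS.closed_left hF' hij hik h)
  · exact Or.inl (hS.closed_right hF.symm (Ne.symm hjk) (Ne.symm hik) h')
  · have hFik := hS.finPair_trans hF hF' hik
    refine Or.inr ⟨hFik, ?_⟩
    rcases h with h | h <;> rcases h' with h' | h'
    · exact Or.inl (h'.trans h)
    · rw [eq_of_mem_P hS hPQ h' hF'] at h
      exact Or.inl h
    · rw [← eq_of_mem_P hS hPQ h hF] at h'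
      exact Or.inl h'
    · exact Or.inr (hμ.P_trans hS hPQ hFik h h'
        ((eq_of_mem_P hS hPQ h hF).trans (eq_of_mem_P hS hPQ h' hF')))

omit hPQ in
theorem nodeRoot_mem {i j : Option (Fin m)} (h : NodeGE S μ P i j) :
    nodeRoot i j ∈ AddSubmonoid.closure (posRoot' S μ P ∪ RootI S μ) := by
  by_cases hij : i = j
  · rw [hij, nodeRoot_self]; exact zero_mem _
  have hr := mem_Root'_iff.2 ⟨i, j, hij, rfl⟩
  refine AddSubmonoid.subset_closure ?_
  rcases h with h | ⟨hF, h | h⟩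
  · by_cases h' : ShiftClosed S i j
    · exact Or.inr ((hS.mem_RootI hμ.mem).2 ⟨i, j, hij, h', h, rfl⟩)
    · refine Or.inl (Or.inl ⟨⟨hr, hμ.strict i j h h'⟩, fun hK => hK.2 ?_⟩)
      rw [neg_nodeRoot]
      exact h _ hμ.mem
  · obtain ⟨a, b, rfl, rfl⟩ := hS.exists_some hF
    have hlt : 0 < (μ a - μ b).re := by simpa using h
    refine Or.inl (Or.inl ⟨⟨hr, hμ.fin a b hF hlt.le⟩, fun hK => hK.2 ?_⟩)
    rw [← sub_eq_add_neg]
    exact hS.sub_mem hF hμ.mem hlt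
  · exact Or.inl (Or.inr h)

open Classical in
/-- All roots outside the parabolic set lie on the negative side of a lexicographic order which is
trivial on `Δ'^I`. -/
theorem exists_negative : ∃ Neg : Set (Wt m), (∀ x ∈ Neg, ∀ y ∈ Neg, x + y ∈ Neg) ∧
    (∀ x ∈ Neg, ∀ γ ∈ AddSubgroup.closure (RootI S μ), x + γ ∈ Neg) ∧
    (∀ γ ∈ AddSubgroup.closure (RootI S μ), γ ∉ Neg) ∧
    ∀ (a : Fin m → ℕ) (i : Option (Fin m)),
      intWt (fun k => (a k : ℤ)) - nodeWt i ∈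
        AddSubmonoid.closure (posRoot' S μ P ∪ RootI S μ) ∨
      intWt (fun k => (a k : ℤ)) - nodeWt i ∈ Neg := by
  set R := AddSubmonoid.closure (posRoot' S μ P ∪ RootI S μ) with hR
  -- The rank counts the nodes below a given one; by totality and transitivity, comparing ranks is
  -- the same as comparing nodes.
  let r : Option (Fin m) → ℕ := fun i => (Finset.univ.filter fun j => NodeGE S μ P i j).card
  have hr1 : ∀ i j, NodeGE S μ P i j → r j ≤ r i := fun i j h =>
    Finset.card_le_card fun k hk => by
      simp only [Finset.mem_filter, Finset.mem_univ, true_and] at hk ⊢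
      exact hμ.nodeGE_trans hS hPQ h hk
  have hr2 : ∀ i j, r j ≤ r i → NodeGE S μ P i j := by
    intro i j h
    by_contra hn
    have hji := (hμ.nodeGE_total hS hPQ i j).resolve_left hn
    refine absurd h (not_le.2 (Finset.card_lt_card ⟨fun k hk => ?_, fun hle => ?_⟩))
    · simp only [Finset.mem_filter, Finset.mem_univ, true_and] at hk ⊢
      exact hμ.nodeGE_trans hS hPQ hji hk
    · have : j ∈ Finset.univ.filter fun k => NodeGE S μ P j k := by
        simp only [Finset.mem_filter, Finset.mem_univ, true_and]
        exact Or.inl (ShiftClosed.refl S j)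
      have := hle this
      simp only [Finset.mem_filter, Finset.mem_univ, true_and] at this
      exact hn this
  have hrM : ∀ i, r i ≤ m + 1 := fun i => by
    refine (Finset.card_le_univ _).trans ?_
    simp
  -- The forms to be compared in turn: minus the degree in the nodes below `none`; the degree in
  -- these nodes weighted by rank; then, for each rank above that of `none`, starting from the top
  -- rank `m + 1`, the degree in the nodes of that rank.
  let c : ℕ → Option (Fin m) → ℤ := fun k i =>
    match k with
    | 0 => if r i < r none then -1 else 0
    | 1 => if r i < r none then (r i : ℤ) else 0
    | k + 2 => if r none < r i ∧ r i + k = m + 1 then 1 else 0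
  have hcz : ∀ i, c 0 i = if r i < r none then -1 else 0 := fun _ => rfl
  have hco : ∀ i, c 1 i = if r i < r none then (r i : ℤ) else 0 := fun _ => rfl
  have hct : ∀ k i, c (k + 2) i = if r none < r i ∧ r i + k = m + 1 then 1 else 0 :=
    fun _ _ => rfl
  clear_value c
  have hc0 : ∀ k, c k none = 0 := by
    rintro (_ | _ | k) <;> simp [hcz, hco, hct]
  have hcr : ∀ k i j, r i = r j → c k i = c k j := by
    rintro (_ | _ | k) i j h <;> simp only [zero_add, hcz, hco, hct, h]
  -- Nodes joined by a root of `Δ'^I` have equal rank, and all coefficients depend only on the rank.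
  have hI : ∀ γ ∈ AddSubgroup.closure (RootI S μ), ∃ z, γ = intWt z ∧ ∀ k, linForm (c k) z = 0 := by
    intro γ hγ
    induction hγ using AddSubgroup.closure_induction with
    | mem x hx =>
      obtain ⟨i, j, -, h, h', rfl⟩ := (hS.mem_RootI hμ.mem).1 hx
      refine ⟨nodeInt i - nodeInt j, by rw [map_sub, intWt_nodeInt, intWt_nodeInt, nodeRoot],
        fun k => ?_⟩
      rw [map_sub, linForm_nodeInt (hc0 k), linForm_nodeInt (hc0 k), sub_eq_zero]
      exact hcr k i j (le_antisymm (hr1 _ _ (Or.inl h)) (hr1 _ _ (Or.inl h')))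
    | zero => exact ⟨0, by simp, fun k => map_zero _⟩
    | add x y _ _ hx hy =>
      obtain ⟨z, rfl, hz⟩ := hx
      obtain ⟨z', rfl, hz'⟩ := hy
      exact ⟨z + z', by rw [map_add], fun k => by rw [map_add, hz, hz', add_zero]⟩
    | neg x _ hx =>
      obtain ⟨z, rfl, hz⟩ := hx
      exact ⟨-z, by rw [map_neg], fun k => by rw [map_neg, hz, neg_zero]⟩
  refine ⟨lexNeg c, fun x hx y hy => lexNeg_add hx hy, ?_, ?_, fun a i => ?_⟩
  · rintro _ ⟨z, rfl, k, hk, hk'⟩ γ hγ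
    obtain ⟨z', rfl, hz'⟩ := hI γ hγ
    exact ⟨z + z', by rw [map_add], k, by rwa [map_add, hz', add_zero],
      fun l hl => by rw [map_add, hz', add_zero, hk' l hl]⟩
  · rintro γ hγ ⟨z, rfl, k, hk, -⟩
    obtain ⟨z', hz, hz'⟩ := hI _ hγ
    rw [intWt_injective hz, hz' k] at hk
    exact lt_irrefl _ hk
  -- sums of positive unit weights are positive
  have hpos : ∀ b : Fin m → ℕ, (∀ k, r (some k) < r none → b k = 0) →
      intWt (fun k => (b k : ℤ)) ∈ R := by
    intro b hb
    rw [sum_nodeWt]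
    refine sum_mem fun k _ => ?_
    rw [natCast_zsmul]
    rcases lt_or_ge (r (some k)) (r none) with h | h
    · rw [hb k h, zero_smul]; exact zero_mem _
    · have := hμ.nodeRoot_mem hS (hr2 _ _ h)
      rw [nodeRoot, nodeWt.eq_1, sub_zero] at this
      exact AddSubmonoid.nsmul_mem _ this _
  -- One unit of `ε_j` is spent on `-nodeWt i`; what is left involves no node below `none`.
  have hpos1 : ∀ j : Fin m, 1 ≤ a j → (∀ k, r (some k) < r none → k ≠ j → a k = 0) →
      (r (some j) < r none → a j = 1) → r i ≤ r (some j) →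
      intWt (fun k => (a k : ℤ)) - nodeWt i ∈ R := by
    intro j hj hk hj1 hji
    have e : intWt (fun k => (a k : ℤ)) - nodeWt i = nodeRoot (some j) i +
        intWt (fun k => ((a k - (if k = j then 1 else 0) : ℕ) : ℤ)) := by
      have : intWt (fun k => (a k : ℤ)) = nodeWt (some j) +
          intWt (fun k => ((a k - (if k = j then 1 else 0) : ℕ) : ℤ)) := by
        rw [← intWt_nodeInt, ← map_add]
        congr 1
        ext k
        simp only [nodeInt, Pi.add_apply, Option.some.injEq]
        by_cases hkj : k = j
        · subst hkj; simp [hj]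
        · simp [hkj, Ne.symm hkj]
      rw [this, nodeRoot]
      abel
    rw [e]
    refine add_mem (hμ.nodeRoot_mem hS (hr2 _ _ hji)) (hpos _ fun k hkn => ?_)
    by_cases hkj : k = j
    · subst hkj; simp [hj1 hkn]
    · simp [hkj, hk k hkn hkj]
  obtain ⟨z, hzdef⟩ : ∃ z : Fin m → ℤ, z = (fun k => (a k : ℤ)) - nodeInt i := ⟨_, rfl⟩
  have hz : intWt (fun k => (a k : ℤ)) - nodeWt i = intWt z := by
    rw [hzdef, map_sub, intWt_nodeInt]
  have hL : ∀ k, linForm (c k) z = ∑ b, c k (some b) * a b - c k i := fun k => by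
    rw [hzdef, map_sub, linForm_nodeInt (hc0 k), linForm_apply]
  set A := Finset.univ.filter fun k : Fin m => r (some k) < r none with hA
  have hs0 : ∑ b, c 0 (some b) * (a b : ℤ) = -∑ b ∈ A, (a b : ℤ) := by
    rw [hA, Finset.sum_filter, ← Finset.sum_neg_distrib]
    refine Finset.sum_congr rfl fun b _ => ?_
    simp only [hcz]
    split_ifs <;> simp
  have hs1 : ∑ b, c 1 (some b) * (a b : ℤ) = ∑ b ∈ A, (r (some b) : ℤ) * a b := by
    rw [hA, Finset.sum_filter]
    refine Finset.sum_congr rfl fun b _ => ?_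
    simp only [hco]
    split_ifs <;> simp
  have hzero : ∑ b ∈ A, (a b : ℤ) = 0 → ∀ k, r (some k) < r none → a k = 0 := by
    intro h k hk
    rw [Finset.sum_eq_zero_iff_of_nonneg fun _ _ => by positivity] at h
    exact_mod_cast h k (by simp [hA, hk])
  have hnn : 0 ≤ ∑ b ∈ A, (a b : ℤ) := Finset.sum_nonneg fun _ _ => by positivity
  by_cases hi : r i < r none
  · -- the node `i` is negative
    have hci : c 0 i = -1 := by simp [hcz, hi]
    rcases (show ∑ b ∈ A, (a b : ℤ) = 0 ∨ ∑ b ∈ A, (a b : ℤ) = 1 ∨ 2 ≤ ∑ b ∈ A, (a b : ℤ) by omega)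
      with h | h | h
    · left
      rw [sub_eq_add_neg]
      refine add_mem (hpos a (hzero h)) ?_
      have := hμ.nodeRoot_mem hS (hr2 none i hi.le)
      rwa [nodeRoot, nodeWt.eq_1, zero_sub] at this
    · obtain ⟨j, hjA, hj0⟩ : ∃ j ∈ A, (a j : ℤ) ≠ 0 := by
        by_contra! hn
        rw [Finset.sum_eq_zero hn] at h
        omega
      have hsplit := Finset.add_sum_erase A (fun b => (a b : ℤ)) hjA
      have hnn' : 0 ≤ ∑ b ∈ A.erase j, (a b : ℤ) := Finset.sum_nonneg fun _ _ => by positivity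
      have hj1 : a j = 1 := by omega
      have hk0 : ∀ k ∈ A.erase j, (a k : ℤ) = 0 := by
        rw [← Finset.sum_eq_zero_iff_of_nonneg fun _ _ => by positivity]
        omega
      have hk1 : ∀ k, r (some k) < r none → k ≠ j → a k = 0 := fun k hk hkj => by
        exact_mod_cast hk0 k (by simp [hA, hk, hkj])
      -- Exactly one unit `ε_j` below `none` occurs, so form `0` vanishes. If `j` ranks at least as
      -- high as `i`, it pays for `-nodeWt i`; if not, form `1` is negative.
      by_cases hji : r i ≤ r (some j)
      · exact Or.inl (hpos1 j hj1.ge hk1 (fun _ => hj1) hji)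
      · right
        refine ⟨_, hz, 1, ?_, fun l hl => ?_⟩
        · rw [hL, hs1, ← Finset.add_sum_erase A _ hjA, Finset.sum_eq_zero fun k hk => by
            rw [hk0 k hk, mul_zero], hj1]
          have : c 1 i = r i := by simp [hco, hi]
          rw [this]
          push_cast
          omega
        · obtain rfl : l = 0 := by omega
          rw [hL, hs0, h, hci]
          norm_num
    · right
      refine ⟨_, hz, 0, ?_, by simp⟩
      rw [hL, hs0, hci]
      omega
  · have hci : c 0 i = 0 := by simp [hcz, hi]
    have hci1 : c 1 i = 0 := by simp [hco, hi]
    rcases hnn.eq_or_lt with h | h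
    · have ha0 := hzero h.symm
      rcases (not_lt.1 hi).eq_or_lt with hin | hin
      · left
        rw [sub_eq_add_neg]
        refine add_mem (hpos a ha0) ?_
        have := hμ.nodeRoot_mem hS (hr2 none i hin.ge)
        rwa [nodeRoot, nodeWt.eq_1, zero_sub] at this
      · by_cases hex : ∃ j, 1 ≤ a j ∧ r i ≤ r (some j)
        · obtain ⟨j, hj, hji⟩ := hex
          exact Or.inl (hpos1 j hj (fun k hk _ => ha0 k hk) (fun hlt => by omega) hji)
        -- No unit reaches the rank of `i`. The forms for higher ranks vanish and the form for the
        -- rank of `i` equals `-1`.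
        · push Not at hex
          right
          have ha1 : ∀ b, r i ≤ r (some b) → (a b : ℤ) = 0 := fun b hb => by
            by_contra h0
            exact absurd (hex b (by omega)) (not_lt.2 hb)
          refine ⟨_, hz, m + 1 - r i + 2, ?_, fun l hl => ?_⟩
          · rw [hL]
            have h1 : c (m + 1 - r i + 2) i = 1 := by
              have := hrM i
              rw [hct]
              rw [if_pos ⟨hin, by omega⟩]
            rw [h1, Finset.sum_eq_zero]
            · norm_num
            · intro b _
              rw [hct]
              split_ifs with hb
              · rw [ha1 b (by have := hrM i; omega), mul_zero]
              · rw [zero_mul]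
          · rw [hL]
            have hAz : ∀ b ∈ A, (a b : ℤ) = 0 := fun b hb => by
              have := ha0 b (by simpa [hA] using hb)
              omega
            rcases l with _ | _ | l
            · rw [hs0, hci, ← h]; norm_num
            · rw [hs1, hci1, Finset.sum_eq_zero fun b hb => by rw [hAz b hb, mul_zero], sub_zero]
            · have h1 : c (l + 2) i = 0 := by
                rw [hct]
                rw [if_neg]
                rintro ⟨-, h⟩
                omega
              rw [h1, sub_zero, Finset.sum_eq_zero]
              intro b _
              rw [hct]
              split_ifs with hb
              · rw [ha1 b (by omega), mul_zero]
              · rw [zero_mul]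
    · right
      refine ⟨_, hz, 0, ?_, by simp⟩
      rw [hL, hs0, hci]
      omega

end IsBlocked

end Order

/-! ### Simultaneous eigenspaces and commutators -/

section LinearAlgebra

variable {ι : Type*} {V : Type*} [AddCommGroup V] [Module ℂ V]

/-- The simultaneous eigenspaces of a family of operators. -/
def jointSpace (h : ι → Module.End ℂ V) (μ : ι → ℂ) : Submodule ℂ V :=
  ⨅ i, LinearMap.ker (h i - μ i • LinearMap.id)

theorem mem_jointSpace {h : ι → Module.End ℂ V} {μ : ι → ℂ} {v : V} :
    v ∈ jointSpace h μ ↔ ∀ i, h i v = μ i • v := by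
  simp [jointSpace, sub_eq_zero]

/-- The sum of the simultaneous eigenspaces with weight in `T`. -/
def weightSum (h : ι → Module.End ℂ V) (T : Set (ι → ℂ)) : Submodule ℂ V :=
  ⨆ μ ∈ T, jointSpace h μ

theorem jointSpace_le_weightSum {h : ι → Module.End ℂ V} {T : Set (ι → ℂ)} {μ : ι → ℂ}
    (hμ : μ ∈ T) : jointSpace h μ ≤ weightSum h T :=
  le_iSup₂_of_le μ hμ le_rfl

/-- Applying `h i - ν i` removes the component of weight `ν` and rescales the others. Since a weight
other than `ν` differs from it in some coordinate `i`, induction on the number of weights recovers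
every component. -/
theorem mem_of_sum_mem {h : ι → Module.End ℂ V} {X : Submodule ℂ V}
    (hX : ∀ i, ∀ v ∈ X, h i v ∈ X) (s : Finset (ι → ℂ)) {f : (ι → ℂ) → V}
    (hf : ∀ μ ∈ s, f μ ∈ jointSpace h μ) (hs : ∑ μ ∈ s, f μ ∈ X) : ∀ μ ∈ s, f μ ∈ X := by
  classical
  induction s using Finset.induction_on generalizing f with
  | empty => simp
  | insert ν s hν ih =>
    have key : ∀ i, ∀ μ ∈ s, (μ i - ν i) • f μ ∈ X := by
      intro i
      refine ih (f := fun μ => (μ i - ν i) • f μ)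
        (fun μ hμ => Submodule.smul_mem _ _ (hf μ (by simp [hμ]))) ?_
      have h1 := X.sub_mem (hX i _ hs) (X.smul_mem (ν i) hs)
      have e : h i (∑ μ ∈ insert ν s, f μ) - ν i • ∑ μ ∈ insert ν s, f μ =
          ∑ μ ∈ s, (μ i - ν i) • f μ := by
        rw [map_sum, Finset.smul_sum, ← Finset.sum_sub_distrib, Finset.sum_insert hν]
        rw [mem_jointSpace.1 (hf ν (by simp)) i, sub_self, zero_add]
        refine Finset.sum_congr rfl fun μ hμ => ?_
        rw [mem_jointSpace.1 (hf μ (by simp [hμ])) i, sub_smul]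
      rwa [e] at h1
    have hmem : ∀ μ ∈ s, f μ ∈ X := by
      intro μ hμ
      have hne : μ ≠ ν := by rintro rfl; exact hν hμ
      obtain ⟨i, hi⟩ := Function.ne_iff.1 hne
      have := X.smul_mem (μ i - ν i)⁻¹ (key i μ hμ)
      rwa [smul_smul, inv_mul_cancel₀ (sub_ne_zero.2 hi), one_smul] at this
    intro μ hμ
    rcases Finset.mem_insert.1 hμ with rfl | hμ
    · rw [Finset.sum_insert hν] at hs
      have := X.sub_mem hs (X.sum_mem hmem)
      rwa [add_sub_cancel_right] at this
    · exact hmem μ hμ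

theorem mem_weightSum {h : ι → Module.End ℂ V} {T : Set (ι → ℂ)} {x : V} :
    x ∈ weightSum h T ↔ ∃ f : (ι → ℂ) →₀ V, (∀ μ, f μ ∈ jointSpace h μ) ∧
      (∀ μ ∈ f.support, μ ∈ T) ∧ ∑ μ ∈ f.support, f μ = x := by
  constructor
  · intro hx
    rw [weightSum, Submodule.mem_iSup_iff_exists_finsupp] at hx
    obtain ⟨f, hf, hsum⟩ := hx
    refine ⟨f, fun μ => ?_, fun μ hμ => ?_, hsum⟩
    · exact (iSup_le fun _ => le_rfl : (⨆ _ : μ ∈ T, jointSpace h μ) ≤ _) (hf μ)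
    · by_contra hT
      have := hf μ
      simp only [hT, iSup_false, Submodule.mem_bot] at this
      exact Finsupp.mem_support_iff.1 hμ this
  · rintro ⟨f, hf, hT, rfl⟩
    exact Submodule.sum_mem _ fun μ hμ => jointSpace_le_weightSum (hT μ hμ) (hf μ)

/-- A subspace which is stable under a family of operators contains the parts of its elements with
weights in a given set. -/
theorem mem_of_add_mem {h : ι → Module.End ℂ V} {X : Submodule ℂ V}
    (hX : ∀ i, ∀ v ∈ X, h i v ∈ X) {T T' : Set (ι → ℂ)} (hT : Disjoint T T') {x y : V}
    (hx : x ∈ weightSum h T) (hy : y ∈ weightSum h T') (hxy : x + y ∈ X) : x ∈ X := by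
  classical
  obtain ⟨f, hf, hfT, rfl⟩ := mem_weightSum.1 hx
  obtain ⟨f', hf', hfT', rfl⟩ := mem_weightSum.1 hy
  have e1 : ∑ μ ∈ f.support, f μ = ∑ μ ∈ f.support ∪ f'.support, f μ :=
    Finset.sum_subset Finset.subset_union_left fun μ _ hμ => by simpa using hμ
  have e2 : ∑ μ ∈ f'.support, f' μ = ∑ μ ∈ f.support ∪ f'.support, f' μ :=
    Finset.sum_subset Finset.subset_union_right fun μ _ hμ => by simpa using hμ
  rw [e1, e2, ← Finset.sum_add_distrib] at hxy
  have key := mem_of_sum_mem hX _ (f := fun μ => f μ + f' μ)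
    (fun μ _ => Submodule.add_mem _ (hf μ) (hf' μ)) hxy
  refine Submodule.sum_mem _ fun μ hμ => ?_
  have h1 := key μ (Finset.mem_union_left _ hμ)
  have h2 : f' μ = 0 := by
    by_contra h0
    exact Set.disjoint_left.1 hT (hfT μ hμ) (hfT' μ (Finsupp.mem_support_iff.2 h0))
  simpa [h2] using h1

theorem weightSum_disjoint {h : ι → Module.End ℂ V} {T T' : Set (ι → ℂ)} (hT : Disjoint T T') :
    Disjoint (weightSum h T) (weightSum h T') := by
  rw [Submodule.disjoint_def]
  intro x hx hx'
  have := mem_of_add_mem (X := ⊥) (fun i v hv => by simp_all) hT hx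
    ((weightSum h T').neg_mem hx') (by simp)
  simpa using this

/-- Interpolation: an element of a stable subspace which is killed by a product of distinct linear
factors is a sum of eigenvectors in this subspace. -/
theorem mem_iSup_of_prod_eq_zero {f : Module.End ℂ V} {N : Submodule ℂ V}
    (hN : ∀ v ∈ N, f v ∈ N) (s : Finset ℂ) {x : V} (hx : x ∈ N)
    (h0 : Polynomial.aeval f (∏ c ∈ s, (Polynomial.X - Polynomial.C c)) x = 0) :
    x ∈ ⨆ c ∈ s, N ⊓ LinearMap.ker (f - c • LinearMap.id) := by
  classical
  induction s using Finset.induction_on generalizing x with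
  | empty => simp_all
  | insert c s hc ih =>
    have hy : f x - c • x ∈ N := N.sub_mem (hN x hx) (N.smul_mem c hx)
    have h1 := ih hy (by
      rw [Finset.prod_insert hc, mul_comm, map_mul, Module.End.mul_apply] at h0
      simpa [Algebra.algebraMap_eq_smul_one] using h0)
    -- On the `d`-eigenspace with `d ≠ c`, the equation `(f - c) z = y` is solved by `z = (d - c)⁻¹
    -- y`. For `y = f x - c x`, the difference `x - z` is then a `c`-eigenvector.
    have key : ∀ y ∈ ⨆ d ∈ s, N ⊓ LinearMap.ker (f - d • LinearMap.id),
        ∃ z ∈ ⨆ d ∈ s, N ⊓ LinearMap.ker (f - d • LinearMap.id), z ∈ N ∧ f z - c • z = y := by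
      intro y hy
      induction hy using Submodule.iSup_induction' with
      | mem d y hy =>
        by_cases hd : d ∈ s
        · simp only [hd, iSup_pos] at hy
          have hne : d - c ≠ 0 := sub_ne_zero.2 fun e => hc (e ▸ hd)
          have hfy : f y = d • y := by simpa [sub_eq_zero] using hy.2
          have hz : (d - c)⁻¹ • y ∈ N ⊓ LinearMap.ker (f - d • LinearMap.id) :=
            Submodule.smul_mem _ _ hy
          refine ⟨(d - c)⁻¹ • y, Submodule.mem_iSup_of_mem d
            (Submodule.mem_iSup_of_mem hd hz), hz.1, ?_⟩
          rw [map_smul, hfy, smul_comm c, ← smul_sub, ← sub_smul, smul_smul, inv_mul_cancel₀ hne,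
            one_smul]
        · simp only [hd, iSup_false, Submodule.mem_bot] at hy
          exact ⟨0, zero_mem _, zero_mem _, by simp [hy]⟩
      | zero => exact ⟨0, zero_mem _, zero_mem _, by simp⟩
      | add y y' _ _ hy hy' =>
        obtain ⟨z, h1, h2, rfl⟩ := hy
        obtain ⟨z', h1', h2', rfl⟩ := hy'
        refine ⟨z + z', add_mem h1 h1', add_mem h2 h2', ?_⟩
        rw [map_add, smul_add]
        abel
    obtain ⟨z, hz, hzN, hzx⟩ := key _ h1
    have hle : ⨆ d ∈ s, N ⊓ LinearMap.ker (f - d • LinearMap.id) ≤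
        ⨆ d ∈ insert c s, N ⊓ LinearMap.ker (f - d • LinearMap.id) :=
      biSup_mono (f := fun d => N ⊓ LinearMap.ker (f - d • LinearMap.id)) fun d hd => by simp [hd]
    have e : x = (x - z) + z := by abel
    rw [e]
    refine add_mem (Submodule.mem_iSup_of_mem c (Submodule.mem_iSup_of_mem (by simp)
      ⟨N.sub_mem hx hzN, ?_⟩)) (hle hz)
    change f (x - z) - c • (x - z) = 0
    rw [map_sub, smul_sub, sub_sub_sub_comm, hzx, sub_self]

/-- The commutator with an operator. -/
def comm (e : Module.End ℂ V) : Module.End ℂ (Module.End ℂ V) :=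
  LinearMap.mulLeft ℂ e - LinearMap.mulRight ℂ e

theorem comm_apply (e x : Module.End ℂ V) : comm e x = e * x - x * e := rfl

theorem comm_mul (e x y : Module.End ℂ V) : comm e (x * y) = comm e x * y + x * comm e y := by
  simp only [comm_apply]
  noncomm_ring

/-- For a derivation, the elements which are killed by one of its powers form a subalgebra. -/
theorem pow_mul_eq_zero {R : Type*} [Ring R] [Algebra ℂ R] {D : Module.End ℂ R}
    (hD : ∀ a b, D (a * b) = D a * b + a * D b) {k l : ℕ} {a b : R} (ha : (D ^ k) a = 0)
    (hb : (D ^ l) b = 0) : (D ^ (k + l)) (a * b) = 0 := by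
  induction hn : k + l generalizing k l a b with
  | zero =>
    obtain rfl : k = 0 := by omega
    simp_all
  | succ p ih =>
    rcases k with _ | k
    · simp only [pow_zero, Module.End.one_apply] at ha
      simp [ha]
    rcases l with _ | l
    · simp only [pow_zero, Module.End.one_apply] at hb
      simp [hb]
    rw [pow_succ, Module.End.mul_apply, hD, map_add]
    rw [pow_succ, Module.End.mul_apply] at ha
    rw [ih (k := k) (l := l + 1) ha hb (by omega), zero_add]
    rw [← Module.End.mul_apply, ← pow_succ] at ha
    rw [pow_succ, Module.End.mul_apply] at hb
    exact ih (k := k + 1) (l := l) ha hb (by omega)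

/-- Induction on the nilpotency order of `e` at `v`. Once the iterated commutators kill `e v`, each
further commutator acts on `v` as left multiplication by `e`, which is locally nilpotent. -/
theorem exists_comm_pow_apply_eq_zero {e : Module.End ℂ V} (he : ∀ v, ∃ k, (e ^ k) v = 0)
    (x : Module.End ℂ V) (v : V) : ∃ K, ∀ k, K ≤ k → ((comm e ^ k) x) v = 0 := by
  obtain ⟨l, hl⟩ := he v
  induction l generalizing v with
  | zero =>
    simp only [pow_zero, Module.End.one_apply] at hl
    exact ⟨0, fun k _ => by rw [hl, map_zero]⟩
  | succ l ih =>
    obtain ⟨K, hK⟩ := ih (e v) (by rwa [pow_succ] at hl)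
    have step : ∀ r, ((comm e ^ (K + r)) x) v = (e ^ r) (((comm e ^ K) x) v) := by
      intro r
      induction r with
      | zero => rfl
      | succ r ihr =>
        rw [← add_assoc, pow_succ', Module.End.mul_apply, comm_apply, LinearMap.sub_apply,
          Module.End.mul_apply, Module.End.mul_apply, hK (K + r) (by omega), sub_zero, ihr,
          pow_succ', Module.End.mul_apply]
    obtain ⟨p, hp⟩ := he (((comm e ^ K) x) v)
    refine ⟨K + p, fun k hk => ?_⟩
    obtain ⟨r, rfl⟩ := Nat.exists_eq_add_of_le hk
    rw [add_assoc, step, add_comm p r, pow_add, Module.End.mul_apply, hp, map_zero]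

end LinearAlgebra

/-! ### Generators of `A_{m,n}` and polynomial vector fields -/

section Derivations

variable {m n : ℕ}

/-- The element `t_k` of `A_{m,n}`. -/
def tA (m n : ℕ) (k : Fin m) : A m n := toA m n (MvPolynomial.X k ⊗ₜ 1)

/-- The element of `A_{m,n}` defined by a vector of `ℂ^n`. -/
def ξA (m n : ℕ) (v : Fin n → ℂ) : A m n := toA m n (1 ⊗ₜ ExteriorAlgebra.ι ℂ v)

theorem A_induction {p : A m n → Prop} (h1 : p 1) (hadd : ∀ a b, p a → p b → p (a + b))
    (hsmul : ∀ (c : ℂ) a, p a → p (c • a)) (ht : ∀ k a, p a → p (tA m n k * a))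
    (hξ : ∀ v a, p a → p (ξA m n v * a)) (a : A m n) : p a := by
  obtain ⟨a, rfl⟩ := (toA m n).surjective a
  have hω : ∀ ω : ExteriorAlgebra ℂ (Fin n → ℂ), p (toA m n (1 ⊗ₜ ω)) := by
    intro ω
    refine CliffordAlgebra.left_induction (0 : QuadraticForm ℂ (Fin n → ℂ))
      (P := fun ω => p (toA m n (1 ⊗ₜ ω))) (fun r => ?_) (fun x y hx hy => ?_)
      (fun x v hx => ?_) ω
    · have := hsmul r _ h1
      rw [← toA_one, ← map_smul, Algebra.TensorProduct.one_def, ← TensorProduct.tmul_smul,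
        ← Algebra.algebraMap_eq_smul_one] at this
      exact this
    · rw [TensorProduct.tmul_add, map_add]
      exact hadd _ _ hx hy
    · have := hξ v _ hx
      rw [ξA, ← toA_mul, Algebra.TensorProduct.tmul_mul_tmul, one_mul] at this
      exact this
  induction a using TensorProduct.induction_on with
  | zero => simpa using hsmul 0 _ h1
  | add x y hx hy => rw [map_add]; exact hadd _ _ hx hy
  | tmul f ω =>
    induction f using MvPolynomial.induction_on with
    | C r =>
      have := hsmul r _ (hω ω)
      rwa [← map_smul, TensorProduct.smul_tmul', ← MvPolynomial.algebraMap_eq,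
        Algebra.algebraMap_eq_smul_one] at *
    | add f g hf hg =>
      rw [TensorProduct.add_tmul, map_add]
      exact hadd _ _ hf hg
    | mul_X f k hf =>
      have := ht k _ hf
      rwa [tA, ← toA_mul, Algebra.TensorProduct.tmul_mul_tmul, one_mul, mul_comm] at this

theorem toA_mem_Apart {j : ZMod 2} (f : MvPolynomial (Fin m) ℂ) {ω : ExteriorAlgebra ℂ (Fin n → ℂ)}
    (hω : ω ∈ CliffordAlgebra.evenOdd (0 : QuadraticForm ℂ (Fin n → ℂ)) j) :
    toA m n (f ⊗ₜ ω) ∈ Apart m n j :=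
  ⟨_, ⟨f ⊗ₜ ⟨ω, hω⟩, rfl⟩, rfl⟩

theorem tA_mem (k : Fin m) : tA m n k ∈ Apart m n 0 :=
  toA_mem_Apart _ (Submodule.one_le.1 (CliffordAlgebra.one_le_evenOdd_zero _))

theorem one_mem_Apart : (1 : A m n) ∈ Apart m n 0 := by
  rw [← toA_one, Algebra.TensorProduct.one_def]
  exact toA_mem_Apart _ (Submodule.one_le.1 (CliffordAlgebra.one_le_evenOdd_zero _))

theorem ξA_mem (v : Fin n → ℂ) : ξA m n v ∈ Apart m n 1 :=
  toA_mem_Apart _ (CliffordAlgebra.ι_mem_evenOdd_one _ v)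

theorem tA_comm (k : Fin m) (a : A m n) : tA m n k * a = a * tA m n k := by
  obtain ⟨a, rfl⟩ := (toA m n).surjective a
  rw [tA, ← toA_mul, ← toA_mul]
  congr 1
  induction a using TensorProduct.induction_on with
  | zero => simp
  | add x y hx hy => rw [mul_add, add_mul, hx, hy]
  | tmul f ω => simp [Algebra.TensorProduct.tmul_mul_tmul, mul_comm]

theorem mul_mem_Apart {i j : ZMod 2} {a b : A m n} (ha : a ∈ Apart m n i) (hb : b ∈ Apart m n j) :
    a * b ∈ Apart m n (i + j) := by
  obtain ⟨_, ⟨x, rfl⟩, rfl⟩ := ha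
  obtain ⟨_, ⟨y, rfl⟩, rfl⟩ := hb
  rw [LinearEquiv.coe_coe, ← toA_mul]
  induction x using TensorProduct.induction_on with
  | zero => simp
  | add x x' hx hx' => rw [map_add, add_mul, map_add]; exact add_mem hx hx'
  | tmul f ω =>
    induction y using TensorProduct.induction_on with
    | zero => simp
    | add x x' hx hx' => rw [map_add, mul_add, map_add]; exact add_mem hx hx'
    | tmul f' ω' =>
      rw [LinearMap.lTensor_tmul, LinearMap.lTensor_tmul, Algebra.TensorProduct.tmul_mul_tmul]
      exact toA_mem_Apart _
        (CliffordAlgebra.evenOdd_mul_le _ i j (Submodule.mul_mem_mul ω.2 ω'.2))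

theorem Wpart_map_one {j : ZMod 2} {x : Module.End ℂ (A m n)} (hx : x ∈ Wpart m n j) : x 1 = 0 := by
  have := hx.2 0 1 one_mem_Apart 1
  simpa [sgn] using this

/-- A super-derivation is determined by its values on the generators. -/
theorem Wpart_ext {j : ZMod 2} {x : Module.End ℂ (A m n)} (hx : x ∈ Wpart m n j)
    (ht : ∀ k, x (tA m n k) = 0) (hξ : ∀ i, x (ξA m n (Pi.single i 1)) = 0) : x = 0 := by
  have hξ' : ∀ v, x (ξA m n v) = 0 := by
    intro v
    have e : x ∘ₗ (toA m n).toLinearMap ∘ₗ (TensorProduct.mk ℂ (MvPolynomial (Fin m) ℂ)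
        (ExteriorAlgebra ℂ (Fin n → ℂ)) 1) ∘ₗ ExteriorAlgebra.ι ℂ = 0 := by
      ext i
      exact hξ i
    exact LinearMap.congr_fun e v
  ext a
  refine A_induction (p := fun a => x a = 0) (Wpart_map_one hx) ?_ ?_ ?_ ?_ a
  · intro a b ha hb
    rw [map_add, ha, hb, add_zero]
  · intro c a ha
    rw [map_smul, ha, smul_zero]
  · intro k a ha
    rw [hx.2 0 _ (tA_mem k), ht, ha]
    simp
  · intro v a ha
    rw [hx.2 1 _ (ξA_mem v), hξ', ha]
    simp

/-- The even derivation of `A_{m,n}` defined by a polynomial vector field. -/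
def vf (m n : ℕ) (D : Derivation ℂ (MvPolynomial (Fin m) ℂ) (MvPolynomial (Fin m) ℂ)) :
    Module.End ℂ (A m n) :=
  (toA m n).toLinearMap ∘ₗ LinearMap.rTensor (ExteriorAlgebra ℂ (Fin n → ℂ)) D.toLinearMap ∘ₗ
    (toA m n).symm.toLinearMap

variable (D D' : Derivation ℂ (MvPolynomial (Fin m) ℂ) (MvPolynomial (Fin m) ℂ))

theorem vf_tmul (f : MvPolynomial (Fin m) ℂ) (ω : ExteriorAlgebra ℂ (Fin n → ℂ)) :
    vf m n D (toA m n (f ⊗ₜ ω)) = toA m n (D f ⊗ₜ ω) := by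
  simp [vf]

theorem End_A_ext {x y : Module.End ℂ (A m n)}
    (h : ∀ f ω, x (toA m n (f ⊗ₜ ω)) = y (toA m n (f ⊗ₜ ω))) : x = y := by
  have e : x ∘ₗ (toA m n).toLinearMap = y ∘ₗ (toA m n).toLinearMap := TensorProduct.ext' h
  ext a
  obtain ⟨a, rfl⟩ := (toA m n).surjective a
  exact LinearMap.congr_fun e a

theorem vf_mul (a b : A m n) : vf m n D (a * b) = vf m n D a * b + a * vf m n D b := by
  obtain ⟨a, rfl⟩ := (toA m n).surjective a
  obtain ⟨b, rfl⟩ := (toA m n).surjective b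
  rw [← toA_mul]
  induction a using TensorProduct.induction_on with
  | zero => simp
  | add x y hx hy => simp only [add_mul, map_add, hx, hy]; abel
  | tmul f ω =>
    induction b using TensorProduct.induction_on with
    | zero => simp
    | add x y hx hy => simp only [mul_add, map_add, hx, hy]; abel
    | tmul f' ω' =>
      simp only [vf_tmul, ← toA_mul, Algebra.TensorProduct.tmul_mul_tmul, Derivation.leibniz,
        smul_eq_mul, ← map_add, TensorProduct.add_tmul]
      rw [add_comm, mul_comm f' (D f)]

theorem vf_mem : vf m n D ∈ Wpart m n 0 := by
  refine ⟨?_, fun j a _ b => ?_⟩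
  · rintro j _ ⟨_, ⟨z, rfl⟩, rfl⟩
    rw [zero_add]
    induction z using TensorProduct.induction_on with
    | zero => simp
    | add x y hx hy => simp only [map_add]; exact add_mem hx hy
    | tmul f ω =>
      rw [LinearMap.lTensor_tmul, LinearEquiv.coe_coe, vf_tmul]
      exact toA_mem_Apart _ ω.2
  · rw [vf_mul, zero_mul, sgn_zero, one_smul]

theorem vf_bracket : comm (vf m n D) (vf m n D') = vf m n ⁅D, D'⁆ := by
  apply End_A_ext
  intro f ω
  simp only [comm_apply, LinearMap.sub_apply, Module.End.mul_apply, vf_tmul,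
    Derivation.commutator_apply, TensorProduct.sub_tmul, map_sub]

theorem vf_smul (c : ℂ) : vf m n (c • D) = c • vf m n D := by
  apply End_A_ext
  intro f ω
  simp only [vf_tmul, LinearMap.smul_apply, Derivation.smul_apply, ← TensorProduct.smul_tmul',
    map_smul]

theorem vf_sub : vf m n (D - D') = vf m n D - vf m n D' := by
  apply End_A_ext
  intro f ω
  simp only [vf_tmul, LinearMap.sub_apply, Derivation.sub_apply, TensorProduct.sub_tmul, map_sub]

/-- The derivation `f ∂/∂t_i` of the polynomial algebra. -/
def pd (f : MvPolynomial (Fin m) ℂ) (i : Fin m) :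
    Derivation ℂ (MvPolynomial (Fin m) ℂ) (MvPolynomial (Fin m) ℂ) :=
  f • MvPolynomial.pderiv i

theorem pd_X (f : MvPolynomial (Fin m) ℂ) (i j : Fin m) :
    pd f i (MvPolynomial.X j) = if j = i then f else 0 := by
  classical
  simp only [pd, Derivation.smul_apply, MvPolynomial.pderiv_X, smul_eq_mul, Pi.single_apply]
  split_ifs <;> simp

theorem pd_bracket (f g : MvPolynomial (Fin m) ℂ) (i j : Fin m) :
    ⁅pd f i, pd g j⁆ = pd (pd f i g) j - pd (pd g j f) i := by
  apply MvPolynomial.derivation_ext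
  intro k
  rw [Derivation.commutator_apply, Derivation.sub_apply]
  simp only [pd_X]
  split_ifs <;> simp

theorem d_eq_vf (i : Fin m) : d m n i = vf m n (pd (MvPolynomial.X i) i) := by
  apply End_A_ext
  intro f ω
  rw [d_toA, dT_tmul, vf_tmul]
  rfl

end Derivations

/-! ### Vectors killed by split polynomials in an operator -/

section Interpolation

variable {V V' : Type*} [AddCommGroup V] [Module ℂ V] [AddCommGroup V'] [Module ℂ V']

theorem aeval_intertwine {f : Module.End ℂ V} {g : Module.End ℂ V'} {L : V →ₗ[ℂ] V'}
    (h : ∀ x, L (f x) = g (L x)) (p : Polynomial ℂ) (x : V) :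
    L (Polynomial.aeval f p x) = Polynomial.aeval g p (L x) := by
  induction p using Polynomial.induction_on' generalizing x with
  | add p q hp hq => simp [hp, hq]
  | monomial k c =>
    have : ∀ x, L ((f ^ k) x) = (g ^ k) (L x) := by
      induction k with
      | zero => simp
      | succ k ih => intro x; rw [pow_succ, pow_succ, Module.End.mul_apply, ih, h]; rfl
    simp [Polynomial.aeval_monomial, this, Algebra.algebraMap_eq_smul_one]

theorem aeval_mem {f : Module.End ℂ V} {N : Submodule ℂ V} (hN : ∀ v ∈ N, f v ∈ N)
    (p : Polynomial ℂ) {x : V} (hx : x ∈ N) : Polynomial.aeval f p x ∈ N := by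
  have h := aeval_intertwine (f := f.restrict hN) (g := f) (L := N.subtype) (fun _ => rfl) p ⟨x, hx⟩
  rw [Submodule.subtype_apply, Submodule.subtype_apply] at h
  rw [← h]
  exact (Polynomial.aeval (f.restrict hN) p ⟨x, hx⟩).2

/-- `z` is killed by a product of distinct linear factors in `f`. -/
def SplitKilled (f : Module.End ℂ V) (z : V) : Prop :=
  ∃ s : Finset ℂ, Polynomial.aeval f (∏ c ∈ s, (Polynomial.X - Polynomial.C c)) z = 0

theorem aeval_eq_zero_of_subset {f : Module.End ℂ V} {z : V} {s t : Finset ℂ} (hst : s ⊆ t)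
    (h : Polynomial.aeval f (∏ c ∈ s, (Polynomial.X - Polynomial.C c)) z = 0) :
    Polynomial.aeval f (∏ c ∈ t, (Polynomial.X - Polynomial.C c)) z = 0 := by
  obtain ⟨q, hq⟩ := Finset.prod_dvd_prod_of_subset s t
    (fun c => Polynomial.X - Polynomial.C c) hst
  rw [hq, mul_comm, map_mul, Module.End.mul_apply, h, map_zero]

theorem SplitKilled.add {f : Module.End ℂ V} {z z' : V} (h : SplitKilled f z)
    (h' : SplitKilled f z') : SplitKilled f (z + z') := by
  classical
  obtain ⟨s, hs⟩ := h
  obtain ⟨s', hs'⟩ := h'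
  refine ⟨s ∪ s', ?_⟩
  rw [map_add, aeval_eq_zero_of_subset Finset.subset_union_left hs,
    aeval_eq_zero_of_subset Finset.subset_union_right hs', add_zero]

end Interpolation

/-! ### Root space decomposition of `W_{m,n}` -/

section Weights

variable {m n : ℕ}

theorem comm_mem_Wpart {e x : Module.End ℂ (A m n)} {j : ZMod 2} (he : e ∈ Wpart m n 0)
    (hx : x ∈ Wpart m n j) : comm e x ∈ Wpart m n j := by
  have h : e * x - sgn (0 * j) • (x * e) ∈ (W m n).part (0 + j) := (W m n).bracket_mem he hx
  rw [zero_add, zero_mul, sgn_zero, one_smul] at h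
  exact h

theorem d_mul (i : Fin m) (a b : A m n) : d m n i (a * b) = d m n i a * b + a * d m n i b := by
  rw [d_eq_vf, vf_mul]

theorem vf_tA (D : Derivation ℂ (MvPolynomial (Fin m) ℂ) (MvPolynomial (Fin m) ℂ)) (k : Fin m) :
    vf m n D (tA m n k) = toA m n (D (MvPolynomial.X k) ⊗ₜ 1) := vf_tmul _ _ _

theorem vf_ξA (D : Derivation ℂ (MvPolynomial (Fin m) ℂ) (MvPolynomial (Fin m) ℂ))
    (v : Fin n → ℂ) : vf m n D (ξA m n v) = 0 := by
  rw [ξA, vf_tmul, Derivation.map_one_eq_zero, TensorProduct.zero_tmul, map_zero]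

theorem mul_mem_jointSpace {μ ν : Wt m} {a b : A m n} (ha : a ∈ jointSpace (d m n) μ)
    (hb : b ∈ jointSpace (d m n) ν) : a * b ∈ jointSpace (d m n) (μ + ν) := by
  rw [mem_jointSpace] at *
  intro i
  rw [d_mul, ha, hb, Pi.add_apply, add_smul, smul_mul_assoc, mul_smul_comm]

theorem tA_mem_jointSpace (k : Fin m) : tA m n k ∈ jointSpace (d m n) (ε k) := by
  rw [mem_jointSpace]
  intro i
  rw [d_eq_vf, vf_tA, pd_X, ε_apply]
  split_ifs with h
  · rw [one_smul, h]; rfl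
  · simp

theorem ξA_mem_jointSpace (v : Fin n → ℂ) : ξA m n v ∈ jointSpace (d m n) 0 := by
  rw [mem_jointSpace]
  intro i
  rw [d_eq_vf, vf_ξA, Pi.zero_apply, zero_smul]

/-- The weights of `A_{m,n}`. -/
def natWt (m : ℕ) : Set (Wt m) := {μ | ∃ a : Fin m → ℕ, μ = intWt fun k => (a k : ℤ)}

theorem weightSum_natWt : weightSum (d m n) (natWt m) = ⊤ := by
  rw [eq_top_iff]
  rintro a -
  refine A_induction (p := fun a => a ∈ weightSum (d m n) (natWt m)) ?_ (fun a b => add_mem)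
    (fun c a => Submodule.smul_mem _ c) ?_ ?_ a
  · have h0 : (0 : Wt m) ∈ natWt m := ⟨0, by ext; simp [intWt_apply]⟩
    refine jointSpace_le_weightSum h0 ?_
    rw [mem_jointSpace]
    intro i
    rw [Wpart_map_one (d_mem m n i), Pi.zero_apply, zero_smul]
  · intro k a ha
    have hle : weightSum (d m n) (natWt m) ≤
        (weightSum (d m n) (natWt m)).comap (LinearMap.mulLeft ℂ (tA m n k)) := by
      refine iSup₂_le ?_
      rintro _ ⟨b, rfl⟩ y hy
      refine jointSpace_le_weightSum ?_ (mul_mem_jointSpace (tA_mem_jointSpace k) hy)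
      refine ⟨fun i => (if k = i then 1 else 0) + b i, ?_⟩
      ext i
      simp [intWt_apply, ε_apply]
    exact hle ha
  · intro v a ha
    have hle : weightSum (d m n) (natWt m) ≤
        (weightSum (d m n) (natWt m)).comap (LinearMap.mulLeft ℂ (ξA m n v)) := by
      refine iSup₂_le ?_
      rintro μ hμ y hy
      have := mul_mem_jointSpace (ξA_mem_jointSpace v) hy
      rw [zero_add] at this
      exact jointSpace_le_weightSum hμ this
    exact hle ha

theorem mem_natWt_of_ne_zero {μ : Wt m} {a : A m n} (ha : a ∈ jointSpace (d m n) μ) (h0 : a ≠ 0) :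
    μ ∈ natWt m := by
  by_contra hμ
  have hd : Disjoint ({μ} : Set (Wt m)) (natWt m) := Set.disjoint_singleton_left.2 hμ
  have h1 : a ∈ weightSum (d m n) {μ} := jointSpace_le_weightSum (Set.mem_singleton μ) ha
  have h2 : a ∈ weightSum (d m n) (natWt m) := weightSum_natWt (m := m) (n := n) ▸ Submodule.mem_top
  exact h0 (Submodule.disjoint_def.1 (weightSum_disjoint (h := d m n) hd) a h1 h2)

theorem rootSpace_apply {α β : Wt m} {j : ZMod 2} {x : Module.End ℂ (A m n)}
    (hx : x ∈ rootSpace m n α j) {a : A m n} (ha : a ∈ jointSpace (d m n) β) :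
    x a ∈ jointSpace (d m n) (α + β) := by
  rw [mem_jointSpace] at *
  intro i
  have := LinearMap.congr_fun (hx.2 i) a
  simp only [LinearMap.sub_apply, Module.End.mul_apply, ha i, map_smul, LinearMap.smul_apply] at this
  rw [Pi.add_apply, add_smul, ← this]
  abel

/-- A nonzero root vector does not kill all generators. The image of a generator has a weight in
`ℕ^m`, and generators have weight `ε_k` or `0`; the difference is the root. -/
theorem exists_of_rootSpace_ne_bot {α : Wt m} {j : ZMod 2} (h : rootSpace m n α j ≠ ⊥) :
    ∃ (a : Fin m → ℕ) (i : Option (Fin m)), α = intWt (fun k => (a k : ℤ)) - nodeWt i := by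
  obtain ⟨x, hx, hx0⟩ := (Submodule.ne_bot_iff _).1 h
  by_contra! hn
  refine hx0 (Wpart_ext hx.1 (fun k => ?_) fun i => ?_)
  · by_contra hk
    obtain ⟨a, ha⟩ := mem_natWt_of_ne_zero (rootSpace_apply hx (tA_mem_jointSpace k)) hk
    exact hn a (some k) (by rw [← ha, nodeWt, add_sub_cancel_right])
  · by_contra hk
    obtain ⟨a, ha⟩ := mem_natWt_of_ne_zero (rootSpace_apply hx (ξA_mem_jointSpace _)) hk
    exact hn a none (by rw [← ha, nodeWt, add_zero, sub_zero])

theorem splitKilled_A (i : Fin m) (δ : ℂ) (z : A m n) :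
    SplitKilled (d m n i - δ • (LinearMap.id : Module.End ℂ (A m n))) z := by
  have hz : z ∈ weightSum (d m n) (natWt m) := by rw [weightSum_natWt]; trivial
  obtain ⟨f, hf, -, rfl⟩ := mem_weightSum.1 hz
  refine Finset.sum_induction _ (SplitKilled _) (fun _ _ => SplitKilled.add)
    ⟨∅, by simp⟩ fun μ _ => ⟨{μ i - δ}, ?_⟩
  have := mem_jointSpace.1 (hf μ) i
  simp [this, Algebra.algebraMap_eq_smul_one]

/-- A super-derivation is determined by its values on finitely many generators. Each value has
finitely many weight components, so one product of distinct linear factors in `ad d_i` annihilates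
the derivation on all generators. -/
theorem splitKilled_W (i : Fin m) {j : ZMod 2} {x : Module.End ℂ (A m n)} (hx : x ∈ Wpart m n j) :
    SplitKilled (comm (d m n i)) x := by
  classical
  have key : ∀ (δ : ℂ) (w : A m n), d m n i w = δ • w → ∃ s : Finset ℂ, ∀ t, s ⊆ t →
      (Polynomial.aeval (comm (d m n i)) (∏ c ∈ t, (Polynomial.X - Polynomial.C c)) x) w = 0 := by
    intro δ w hw
    obtain ⟨s, hs⟩ := splitKilled_A i δ (x w)
    refine ⟨s, fun t hst => ?_⟩
    have := aeval_intertwine (f := comm (d m n i))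
      (g := d m n i - δ • (LinearMap.id : Module.End ℂ (A m n)))
      (L := LinearMap.applyₗ w) (fun y => by
        simp [comm_apply, hw]) (∏ c ∈ t, (Polynomial.X - Polynomial.C c)) x
    simp only [LinearMap.applyₗ_apply_apply] at this
    rw [this]
    exact aeval_eq_zero_of_subset hst hs
  choose s hs using fun k => key _ (tA m n k) (mem_jointSpace.1 (tA_mem_jointSpace k) i)
  choose s' hs' using fun k : Fin n => key _ (ξA m n (Pi.single k 1))
    (mem_jointSpace.1 (ξA_mem_jointSpace _) i)
  refine ⟨Finset.univ.biUnion s ∪ Finset.univ.biUnion s', ?_⟩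
  refine Wpart_ext (aeval_mem (fun y hy => comm_mem_Wpart (d_mem m n i) hy) _ hx)
    (fun k => hs k _ ?_) fun k => hs' k _ ?_
  · exact (Finset.subset_biUnion_of_mem s (Finset.mem_univ k)).trans Finset.subset_union_left
  · exact (Finset.subset_biUnion_of_mem s' (Finset.mem_univ k)).trans Finset.subset_union_right

theorem mem_rootSpace_iff {α : Wt m} {j : ZMod 2} {x : Module.End ℂ (A m n)} :
    x ∈ rootSpace m n α j ↔ x ∈ Wpart m n j ∧ ∀ i, comm (d m n i) x = α i • x := Iff.rfl

theorem comm_comm_of_commute {V : Type*} [AddCommGroup V] [Module ℂ V] {e f : Module.End ℂ V}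
    (h : f * e = e * f) (x : Module.End ℂ V) :
    comm e (comm f x) = comm f (comm e x) := by
  have h' : f * (e * x) = e * (f * x) := by rw [← mul_assoc, h, mul_assoc]
  simp only [comm_apply, mul_sub, sub_mul, mul_assoc, h, h']
  abel

theorem comm_d_comm (i k : Fin m) (x : Module.End ℂ (A m n)) :
    comm (d m n i) (comm (d m n k) x) = comm (d m n k) (comm (d m n i) x) :=
  comm_comm_of_commute (d_comm m n i k) x

/-- Every super-derivation is a sum of root vectors. -/
theorem Wpart_le_iSup_rootSpace (j : ZMod 2) : Wpart m n j ≤ ⨆ α, rootSpace m n α j := by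
  classical
  -- The operators `ad d_i` commute, so they can be diagonalised one index at a time.
  have key : ∀ t : Finset (Fin m), Wpart m n j ≤
      ⨆ α : Wt m, Wpart m n j ⊓ ⨅ i ∈ t, LinearMap.ker (comm (d m n i) - α i • LinearMap.id) := by
    intro t
    induction t using Finset.induction_on with
    | empty => exact le_iSup_of_le 0 (by simp)
    | insert k t hk ih =>
      refine ih.trans (iSup_le fun α x hx => ?_)
      have hmem : ∀ y ∈ Wpart m n j ⊓ ⨅ i ∈ t,
          LinearMap.ker (comm (d m n i) - α i • LinearMap.id), comm (d m n k) y ∈ Wpart m n j ⊓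
            ⨅ i ∈ t, LinearMap.ker (comm (d m n i) - α i • LinearMap.id) := by
        rintro y ⟨hy, hy'⟩
        refine ⟨comm_mem_Wpart (d_mem m n k) hy, ?_⟩
        simp only [SetLike.mem_coe, Submodule.mem_iInf, LinearMap.mem_ker, LinearMap.sub_apply,
          LinearMap.smul_apply, LinearMap.id_apply, sub_eq_zero] at hy' ⊢
        intro i hi
        rw [comm_d_comm, hy' i hi, map_smul]
      obtain ⟨s, hs⟩ := splitKilled_W k hx.1
      refine SetLike.le_def.1 (iSup₂_le fun c _ => ?_)
        (mem_iSup_of_prod_eq_zero hmem s hx hs)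
      refine le_iSup_of_le (Function.update α k c) ?_
      rintro y ⟨⟨hy, hy'⟩, hy''⟩
      refine ⟨hy, ?_⟩
      simp only [SetLike.mem_coe, Submodule.mem_iInf] at hy' ⊢
      intro i hi
      rcases Finset.mem_insert.1 hi with rfl | hi
      · simpa using hy''
      · have : i ≠ k := fun h => hk (h ▸ hi)
        rw [Function.update_of_ne this]
        exact hy' i hi
  refine (key Finset.univ).trans (iSup_mono fun α x hx => ?_)
  refine ⟨hx.1, fun i => ?_⟩
  have := hx.2
  simp only [SetLike.mem_coe, Submodule.mem_iInf, LinearMap.mem_ker, LinearMap.sub_apply,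
    LinearMap.smul_apply, LinearMap.id_apply, sub_eq_zero] at this
  exact this i (Finset.mem_univ i)

end Weights

/-! ### Ad-nilpotent root vectors and their brackets -/

section Nilpotent

variable {m n : ℕ}

/-- The commutators are pointwise eventually zero, and a derivation needs to be tested only on
finitely many generators, so a common exponent exists. -/
theorem exists_comm_pow_eq_zero {e : Module.End ℂ (A m n)} (he : e ∈ Wpart m n 0)
    (hnil : ∀ v, ∃ k, (e ^ k) v = 0) {j : ZMod 2} {x : Module.End ℂ (A m n)}
    (hx : x ∈ Wpart m n j) : ∃ k, (comm e ^ k) x = 0 := by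
  choose K hK using exists_comm_pow_apply_eq_zero hnil x
  have hmem : ∀ k, (comm e ^ k) x ∈ Wpart m n j := by
    intro k
    induction k with
    | zero => exact hx
    | succ k ih => rw [pow_succ']; exact comm_mem_Wpart he ih
  refine ⟨∑ k, K (tA m n k) + ∑ i, K (ξA m n (Pi.single i 1)), Wpart_ext (hmem _)
    (fun k => hK _ _ ?_) fun i => hK _ _ ?_⟩
  · exact (Finset.single_le_sum (f := fun k => K (tA m n k)) (fun _ _ => Nat.zero_le _)
      (Finset.mem_univ k)).trans (Nat.le_add_right _ _)
  · exact (Finset.single_le_sum (f := fun i => K (ξA m n (Pi.single i 1)))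
      (fun _ _ => Nat.zero_le _) (Finset.mem_univ i)).trans (Nat.le_add_left _ _)

/-- If `f ∂_i` kills `f`, then its square kills every `t_k`, and it kills the odd generators. The
Leibniz rule spreads local nilpotency to products. -/
theorem vf_locally_nilpotent {f : MvPolynomial (Fin m) ℂ} {i : Fin m} (hf : pd f i f = 0)
    (a : A m n) : ∃ k, (vf m n (pd f i) ^ k) a = 0 := by
  refine A_induction (p := fun a => ∃ k, (vf m n (pd f i) ^ k) a = 0) ⟨1, ?_⟩ ?_ ?_ ?_ ?_ a
  · rw [pow_one]; exact Wpart_map_one (vf_mem _)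
  · rintro a b ⟨k, hk⟩ ⟨l, hl⟩
    have h1 : (vf m n (pd f i) ^ (l + k)) a = 0 := by
      rw [pow_add, Module.End.mul_apply, hk, map_zero]
    have h2 : (vf m n (pd f i) ^ (l + k)) b = 0 := by
      rw [add_comm, pow_add, Module.End.mul_apply, hl, map_zero]
    exact ⟨l + k, by rw [map_add, h1, h2, add_zero]⟩
  · rintro c a ⟨k, hk⟩
    exact ⟨k, by rw [map_smul, hk, smul_zero]⟩
  · rintro k a ⟨l, hl⟩
    refine ⟨2 + l, pow_mul_eq_zero (vf_mul _) ?_ hl⟩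
    rw [pow_two, Module.End.mul_apply, vf_tA, vf_tmul, pd_X]
    split_ifs
    · rw [hf]; simp
    · simp
  · rintro v a ⟨l, hl⟩
    refine ⟨1 + l, pow_mul_eq_zero (vf_mul _) ?_ hl⟩
    rw [pow_one, vf_ξA]

theorem vf_mem_rootSpace {f : MvPolynomial (Fin m) ℂ} {β : Wt m}
    (hf : ∀ k, pd (MvPolynomial.X k) k f = β k • f) (i : Fin m) :
    vf m n (pd f i) ∈ rootSpace m n (β - ε i) 0 := by
  rw [mem_rootSpace_iff]
  refine ⟨vf_mem _, fun k => ?_⟩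
  rw [d_eq_vf, vf_bracket, ← vf_smul]
  congr 1
  rw [pd_bracket, hf, pd_X, Pi.sub_apply, ε_apply]
  apply MvPolynomial.derivation_ext
  intro l
  simp only [Derivation.sub_apply, Derivation.smul_apply, pd_X]
  by_cases h1 : i = l
  · by_cases h2 : k = i
    · subst h1 h2; simp [sub_smul]
    · subst h1; simp [Ne.symm h2]
  · have h1' := Ne.symm h1
    by_cases h2 : k = i
    · subst h2; simp [h1']
    · simp [h1', h2]

/-- The polynomials `t_i`, together with `t_none = 1`. -/
def nodePoly : Option (Fin m) → MvPolynomial (Fin m) ℂ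
  | none => 1
  | some k => MvPolynomial.X k

/-- The root vector `t_i ∂/∂t_j`. -/
def rootVec (m n : ℕ) (i : Option (Fin m)) (j : Fin m) : Module.End ℂ (A m n) :=
  vf m n (pd (nodePoly i) j)

theorem pd_nodePoly (f : MvPolynomial (Fin m) ℂ) (i : Option (Fin m)) (j : Fin m) :
    pd f j (nodePoly i) = if i = some j then f else 0 := by
  rcases i with _ | i
  · simp [nodePoly]
  · simp [nodePoly, pd_X]

theorem rootVec_mem (i : Option (Fin m)) (j : Fin m) :
    rootVec m n i j ∈ rootSpace m n (nodeRoot i (some j)) 0 := by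
  refine vf_mem_rootSpace (fun k => ?_) j
  rw [pd_nodePoly, nodeWt_apply]
  split_ifs with h
  · rw [h, one_smul]; rfl
  · rw [zero_smul]

theorem rootVec_nilpotent {i : Option (Fin m)} {j : Fin m} (hij : i ≠ some j) {p : ZMod 2}
    {x : Module.End ℂ (A m n)} (hx : x ∈ Wpart m n p) : ∃ k, (comm (rootVec m n i j) ^ k) x = 0 := by
  refine exists_comm_pow_eq_zero (vf_mem _) (vf_locally_nilpotent ?_) hx
  rw [pd_nodePoly, if_neg hij]

/-- The root vector `t_i^r ∂/∂t_i`. -/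
def lineVec (m n : ℕ) (i : Fin m) (r : ℕ) : Module.End ℂ (A m n) :=
  vf m n (pd (MvPolynomial.X i ^ r) i)

theorem pd_X_pow (i j : Fin m) (r : ℕ) (f : MvPolynomial (Fin m) ℂ) :
    pd f j (MvPolynomial.X i ^ r) =
      if i = j then (r : ℂ) • (MvPolynomial.X i ^ (r - 1) * f) else 0 := by
  rw [Derivation.leibniz_pow, pd_X]
  split_ifs
  · rw [← Nat.cast_smul_eq_nsmul ℂ, smul_eq_mul]
  · simp

theorem lineVec_mem (i : Fin m) (r : ℕ) :
    lineVec m n i r ∈ rootSpace m n ((r : ℂ) • ε i - ε i) 0 := by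
  refine vf_mem_rootSpace (fun k => ?_) i
  rw [pd_X_pow, Pi.smul_apply, ε_apply]
  split_ifs with h
  · rcases r with _ | r
    · simp
    · rw [h, Nat.add_sub_cancel, ← pow_succ]; simp
  · simp

theorem comm_lineVec (i : Fin m) (r : ℕ) :
    comm (lineVec m n i 0) (lineVec m n i (r + 1)) = ((r + 1 : ℕ) : ℂ) • lineVec m n i r := by
  rw [lineVec, lineVec, lineVec, vf_bracket, pd_bracket, pd_X_pow, pd_X_pow, if_pos rfl,
    if_pos rfl, ← vf_smul]
  congr 1
  apply MvPolynomial.derivation_ext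
  intro l
  simp only [Derivation.sub_apply, Derivation.smul_apply, pd_X]
  split_ifs <;> simp

theorem lineVec_zero (i : Fin m) : lineVec m n i 0 = rootVec m n none i := by
  rw [lineVec, rootVec, pow_zero]; rfl

theorem comm_rootVec (i j : Fin m) :
    comm (rootVec m n (some i) j) (rootVec m n (some j) i) = d m n i - d m n j := by
  rw [rootVec, rootVec, vf_bracket, pd_bracket, d_eq_vf, d_eq_vf, ← vf_sub]
  simp only [pd_nodePoly, if_true]
  rfl

theorem comm_lineVec_two (i : Fin m) :
    comm (rootVec m n none i) (lineVec m n i 2) = (2 : ℂ) • d m n i := by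
  have h1 : lineVec m n i 1 = d m n i := by rw [lineVec, pow_one, d_eq_vf]
  rw [← lineVec_zero, comm_lineVec, h1]
  norm_num

end Nilpotent

/-! ### Surjectivity of `ad ∂_k` on root vectors -/

section Antiderivative

variable {m n : ℕ}

theorem comm_mem_rootSpace {α β : Wt m} {j : ZMod 2} {e x : Module.End ℂ (A m n)}
    (he : e ∈ rootSpace m n α 0) (hx : x ∈ rootSpace m n β j) :
    comm e x ∈ rootSpace m n (α + β) j := by
  have h := rootSpace_bracket he hx
  rw [zero_add, zero_mul, sgn_zero, one_smul] at h
  exact h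

theorem tA_mul_mem {α : Wt m} {j : ZMod 2} {x : Module.End ℂ (A m n)} (k : Fin m)
    (hx : x ∈ rootSpace m n α j) :
    LinearMap.mulLeft ℂ (tA m n k) * x ∈ rootSpace m n (α + ε k) j := by
  rw [mem_rootSpace_iff] at *
  refine ⟨⟨?_, fun i a ha b => ?_⟩, fun i => ?_⟩
  · intro i a ha
    have := mul_mem_Apart (tA_mem k) (hx.1.1 i a ha)
    rw [zero_add] at this
    exact this
  · simp only [Module.End.mul_apply, LinearMap.mulLeft_apply]
    rw [hx.1.2 i a ha b, mul_add, mul_smul_comm, mul_assoc, ← mul_assoc, ← mul_assoc, tA_comm k a,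
      mul_assoc a]
  · ext a
    have h1 := LinearMap.congr_fun (hx.2 i) a
    have h2 := mem_jointSpace.1 (tA_mem_jointSpace (n := n) k) i
    simp only [comm_apply, LinearMap.sub_apply, Module.End.mul_apply, LinearMap.mulLeft_apply,
      LinearMap.smul_apply] at h1 ⊢
    rw [d_mul, h2, Pi.add_apply, add_smul, ← mul_smul_comm, ← h1, mul_sub, smul_mul_assoc]
    abel

theorem comm_partial_tA_mul (k : Fin m) (x : Module.End ℂ (A m n)) :
    comm (rootVec m n none k) (LinearMap.mulLeft ℂ (tA m n k) * x) =
      x + LinearMap.mulLeft ℂ (tA m n k) * comm (rootVec m n none k) x := by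
  have h : rootVec m n none k (tA m n k) = 1 := by
    rw [rootVec, vf_tA, pd_X, if_pos rfl, ← toA_one]
    rfl
  ext a
  simp only [comm_apply, LinearMap.sub_apply, Module.End.mul_apply, LinearMap.mulLeft_apply,
    LinearMap.add_apply]
  rw [rootVec] at *
  rw [vf_mul, h, one_mul, mul_sub]
  abel

theorem comm_partial_mem {β : Wt m} {j : ZMod 2} {x : Module.End ℂ (A m n)} (k : Fin m)
    (hx : x ∈ rootSpace m n β j) : comm (rootVec m n none k) x ∈ rootSpace m n (β - ε k) j := by
  have := comm_mem_rootSpace (rootVec_mem none k) hx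
  rwa [show nodeRoot none (some k) + β = β - ε k by
    simp [nodeRoot, nodeWt, sub_eq_add_neg, add_comm]] at this

/-- Antiderivatives with respect to `∂/∂t_k`. -/
theorem exists_comm_partial_eq {β : Wt m} {j : ZMod 2} {x : Module.End ℂ (A m n)} (k : Fin m)
    (hx : x ∈ rootSpace m n β j) :
    ∃ y ∈ rootSpace m n (β + ε k) j, comm (rootVec m n none k) y = x := by
  obtain ⟨l, hl⟩ := rootVec_nilpotent (i := none) (j := k) (by simp) hx.1
  have hT : ∀ (r : ℕ) (β : Wt m) (x : Module.End ℂ (A m n)), x ∈ rootSpace m n β j →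
      ((LinearMap.mulLeft ℂ (tA m n k)) ^ r * x ∈ rootSpace m n (β + (r : ℂ) • ε k) j) ∧
      comm (rootVec m n none k) ((LinearMap.mulLeft ℂ (tA m n k)) ^ (r + 1) * x) =
        ((r + 1 : ℕ) : ℂ) • ((LinearMap.mulLeft ℂ (tA m n k)) ^ r * x) +
          (LinearMap.mulLeft ℂ (tA m n k)) ^ (r + 1) * comm (rootVec m n none k) x := by
    intro r
    induction r with
    | zero =>
      intro β x hx
      refine ⟨by simpa using hx, ?_⟩
      simp [comm_partial_tA_mul]
    | succ r ih =>
      intro β x hx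
      obtain ⟨h1, h2⟩ := ih β x hx
      constructor
      · have := tA_mul_mem k h1
        rw [← mul_assoc, ← pow_succ'] at this
        have e : β + (r : ℂ) • ε k + ε k = β + ((r + 1 : ℕ) : ℂ) • ε k := by
          push_cast
          module
        rwa [e] at this
      · rw [pow_succ', mul_assoc, comm_partial_tA_mul, h2, mul_add, ← mul_assoc, ← pow_succ',
          mul_smul_comm, ← mul_assoc, ← pow_succ']
        push_cast
        module
  -- Integration by parts: `ad ∂_k` sends `t_k^{r+1} x / (r+1)` to `t_k^r x` plus `t_k^{r+1} [∂_k,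
  -- x] / (r+1)`. The error term is integrated by induction, as `[∂_k, x]` has smaller nilpotency
  -- order.
  have key : ∀ (l r : ℕ) (β : Wt m) (x : Module.End ℂ (A m n)), x ∈ rootSpace m n β j →
      (comm (rootVec m n none k) ^ l) x = 0 →
      ∃ y ∈ rootSpace m n (β + ((r + 1 : ℕ) : ℂ) • ε k) j,
        comm (rootVec m n none k) y = (LinearMap.mulLeft ℂ (tA m n k)) ^ r * x := by
    intro l
    induction l with
    | zero =>
      intro r β x hx h0
      simp only [pow_zero, Module.End.one_apply] at h0
      exact ⟨0, zero_mem _, by simp [h0]⟩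
    | succ l ih =>
      intro r β x hx h0
      rw [pow_succ, Module.End.mul_apply] at h0
      obtain ⟨y, hy, hyx⟩ := ih (r + 1) _ _ (comm_partial_mem k hx) h0
      have e : β - ε k + ((r + 1 + 1 : ℕ) : ℂ) • ε k = β + ((r + 1 : ℕ) : ℂ) • ε k := by
        push_cast
        module
      rw [e] at hy
      have hr : ((r + 1 : ℕ) : ℂ) ≠ 0 := Nat.cast_ne_zero.2 (Nat.succ_ne_zero r)
      refine ⟨((r + 1 : ℕ) : ℂ)⁻¹ • ((LinearMap.mulLeft ℂ (tA m n k)) ^ (r + 1) * x - y),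
        Submodule.smul_mem _ _ (sub_mem (hT (r + 1) β x hx).1 hy), ?_⟩
      rw [map_smul, map_sub, (hT r β x hx).2, hyx, add_sub_cancel_right, smul_smul,
        inv_mul_cancel₀ hr, one_smul]
  obtain ⟨y, hy, hyx⟩ := key l 0 β x hx hl
  exact ⟨y, by simpa using hy, by simpa using hyx⟩

end Antiderivative

/-! ### Ad-nilpotency and powers of an operator -/

section Operators

variable {V : Type*} [AddCommGroup V] [Module ℂ V]

/-- If `X` is ad-nilpotent for `E`, it preserves the vectors killed by a power of `E`. -/
theorem pow_apply_eq_zero_of_comm {E : Module.End ℂ V} {k l : ℕ} {X : Module.End ℂ V} {v : V}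
    (hX : (comm E ^ k) X = 0) (hv : (E ^ l) v = 0) : (E ^ (k + l)) (X v) = 0 := by
  induction hn : k + l generalizing k l X v with
  | zero =>
    obtain rfl : k = 0 := by omega
    simp_all
  | succ p ih =>
    rcases k with _ | k
    · simp only [pow_zero, Module.End.one_apply] at hX
      simp [hX]
    rcases l with _ | l
    · simp only [pow_zero, Module.End.one_apply] at hv
      simp [hv]
    have e : E (X v) = comm E X v + X (E v) := by
      simp [comm_apply]
    rw [pow_succ, Module.End.mul_apply, e, map_add]
    rw [pow_succ, Module.End.mul_apply] at hX
    rw [ih (k := k) (l := l + 1) hX hv (by omega), zero_add]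
    rw [← Module.End.mul_apply, ← pow_succ] at hX
    rw [pow_succ, Module.End.mul_apply] at hv
    exact ih (k := k + 1) (l := l) hX hv (by omega)

/-- If `X` is ad-nilpotent for `E`, it maps the range of `E ^ (k + N)` to the range of `E ^ N`. -/
theorem exists_mul_pow_eq_of_comm {E : Module.End ℂ V} {k : ℕ} {X : Module.End ℂ V}
    (hX : (comm E ^ k) X = 0) (N : ℕ) : ∃ Y, X * E ^ (N + k) = E ^ N * Y := by
  induction k generalizing X N with
  | zero =>
    simp only [pow_zero, Module.End.one_apply] at hX
    exact ⟨0, by simp [hX]⟩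
  | succ k ih =>
    induction N with
    | zero => exact ⟨X * E ^ (k + 1), by simp⟩
    | succ N ihN =>
      obtain ⟨Y, hY⟩ := ihN
      obtain ⟨Y', hY'⟩ := ih (X := comm E X) (by rwa [pow_succ, Module.End.mul_apply] at hX) (N + 1)
      refine ⟨Y - Y', ?_⟩
      have e1 : X * E = E * X - comm E X := by rw [comm_apply]; abel
      rw [show N + 1 + (k + 1) = 1 + (N + (k + 1)) by ring, pow_add, pow_one, ← mul_assoc, e1,
        sub_mul, mul_assoc, hY, show N + (k + 1) = N + 1 + k by ring, hY', mul_sub, ← mul_assoc,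
        ← pow_succ']

theorem comm_pow_map {V' : Type*} [AddCommGroup V'] [Module ℂ V'] {e : Module.End ℂ V}
    {E : Module.End ℂ V'} {L : Module.End ℂ V →ₗ[ℂ] Module.End ℂ V'} {X : Submodule ℂ (Module.End ℂ V)}
    (hX : ∀ x ∈ X, comm e x ∈ X) (hL : ∀ x ∈ X, L (comm e x) = comm E (L x)) (k : ℕ) :
    ∀ x ∈ X, (comm E ^ k) (L x) = L ((comm e ^ k) x) := by
  induction k with
  | zero => intro x _; rfl
  | succ k ih =>
    intro x hx
    rw [pow_succ, pow_succ, Module.End.mul_apply, Module.End.mul_apply, ← hL x hx, ih _ (hX x hx)]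

end Operators

/-! ### Graded subspaces and ad-nilpotent elements on simple modules -/

namespace Superspace

variable {V : Type*} [AddCommGroup V] [Module ℂ V] (γ : Superspace V)

theorem mem_of_parity_eq {i : ZMod 2} {v : V} (h : γ.parity v = sgn i • v) : v ∈ γ.part i := by
  obtain ⟨y, hy, z, hz, rfl⟩ := γ.exists_add v
  rw [map_add, γ.parity_apply hy, γ.parity_apply hz, smul_add] at h
  rcases zmod2_cases i with rfl | rfl
  · have : (2 : ℂ) • z = 0 := by
      have := congrArg (fun w => y + z - w) h
      simp only [sgn_zero, sgn_one] at this
      rw [← sub_eq_zero] at this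
      rw [← this]; module
    have hz0 : z = 0 := by simpa using this
    rw [hz0, add_zero]; exact hy
  · have : (2 : ℂ) • y = 0 := by
      have := congrArg (fun w => y + z + w) h
      simp only [sgn_zero, sgn_one] at this
      rw [← sub_eq_zero] at this
      rw [← this]; module
    have hz0 : y = 0 := by simpa using this
    rw [hz0, zero_add]; exact hz

theorem exists_add_of_parity_mem {X : Submodule ℂ V} (hX : ∀ v ∈ X, γ.parity v ∈ X) {v : V}
    (hv : v ∈ X) : ∃ v₀ ∈ X ⊓ γ.part 0, ∃ v₁ ∈ X ⊓ γ.part 1, v₀ + v₁ = v := by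
  obtain ⟨y, hy, z, hz, rfl⟩ := γ.exists_add v
  have h := hX _ hv
  rw [map_add, γ.parity_apply hy, γ.parity_apply hz, sgn_zero, sgn_one] at h
  refine ⟨y, ⟨?_, hy⟩, z, ⟨?_, hz⟩, rfl⟩
  · have := X.smul_mem (2⁻¹ : ℂ) (add_mem hv h)
    have e : (2⁻¹ : ℂ) • (y + z + ((1 : ℂ) • y + (-1 : ℂ) • z)) = y := by module
    rwa [e] at this
  · have := X.smul_mem (2⁻¹ : ℂ) (sub_mem hv h)
    have e : (2⁻¹ : ℂ) • (y + z - ((1 : ℂ) • y + (-1 : ℂ) • z)) = z := by module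
    rwa [e] at this

end Superspace

namespace SuperModule

section General

variable {V : Type*} [AddCommGroup V] [Module ℂ V] {γ : Superspace V} {g k : LieSuper γ}
  {M : Type*} [AddCommGroup M] [Module ℂ M] (ρ : SuperModule g M)

/-- A linear extension of the action to all operators. -/
def op (j : ZMod 2) : Module.End ℂ V →ₗ[ℂ] Module.End ℂ M :=
  Classical.choose (ρ.act j).exists_extend

theorem op_eq {j : ZMod 2} {x : Module.End ℂ V} (hx : x ∈ g.part j) :
    ρ.op j x = ρ.act j ⟨x, hx⟩ :=
  LinearMap.congr_fun (Classical.choose_spec (ρ.act j).exists_extend) ⟨x, hx⟩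

theorem op_coe {j : ZMod 2} (x : g.part j) : ρ.op j x = ρ.act j x := ρ.op_eq x.2

theorem op_bracket {i j : ZMod 2} {x y : Module.End ℂ V} (hx : x ∈ g.part i) (hy : y ∈ g.part j) :
    ρ.op (i + j) (x * y - sgn (i * j) • (y * x)) =
      ρ.op i x * ρ.op j y - sgn (i * j) • (ρ.op j y * ρ.op i x) := by
  rw [ρ.op_eq hx, ρ.op_eq hy, ρ.op_eq (g.bracket_mem hx hy), ← ρ.act_bracket]
  rfl

theorem comm_mem_part {e x : Module.End ℂ V} {j : ZMod 2} (he : e ∈ g.part 0) (hx : x ∈ g.part j) :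
    comm e x ∈ g.part j := by
  have h := g.bracket_mem he hx
  rw [zero_add, zero_mul, sgn_zero, one_smul] at h
  exact h

theorem op_comm {e x : Module.End ℂ V} {j : ZMod 2} (he : e ∈ g.part 0) (hx : x ∈ g.part j) :
    ρ.op j (comm e x) = comm (ρ.op 0 e) (ρ.op j x) := by
  have h := ρ.op_bracket he hx
  rw [zero_add, zero_mul, sgn_zero, one_smul, one_smul] at h
  exact h

theorem comm_pow_op {e x : Module.End ℂ V} {j : ZMod 2} (he : e ∈ g.part 0) (hx : x ∈ g.part j)
    (k : ℕ) : (comm (ρ.op 0 e) ^ k) (ρ.op j x) = ρ.op j ((comm e ^ k) x) :=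
  comm_pow_map (X := g.part j) (fun _ hy => comm_mem_part he hy) (fun _ hy => ρ.op_comm he hy) k x hx

theorem parity_op {j : ZMod 2} {x : Module.End ℂ V} (hx : x ∈ g.part j) (v : M) :
    ρ.grading.parity (ρ.op j x v) = sgn j • ρ.op j x (ρ.grading.parity v) := by
  rw [ρ.op_eq hx]
  obtain ⟨y, hy, z, hz, rfl⟩ := ρ.grading.exists_add v
  rw [map_add, map_add, map_add, ρ.grading.parity_apply hy, ρ.grading.parity_apply hz,
    ρ.grading.parity_apply (ρ.act_mem ⟨x, hx⟩ hy), ρ.grading.parity_apply (ρ.act_mem ⟨x, hx⟩ hz),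
    map_add, map_smul, map_smul, sgn_add, sgn_add, smul_add, smul_smul, smul_smul]

theorem parity_op_zero {x : Module.End ℂ V} (hx : x ∈ g.part 0) (v : M) :
    ρ.grading.parity (ρ.op 0 x v) = ρ.op 0 x (ρ.grading.parity v) := by
  rw [ρ.parity_op hx, sgn_zero, one_smul]

theorem isSubmodule_of_parity_mem {X : Submodule ℂ M} (hX : ∀ v ∈ X, ρ.grading.parity v ∈ X)
    (hop : ∀ j, ∀ x ∈ g.part j, ∀ v ∈ X, ρ.op j x v ∈ X) : ρ.IsSubmodule X :=
  ⟨fun _ hv => ρ.grading.exists_add_of_parity_mem hX hv,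
    fun i x v hv => by rw [← op_coe]; exact hop i x x.2 v hv⟩

theorem IsSubmodule.parity_mem {ρ : SuperModule g M} {X : Submodule ℂ M} (hX : ρ.IsSubmodule X)
    {v : M} (hv : v ∈ X) : ρ.grading.parity v ∈ X := by
  obtain ⟨y, hy, z, hz, rfl⟩ := hX.1 v hv
  rw [map_add, ρ.grading.parity_apply hy.2, ρ.grading.parity_apply hz.2]
  exact add_mem (X.smul_mem _ hy.1) (X.smul_mem _ hz.1)

theorem IsSubmodule.op_mem {ρ : SuperModule g M} {X : Submodule ℂ M} (hX : ρ.IsSubmodule X)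
    {j : ZMod 2} {x : Module.End ℂ V} (hx : x ∈ g.part j) {v : M} (hv : v ∈ X) :
    ρ.op j x v ∈ X := by
  rw [ρ.op_eq hx]
  exact hX.2 j ⟨x, hx⟩ v hv

theorem comm_op_pow_eq_zero {e : Module.End ℂ V} (he : e ∈ g.part 0)
    (hnil : ∀ j, ∀ x ∈ g.part j, ∃ k, (comm e ^ k) x = 0) {j : ZMod 2} {x : Module.End ℂ V}
    (hx : x ∈ g.part j) : ∃ k, (comm (ρ.op 0 e) ^ k) (ρ.op j x) = 0 := by
  obtain ⟨k, hk⟩ := hnil j x hx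
  exact ⟨k, by rw [ρ.comm_pow_op he hx, hk, map_zero]⟩

/-- An ad-nilpotent even element acts on a simple module injectively or locally nilpotently. -/
theorem IsSimple.injective_or_nilpotent {ρ : SuperModule g M} (hs : ρ.IsSimple)
    {e : Module.End ℂ V} (he : e ∈ g.part 0)
    (hnil : ∀ j, ∀ x ∈ g.part j, ∃ k, (comm e ^ k) x = 0) :
    Function.Injective (ρ.op 0 e) ∨ ∀ v, ∃ k, ((ρ.op 0 e) ^ k) v = 0 := by
  set E := ρ.op 0 e with hE
  have hmono : ∀ {k l : ℕ} {v : M}, k ≤ l → (E ^ k) v = 0 → (E ^ l) v = 0 := by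
    intro k l v hkl h
    obtain ⟨r, rfl⟩ := Nat.exists_eq_add_of_le hkl
    rw [add_comm, pow_add, Module.End.mul_apply, h, map_zero]
  -- The generalised kernel of `E` is a graded submodule, because every element of `g` is
  -- ad-nilpotent for `E`.
  let X : Submodule ℂ M :=
    { carrier := {v | ∃ k, (E ^ k) v = 0}
      add_mem' := by
        rintro a b ⟨k, hk⟩ ⟨l, hl⟩
        exact ⟨k + l, by rw [map_add, hmono (Nat.le_add_right k l) hk,
          hmono (Nat.le_add_left l k) hl, add_zero]⟩
      zero_mem' := ⟨0, map_zero _⟩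
      smul_mem' := by
        rintro c a ⟨k, hk⟩
        exact ⟨k, by rw [map_smul, hk, smul_zero]⟩ }
  have hpar : ∀ (k : ℕ) (v : M), (E ^ k) (ρ.grading.parity v) = ρ.grading.parity ((E ^ k) v) := by
    intro k
    induction k with
    | zero => intro v; rfl
    | succ k ih =>
      intro v
      rw [pow_succ, Module.End.mul_apply, Module.End.mul_apply, hE, ← ρ.parity_op_zero he, ← hE, ih]
  have hX : ρ.IsSubmodule X := by
    refine ρ.isSubmodule_of_parity_mem ?_ ?_
    · rintro v ⟨k, hk⟩
      exact ⟨k, by rw [hpar, hk, map_zero]⟩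
    · rintro j x hx v ⟨l, hl⟩
      obtain ⟨k, hk⟩ := ρ.comm_op_pow_eq_zero he hnil hx
      exact ⟨k + l, pow_apply_eq_zero_of_comm hk hl⟩
  rcases hs.2 X hX with h | h
  · left
    rw [← LinearMap.ker_eq_bot, eq_bot_iff]
    intro v hv
    rw [← h]
    exact ⟨1, by rw [pow_one]; exact hv⟩
  · right
    intro v
    have : v ∈ X := h ▸ Submodule.mem_top
    exact this

/-- An ad-nilpotent even element which is not surjective on a simple module has no nonzero
infinitely divisible vectors. -/
theorem IsSimple.surjective_or_iInf_range {ρ : SuperModule g M} (hs : ρ.IsSimple)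
    {e : Module.End ℂ V} (he : e ∈ g.part 0)
    (hnil : ∀ j, ∀ x ∈ g.part j, ∃ k, (comm e ^ k) x = 0) :
    Function.Surjective (ρ.op 0 e) ∨ ∀ v, (∀ k, ∃ u, ((ρ.op 0 e) ^ k) u = v) → v = 0 := by
  set E := ρ.op 0 e with hE
  -- The vectors divisible by every power of `E` form a graded submodule, again by ad-nilpotency.
  let X : Submodule ℂ M := ⨅ k : ℕ, LinearMap.range (E ^ k)
  have hmem : ∀ {v}, v ∈ X ↔ ∀ k, ∃ u, (E ^ k) u = v := by
    intro v
    simp only [X, Submodule.mem_iInf, LinearMap.mem_range]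
  have hpar : ∀ (k : ℕ) (v : M), (E ^ k) (ρ.grading.parity v) = ρ.grading.parity ((E ^ k) v) := by
    intro k
    induction k with
    | zero => intro v; rfl
    | succ k ih =>
      intro v
      rw [pow_succ, Module.End.mul_apply, Module.End.mul_apply, hE, ← ρ.parity_op_zero he, ← hE, ih]
  have hX : ρ.IsSubmodule X := by
    refine ρ.isSubmodule_of_parity_mem ?_ ?_
    · intro v hv
      rw [hmem] at hv ⊢
      intro k
      obtain ⟨u, rfl⟩ := hv k
      exact ⟨_, hpar k u⟩
    · intro j x hx v hv
      obtain ⟨k, hk⟩ := ρ.comm_op_pow_eq_zero he hnil hx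
      rw [hmem] at hv ⊢
      intro N
      obtain ⟨u, rfl⟩ := hv (N + k)
      obtain ⟨Y, hY⟩ := exists_mul_pow_eq_of_comm hk N
      exact ⟨Y u, (LinearMap.congr_fun hY u).symm⟩
  rcases hs.2 X hX with h | h
  · right
    intro v hv
    have : v ∈ X := hmem.2 hv
    rw [h] at this
    exact (Submodule.mem_bot ℂ).1 this
  · left
    intro v
    have : v ∈ X := h ▸ Submodule.mem_top
    obtain ⟨u, hu⟩ := hmem.1 this 1
    exact ⟨u, by rwa [pow_one] at hu⟩

/-- The action of a sub-superalgebra on a graded subspace which is stable under it. -/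
def sub (hk : k.IsSub g) (X : Submodule ℂ M) (hX : ∀ v ∈ X, ρ.grading.parity v ∈ X)
    (hop : ∀ (j : ZMod 2) (x : k.part j), ∀ v ∈ X, ρ.act j (LieSuper.incl hk j x) v ∈ X) :
    SuperModule k X where
  grading :=
    { part := fun i => (ρ.grading.part i).comap X.subtype
      isCompl := by
        constructor
        · rw [Submodule.disjoint_def]
          intro v h0 h1
          exact Subtype.ext (Submodule.disjoint_def.1 ρ.grading.isCompl.disjoint _ h0 h1)
        · rw [codisjoint_iff, eq_top_iff]
          intro v _
          obtain ⟨y, hy, z, hz, hyz⟩ := ρ.grading.exists_add_of_parity_mem hX v.2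
          exact Submodule.mem_sup.2 ⟨⟨y, hy.1⟩, hy.2, ⟨z, hz.1⟩, hz.2, Subtype.ext hyz⟩ }
  act j :=
    { toFun := fun x => (ρ.act j (LieSuper.incl hk j x)).restrict (hop j x)
      map_add' := by intro x y; ext v; simp
      map_smul' := by intro c x; ext v; simp }
  act_mem x _ hv := ρ.act_mem (LieSuper.incl hk _ x) hv
  act_bracket x y := by
    ext v
    have := LinearMap.congr_fun (ρ.act_bracket (LieSuper.incl hk _ x) (LieSuper.incl hk _ y)) v
    exact this

end General

end SuperModule

/-! ### Weight spaces of modules over `W_{m,n}` -/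

namespace SuperModule

section WeightModules

variable {m n : ℕ} {M : Type*} [AddCommGroup M] [Module ℂ M] (ρ : SuperModule (W m n) M)

/-- The action of the Cartan subalgebra. -/
def cartan (i : Fin m) : Module.End ℂ M := ρ.op 0 (d m n i)

/-- The weight space `M_μ`. -/
def wt (μ : Wt m) : Submodule ℂ M := jointSpace ρ.cartan μ

theorem mem_wt {μ : Wt m} {v : M} : v ∈ ρ.wt μ ↔ ∀ i, ρ.cartan i v = μ i • v := mem_jointSpace

theorem weightSpace_eq_wt (μ : Wt m) : weightSpace (W_hasCartan m n) ρ μ = ρ.wt μ := by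
  ext v
  rw [mem_weightSpace, mem_wt]
  simp only [cartan, ρ.op_eq (d_mem m n _)]

theorem op_mem_wt {α μ : Wt m} {j : ZMod 2} {x : Module.End ℂ (A m n)}
    (hx : x ∈ rootSpace m n α j) {v : M} (hv : v ∈ ρ.wt μ) : ρ.op j x v ∈ ρ.wt (μ + α) := by
  rw [mem_wt] at *
  intro i
  have h := LinearMap.congr_fun (ρ.op_comm (d_mem m n i) hx.1) v
  rw [show comm (d m n i) x = α i • x from hx.2 i] at h
  simp only [map_smul, comm_apply, LinearMap.smul_apply, LinearMap.sub_apply,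
    Module.End.mul_apply] at h
  have h' : ρ.op j x (ρ.op 0 (d m n i) v) = μ i • ρ.op j x v := by
    rw [← map_smul, ← hv i]; rfl
  rw [h'] at h
  rw [Pi.add_apply, add_smul, h, cartan]
  abel

theorem op_pow_mem_wt {α μ : Wt m} {x : Module.End ℂ (A m n)} (hx : x ∈ rootSpace m n α 0)
    {v : M} (hv : v ∈ ρ.wt μ) (k : ℕ) : (ρ.op 0 x ^ k) v ∈ ρ.wt (μ + k • α) := by
  induction k with
  | zero => simpa using hv
  | succ k ih =>
    rw [pow_succ', Module.End.mul_apply, succ_nsmul, ← add_assoc]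
    exact ρ.op_mem_wt hx ih

theorem parity_mem_wt {μ : Wt m} {v : M} (hv : v ∈ ρ.wt μ) : ρ.grading.parity v ∈ ρ.wt μ := by
  rw [mem_wt] at *
  intro i
  rw [cartan, ← ρ.parity_op_zero (d_mem m n i), ← cartan, hv, map_smul]

theorem op_mem_of_rootSpace {X Y : Submodule ℂ M}
    (h : ∀ j α, ∀ x ∈ rootSpace m n α j, ∀ v ∈ X, ρ.op j x v ∈ Y) {j : ZMod 2}
    {x : Module.End ℂ (A m n)} (hx : x ∈ (W m n).part j) {v : M} (hv : v ∈ X) : ρ.op j x v ∈ Y := by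
  have hle : (⨆ α, rootSpace m n α j) ≤ Y.comap ((LinearMap.applyₗ v) ∘ₗ ρ.op j) :=
    iSup_le fun α x hx => h j α x hx v hv
  exact hle (Wpart_le_iSup_rootSpace j hx)

theorem isSubmodule_of_rootSpace {X : Submodule ℂ M} (hX : ∀ v ∈ X, ρ.grading.parity v ∈ X)
    (h : ∀ j α, ∀ x ∈ rootSpace m n α j, ∀ v ∈ X, ρ.op j x v ∈ X) : ρ.IsSubmodule X :=
  ρ.isSubmodule_of_parity_mem hX fun _ _ hx _ hv => ρ.op_mem_of_rootSpace h hx hv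

theorem parity_mem_weightSum (T : Set (Wt m)) {v : M} (hv : v ∈ weightSum ρ.cartan T) :
    ρ.grading.parity v ∈ weightSum ρ.cartan T := by
  have hle : weightSum ρ.cartan T ≤ (weightSum ρ.cartan T).comap ρ.grading.parity :=
    iSup₂_le fun μ hμ v hv => jointSpace_le_weightSum hμ (ρ.parity_mem_wt hv)
  exact hle hv

theorem op_mem_weightSum {T T' : Set (Wt m)} {α : Wt m} {j : ZMod 2} {x : Module.End ℂ (A m n)}
    (hx : x ∈ rootSpace m n α j) (hT : ∀ μ ∈ T, μ + α ∈ T' ∨ ρ.wt (μ + α) = ⊥) {v : M}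
    (hv : v ∈ weightSum ρ.cartan T) : ρ.op j x v ∈ weightSum ρ.cartan T' := by
  have hle : weightSum ρ.cartan T ≤ (weightSum ρ.cartan T').comap (ρ.op j x) := by
    refine iSup₂_le fun μ hμ v hv => ?_
    have hv' := ρ.op_mem_wt hx hv
    rcases hT μ hμ with h | h
    · exact jointSpace_le_weightSum h hv'
    · rw [h, Submodule.mem_bot] at hv'
      rw [Submodule.mem_comap, hv']
      exact zero_mem _
  exact hle hv

theorem root_eq_intWt {α : Wt m} {j : ZMod 2} {x : Module.End ℂ (A m n)}
    (hx : x ∈ rootSpace m n α j) (h0 : x ≠ 0) : ∃ z : Fin m → ℤ, α = intWt z := by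
  obtain ⟨a, i, rfl⟩ := exists_of_rootSpace_ne_bot ((Submodule.ne_bot_iff _).2 ⟨x, hx, h0⟩)
  rcases i with _ | i
  · exact ⟨_, by rw [nodeWt, sub_zero]⟩
  · refine ⟨(fun k => (a k : ℤ)) - Pi.single i 1, ?_⟩
    rw [map_sub]
    congr 1
    ext k
    simp [nodeWt, ε, intWt_apply, Pi.single_apply, apply_ite]

/-- The support of a simple weight module is contained in a coset of the root lattice. -/
theorem IsSimple.exists_intWt {ρ : SuperModule (W m n) M} (hs : ρ.IsSimple) {μ ν : Wt m}
    (hμ : ρ.wt μ ≠ ⊥) (hν : ρ.wt ν ≠ ⊥) : ∃ z : Fin m → ℤ, ν = μ + intWt z := by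
  by_contra hn
  have hX : ρ.IsSubmodule (weightSum ρ.cartan {ν | ∃ z : Fin m → ℤ, ν = μ + intWt z}) := by
    refine ρ.isSubmodule_of_rootSpace (fun v => ρ.parity_mem_weightSum _) ?_
    intro j α x hx v hv
    by_cases h0 : x = 0
    · rw [h0, map_zero]; exact zero_mem _
    obtain ⟨z, rfl⟩ := root_eq_intWt hx h0
    refine ρ.op_mem_weightSum hx ?_ hv
    rintro _ ⟨z', rfl⟩
    exact Or.inl ⟨z' + z, by rw [map_add, add_assoc]⟩
  have hle : ρ.wt μ ≤ weightSum ρ.cartan {ν | ∃ z : Fin m → ℤ, ν = μ + intWt z} :=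
    jointSpace_le_weightSum ⟨0, by rw [map_zero, add_zero]⟩
  rcases hs.2 _ hX with h | h
  · rw [h, le_bot_iff] at hle
    exact hμ hle
  · have hd : Disjoint ({ν} : Set (Wt m)) {ν | ∃ z : Fin m → ℤ, ν = μ + intWt z} :=
      Set.disjoint_singleton_left.2 hn
    have h1 := weightSum_disjoint (h := ρ.cartan) hd
    rw [h, disjoint_top] at h1
    have h2 : ρ.wt ν ≤ weightSum ρ.cartan {ν} := jointSpace_le_weightSum (Set.mem_singleton ν)
    rw [h1, le_bot_iff] at h2
    exact hν h2

end WeightModules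

/-! ### 𝔰𝔩₂-triples and bounds on the support -/

section Strings

variable {m n : ℕ} {M : Type*} [AddCommGroup M] [Module ℂ M] {ρ : SuperModule (W m n) M}

/-- If `e` is injective on a simple Harish-Chandra module, then it is surjective, or the support is
bounded in the direction opposite to the weight of `e`. -/
theorem IsSimple.surjective_or_bounded (hs : ρ.IsSimple)
    (hfin : ∀ μ, FiniteDimensional ℂ (ρ.wt μ)) {e : Module.End ℂ (A m n)} {α : Wt m}
    (he : e ∈ rootSpace m n α 0) (hnil : ∀ j, ∀ x ∈ (W m n).part j, ∃ k, (comm e ^ k) x = 0)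
    (hinj : Function.Injective (ρ.op 0 e)) :
    Function.Surjective (ρ.op 0 e) ∨ ∀ μ, ∃ B : ℕ, ∀ k : ℕ, B ≤ k → ρ.wt (μ - k • α) = ⊥ := by
  refine (hs.surjective_or_iInf_range he.1 hnil).imp_right fun h μ => ?_
  set E := ρ.op 0 e with hE
  have hinjk : ∀ k : ℕ, Function.Injective (E ^ k) := by
    intro k
    rw [Module.End.coe_pow]
    exact hinj.iterate k
  -- A decreasing chain inside the finite-dimensional space `M_μ`; it becomes constant from some `B`
  -- on.
  let R : ℕ → Submodule ℂ M := fun k => (ρ.wt (μ - k • α)).map (E ^ k)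
  have hRle : ∀ k, R k ≤ ρ.wt μ := by
    rintro k _ ⟨u, hu, rfl⟩
    have := ρ.op_pow_mem_wt he hu k
    rwa [sub_add_cancel] at this
  have hanti : ∀ k l, k ≤ l → R l ≤ R k := by
    rintro k l hkl _ ⟨u, hu, rfl⟩
    obtain ⟨r, rfl⟩ := Nat.exists_eq_add_of_le hkl
    refine ⟨(E ^ r) u, ?_, ?_⟩
    · have := ρ.op_pow_mem_wt he hu r
      rwa [add_smul, ← sub_sub, sub_add_cancel] at this
    · rw [pow_add, Module.End.mul_apply]
  have hfinR : ∀ k, FiniteDimensional ℂ (R k) := fun k =>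
    Submodule.finiteDimensional_of_le (hRle k)
  obtain ⟨B, hB⟩ : ∃ B, ∀ k, Module.finrank ℂ (R B) ≤ Module.finrank ℂ (R k) :=
    ⟨Function.argmin fun k => Module.finrank ℂ (R k), fun k =>
      Function.argmin_le (fun k => Module.finrank ℂ (R k)) k⟩
  refine ⟨B, fun k hk => ?_⟩
  have heq : ∀ l, B ≤ l → R l = R B := fun l hl =>
    Submodule.eq_of_le_of_finrank_le (hanti _ _ hl) (hB l)
  rw [eq_bot_iff]
  intro u hu
  -- The stable term consists of vectors divisible by all powers of `E`, hence is zero.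
  have hz : (E ^ k) u = 0 := by
    refine h _ fun N => ?_
    have h1 : (E ^ k) u ∈ R k := ⟨u, hu, rfl⟩
    have h2 : (E ^ k) u ∈ R N := by
      rcases le_total B N with hN | hN
      · rw [heq N hN, ← heq k hk]; exact h1
      · exact hanti N k (hN.trans hk) h1
    obtain ⟨u', -, hu'⟩ := h2
    exact ⟨u', hu'⟩
  exact (Submodule.mem_bot ℂ).2 (hinjk k (by rw [hz, map_zero]))

theorem exists_pow_apply_ne_zero {E : Module.End ℂ M} (hE : ∀ v, ∃ k, (E ^ k) v = 0) {v : M}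
    (h0 : v ≠ 0) : ∃ r, (E ^ r) v ≠ 0 ∧ (E ^ (r + 1)) v = 0 := by
  classical
  obtain ⟨k, hk⟩ : ∃ k, Nat.find (hE v) = k + 1 := by
    refine Nat.exists_eq_succ_of_ne_zero fun h' => h0 ?_
    have := Nat.find_spec (hE v)
    rwa [h'] at this
  exact ⟨k, Nat.find_min (hE v) (by omega), hk ▸ Nat.find_spec (hE v)⟩

/-- An `𝔰𝔩₂`-triple of root vectors: `e` of weight `α`, `f` of weight `-α`, such that `[e, f]` acts
on `M_μ` by the scalar `c μ`. -/
structure Triple (ρ : SuperModule (W m n) M) (α : Wt m) (e f : Module.End ℂ (A m n))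
    (c : Wt m → ℂ) : Prop where
  e_mem : e ∈ rootSpace m n α 0
  f_mem : f ∈ rootSpace m n (-α) 0
  apply_add : ∀ μ, c (μ + α) = c μ + 2
  comm_eq : ∀ μ, ∀ v ∈ ρ.wt μ, comm (ρ.op 0 e) (ρ.op 0 f) v = c μ • v

variable {α : Wt m} {e f : Module.End ℂ (A m n)} {c : Wt m → ℂ}

theorem Triple.apply_sub (h : Triple ρ α e f c) (μ : Wt m) (r : ℕ) :
    c (μ - r • α) = c μ - 2 * r := by
  induction r with
  | zero => simp
  | succ r ih =>
    have := h.apply_add (μ - (r + 1) • α)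
    rw [show μ - (r + 1) • α + α = μ - r • α by rw [add_smul, one_smul]; abel, ih] at this
    push_cast
    linear_combination -this

theorem Triple.apply_add_nsmul (h : Triple ρ α e f c) (μ : Wt m) (r : ℕ) :
    c (μ + r • α) = c μ + 2 * r := by
  have := h.apply_sub (μ + r • α) r
  rw [add_sub_cancel_right] at this
  linear_combination -this

theorem Triple.f_pow_mem (h : Triple ρ α e f c) {μ : Wt m} {v : M} (hv : v ∈ ρ.wt μ) (r : ℕ) :
    (ρ.op 0 f ^ r) v ∈ ρ.wt (μ - r • α) := by
  have := ρ.op_pow_mem_wt h.f_mem hv r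
  rwa [smul_neg, ← sub_eq_add_neg] at this

theorem Triple.e_f_pow (h : Triple ρ α e f c) {μ : Wt m} {v : M} (hv : v ∈ ρ.wt μ)
    (hev : ρ.op 0 e v = 0) (r : ℕ) :
    ρ.op 0 e ((ρ.op 0 f ^ (r + 1)) v) = ((r + 1) * (c μ - r)) • (ρ.op 0 f ^ r) v := by
  have step : ∀ w, ρ.op 0 e (ρ.op 0 f w) = comm (ρ.op 0 e) (ρ.op 0 f) w +
      ρ.op 0 f (ρ.op 0 e w) := by
    intro w
    simp [comm_apply]
  induction r with
  | zero => simp [step, hev, h.comm_eq μ v hv]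
  | succ r ih =>
    rw [pow_succ', Module.End.mul_apply, step, ih, h.comm_eq _ _ (h.f_pow_mem hv (r + 1)),
      h.apply_sub, map_smul, ← Module.End.mul_apply, ← pow_succ', ← add_smul]
    congr 1
    push_cast
    ring

theorem Triple.e_pow_f_pow_ne_zero (h : Triple ρ α e f c) {μ : Wt m} {v : M} (hv : v ∈ ρ.wt μ)
    (hev : ρ.op 0 e v = 0) (h0 : v ≠ 0) (r : ℕ) (hr : ∀ s : ℕ, s < r → c μ ≠ s) :
    (ρ.op 0 e ^ r) ((ρ.op 0 f ^ r) v) ≠ 0 := by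
  induction r with
  | zero => exact h0
  | succ r ih =>
    rw [pow_succ, Module.End.mul_apply, h.e_f_pow hv hev, map_smul]
    refine smul_ne_zero (mul_ne_zero (by exact_mod_cast Nat.succ_ne_zero r) ?_)
      (ih fun s hs => hr s (hs.trans (Nat.lt_succ_self r)))
    exact sub_ne_zero.2 (hr r (Nat.lt_succ_self r))

theorem Triple.exists_highest (h : Triple ρ α e f c) (he : ∀ v, ∃ k, (ρ.op 0 e ^ k) v = 0)
    {μ : Wt m} (hμ : ρ.wt μ ≠ ⊥) : ∃ k : ℕ, ∃ v ∈ ρ.wt (μ + k • α), v ≠ 0 ∧ ρ.op 0 e v = 0 := by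
  obtain ⟨v, hv, hv0⟩ := (Submodule.ne_bot_iff _).1 hμ
  obtain ⟨k, hk, hk'⟩ := exists_pow_apply_ne_zero he hv0
  exact ⟨k, _, ρ.op_pow_mem_wt h.e_mem hv k, hk, by
    rwa [← Module.End.mul_apply, ← pow_succ']⟩

/-- If `e` is locally nilpotent, the support is bounded in the direction of the weight of `e`. -/
theorem Triple.bounded (h : Triple ρ α e f c) (hfin : ∀ μ, FiniteDimensional ℂ (ρ.wt μ))
    (he : ∀ v, ∃ k, (ρ.op 0 e ^ k) v = 0) (μ : Wt m) :
    ∃ B : ℕ, ∀ k : ℕ, B ≤ k → ρ.wt (μ + k • α) = ⊥ := by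
  set E := ρ.op 0 e with hE
  -- An increasing chain inside the finite-dimensional space `M_μ`. A highest weight vector far
  -- above `μ` would produce a vector of `M_μ` on which `e` has a large exact nilpotency order.
  let R : ℕ → Submodule ℂ M := fun k => ρ.wt μ ⊓ LinearMap.ker (E ^ k)
  have hmono : ∀ k l, k ≤ l → R k ≤ R l := by
    rintro k l hkl v ⟨hv, hv'⟩
    refine ⟨hv, ?_⟩
    obtain ⟨r, rfl⟩ := Nat.exists_eq_add_of_le hkl
    change (E ^ (k + r)) v = 0
    rw [add_comm, pow_add, Module.End.mul_apply, show (E ^ k) v = 0 from hv', map_zero]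
  have hfinR : ∀ k, FiniteDimensional ℂ (R k) := fun k =>
    Submodule.finiteDimensional_of_le inf_le_left
  obtain ⟨B, hB⟩ : ∃ B, ∀ k, Module.finrank ℂ (R k) ≤ Module.finrank ℂ (R B) := by
    have hb : ∀ k, Module.finrank ℂ (R k) ≤ Module.finrank ℂ (ρ.wt μ) := fun k =>
      Submodule.finrank_mono inf_le_left
    let F : ℕ → ℕ := fun k => Module.finrank ℂ (ρ.wt μ) - Module.finrank ℂ (R k)
    refine ⟨Function.argmin F, fun k => ?_⟩
    have h1 : F (Function.argmin F) ≤ F k := Function.argmin_le F k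
    have h2 := hb k
    have h3 := hb (Function.argmin F)
    simp only [F] at h1 h2 h3 ⊢
    omega
  have heq : ∀ l, B ≤ l → R B = R l := fun l hl =>
    Submodule.eq_of_le_of_finrank_le (hmono _ _ hl) (hB l)
  obtain ⟨b, hb⟩ := exists_nat_gt ‖c μ‖
  refine ⟨B + b, fun k hk => ?_⟩
  by_contra hne
  obtain ⟨l, v, hv, h0, hev⟩ := h.exists_highest he hne
  rw [add_assoc, ← add_smul] at hv
  have hw := h.f_pow_mem hv (k + l)
  rw [add_sub_cancel_right] at hw
  -- The highest weight is `c μ + 2 (k + l)`. Were it equal to some `s < k + l`, then `c μ` would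
  -- have absolute value above `k + l ≥ b`.
  have h1 : (E ^ (k + l)) ((ρ.op 0 f ^ (k + l)) v) ≠ 0 := by
    refine h.e_pow_f_pow_ne_zero hv hev h0 _ fun s hs hc => ?_
    rw [h.apply_add_nsmul] at hc
    have e1 : c μ = ((s : ℤ) - 2 * (k + l : ℕ) : ℤ) := by
      push_cast at hc ⊢
      linear_combination hc
    rw [e1, Complex.norm_intCast] at hb
    have h2 : |(s : ℤ) - 2 * (k + l : ℕ)| < b := by exact_mod_cast hb
    rw [abs_lt] at h2
    omega
  refine h1 ?_
  have h2 : (E ^ (k + l + 1)) ((ρ.op 0 f ^ (k + l)) v) = 0 := by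
    have h3 : ∀ r, (E ^ (r + 1)) ((ρ.op 0 f ^ r) v) = 0 := by
      intro r
      induction r with
      | zero => simpa using hev
      | succ r ih =>
        rw [pow_succ, Module.End.mul_apply, h.e_f_pow hv hev, map_smul, ih, smul_zero]
    exact h3 _
  have h3 : (ρ.op 0 f ^ (k + l)) v ∈ R (k + l + 1) := ⟨hw, h2⟩
  rw [← heq _ (by omega), heq (k + l) (by omega)] at h3
  exact h3.2

/-- If `e` and `f` are locally nilpotent, the weights along `α` form `𝔰𝔩₂`-strings. -/
theorem Triple.string (h : Triple ρ α e f c) (he : ∀ v, ∃ k, (ρ.op 0 e ^ k) v = 0)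
    (hf : ∀ v, ∃ k, (ρ.op 0 f ^ k) v = 0) {μ : Wt m} (hμ : ρ.wt μ ≠ ⊥) :
    ∃ κ : ℤ, c μ = κ ∧ ∀ t : ℕ, (t : ℤ) ≤ κ → ρ.wt (μ - t • α) ≠ ⊥ := by
  obtain ⟨k, v, hv, h0, hev⟩ := h.exists_highest he hμ
  -- The string under the highest weight vector ends after `r` steps. Applying `e` to `f^{r+1} v =
  -- 0` forces `c (μ + k α) = r`, whence `κ = r - 2k`.
  obtain ⟨r, hr, hr'⟩ := exists_pow_apply_ne_zero hf h0
  have h1 := h.e_f_pow hv hev r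
  rw [hr', map_zero, eq_comm, smul_eq_zero, or_iff_left hr, mul_eq_zero,
    or_iff_right (by exact_mod_cast Nat.succ_ne_zero r), h.apply_add_nsmul] at h1
  refine ⟨(r : ℤ) - 2 * k, by push_cast; linear_combination h1, fun t ht => ?_⟩
  have h2 := h.f_pow_mem hv (k + t)
  rw [add_smul, ← sub_sub, add_sub_cancel_right] at h2
  refine (Submodule.ne_bot_iff _).2 ⟨_, h2, fun h3 => hr ?_⟩
  obtain ⟨s, rfl⟩ := Nat.exists_eq_add_of_le (show k + t ≤ r by omega)
  rw [add_comm, pow_add, Module.End.mul_apply, h3, map_zero]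

end Strings

end SuperModule

/-! ### A locally nilpotent `∂_i` forces stability under `ε_i` -/

namespace SuperModule

section Trivial

variable {m n : ℕ} {M : Type*} [AddCommGroup M] [Module ℂ M] {ρ : SuperModule (W m n) M}

/-- A simple module with a nonzero vector killed by all root vectors is trivial. -/
theorem IsSimple.isTrivial_of_invariant (hs : ρ.IsSimple) {v : M} (h0 : v ≠ 0)
    (hv : ∀ j α, ∀ x ∈ rootSpace m n α j, ρ.op j x v = 0) : ρ.IsTrivial := by
  let X : Submodule ℂ M :=
    { carrier := {w | ∀ j, ∀ x ∈ (W m n).part j, ρ.op j x w = 0}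
      add_mem' := fun {a b} ha hb j x hx => by rw [map_add, ha j x hx, hb j x hx, add_zero]
      zero_mem' := fun j x _ => map_zero _
      smul_mem' := fun c a ha j x hx => by rw [map_smul, ha j x hx, smul_zero] }
  have hX : ρ.IsSubmodule X := by
    refine ρ.isSubmodule_of_parity_mem (fun w hw j x hx => ?_) fun j x hx w hw => ?_
    · have h := ρ.parity_op hx w
      rw [hw j x hx, map_zero, eq_comm, smul_eq_zero, or_iff_right] at h
      · exact h
      · intro h1
        have := sgn_mul_self j
        rw [h1] at this
        simp at this
    · rw [hw j x hx]
      exact X.zero_mem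
  have hvX : v ∈ X := by
    intro j x hx
    have := ρ.op_mem_of_rootSpace (X := ℂ ∙ v) (Y := ⊥) (fun j α x hx w hw => ?_) hx
      (Submodule.mem_span_singleton_self v)
    · exact (Submodule.mem_bot ℂ).1 this
    · obtain ⟨c, rfl⟩ := Submodule.mem_span_singleton.1 hw
      rw [map_smul, hv j α x hx, smul_zero]
      exact zero_mem _
  rcases hs.2 X hX with h | h
  · rw [h] at hvX
    exact absurd ((Submodule.mem_bot ℂ).1 hvX) h0
  · intro i x
    ext w
    have hw : w ∈ X := h ▸ Submodule.mem_top
    rw [← op_coe]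
    exact hw i x x.2

/-- The operators of weight `γ` on which the commutator with `∂/∂t_i` is nilpotent. -/
def nilOps (ρ : SuperModule (W m n) M) (i : Fin m) (γ : Wt m) : Set (Module.End ℂ M) :=
  {u | (∀ μ, ∀ v ∈ ρ.wt μ, u v ∈ ρ.wt (μ + γ)) ∧
    ∃ k, (comm (ρ.op 0 (rootVec m n none i)) ^ k) u = 0}

theorem partial_apply_wt (i : Fin m) {μ : Wt m} {v : M} (hv : v ∈ ρ.wt μ) :
    ρ.op 0 (rootVec m n none i) v ∈ ρ.wt (μ - ε i) := by
  have := ρ.op_mem_wt (rootVec_mem none i) hv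
  rwa [show nodeRoot none (some i) = -ε i by simp [nodeRoot, nodeWt], ← sub_eq_add_neg] at this

/-- With `x = [∂_i, y]` one has `u x v = u ∂_i y v = ∂_i u y v - [∂_i, u] y v`. The first term
vanishes since `u y v` has the missing weight `μ + ε_i`. The second vanishes by induction, `[∂_i,
u]` having smaller nilpotency order and the weight opposite to that of `y`. -/
theorem apply_apply_eq_zero {i : Fin m} {μ : Wt m} (hμ : ρ.wt (μ + ε i) = ⊥) {v : M}
    (hv : v ∈ ρ.wt μ) (hdv : ρ.op 0 (rootVec m n none i) v = 0) {β : Wt m} {j : ZMod 2}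
    {u : Module.End ℂ M} (hu : u ∈ nilOps ρ i (-β)) {x : Module.End ℂ (A m n)}
    (hx : x ∈ rootSpace m n β j) : u (ρ.op j x v) = 0 := by
  obtain ⟨hu, k, hk⟩ := hu
  induction k generalizing u β x with
  | zero =>
    simp only [pow_zero, Module.End.one_apply] at hk
    rw [hk, LinearMap.zero_apply]
  | succ k ih =>
    set E := ρ.op 0 (rootVec m n none i) with hE
    obtain ⟨y, hy, hyx⟩ := exists_comm_partial_eq i hx
    have h1 : ρ.op j x = comm E (ρ.op j y) := by
      rw [← hyx, ρ.op_comm (rootVec_mem none i).1 hy.1]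
    have h2 : ρ.op j x v = E (ρ.op j y v) := by
      rw [h1, comm_apply, LinearMap.sub_apply, Module.End.mul_apply, Module.End.mul_apply, hdv,
        map_zero, sub_zero]
    have h3 : u (ρ.op j y v) = 0 := by
      have := hu _ _ (ρ.op_mem_wt hy hv)
      rwa [show μ + (β + ε i) + -β = μ + ε i by abel, hμ, Submodule.mem_bot] at this
    have h4 : comm E u (ρ.op j y v) = 0 := by
      refine ih (u := comm E u) hy (fun ν w hw => ?_) (by rwa [pow_succ, Module.End.mul_apply] at hk)
      have e1 : E (u w) ∈ ρ.wt (ν + -(β + ε i)) := by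
        have := partial_apply_wt i (hu _ _ hw)
        rwa [show ν + -β - ε i = ν + -(β + ε i) by abel] at this
      have e2 : u (E w) ∈ ρ.wt (ν + -(β + ε i)) := by
        have := hu _ _ (partial_apply_wt i hw)
        rwa [show ν - ε i + -β = ν + -(β + ε i) by abel] at this
      exact sub_mem e1 e2
    rw [comm_apply, LinearMap.sub_apply, Module.End.mul_apply, Module.End.mul_apply, h3, map_zero,
      zero_sub, neg_eq_zero] at h4
    rw [h2, h4]

/-- The vectors `x v`, for root vectors `x` and `v` of weight `μ` killed by `∂_i`, lie in a
submodule without weight `μ`. By simplicity it is zero, so all of W kills `v` and M is trivial. The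
operators in `nilOps` play the role of weight vectors of the enveloping algebra. -/
theorem IsSimple.isTrivial_of_partial_eq_zero (hs : ρ.IsSimple) {i : Fin m} {μ : Wt m}
    (hμ : ρ.wt (μ + ε i) = ⊥) {v : M} (hv : v ∈ ρ.wt μ) (h0 : v ≠ 0)
    (hdv : ρ.op 0 (rootVec m n none i) v = 0) : ρ.IsTrivial := by
  set E := ρ.op 0 (rootVec m n none i) with hE
  let G : Set M := {w | ∃ γ, ∃ u ∈ nilOps ρ i γ, ∃ j β, ∃ x ∈ rootSpace m n β j,
    ∃ v ∈ ρ.wt μ, E v = 0 ∧ w = u (ρ.op j x v)}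
  have hX : ρ.IsSubmodule (Submodule.span ℂ G) := by
    refine ρ.isSubmodule_of_rootSpace (fun w hw => ?_) fun j α y hy w hw => ?_
    · have hle : Submodule.span ℂ G ≤ (Submodule.span ℂ G).comap ρ.grading.parity := by
        rw [Submodule.span_le]
        rintro _ ⟨γ, u, ⟨hu, k, hk⟩, j, β, x, hx, v, hv, hdv, rfl⟩
        -- No parity is imposed on `u`; its conjugate by the parity involution has the same weight
        -- and the same nilpotency, since `∂_i` is even.
        have e : ρ.grading.parity (u (ρ.op j x v)) =
            sgn j • (ρ.grading.parity * u * ρ.grading.parity) (ρ.op j x (ρ.grading.parity v)) := by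
          rw [Module.End.mul_apply, Module.End.mul_apply, ρ.parity_op hx.1,
            ρ.grading.parity_parity, map_smul, map_smul, smul_smul, sgn_mul_self, one_smul]
        rw [SetLike.mem_coe, Submodule.mem_comap, e]
        refine Submodule.smul_mem _ _ (Submodule.subset_span ⟨γ, _, ⟨fun ν w hw => ?_, k, ?_⟩, j, β,
          x, hx, _, ρ.parity_mem_wt hv, ?_, rfl⟩)
        · exact ρ.parity_mem_wt (hu _ _ (ρ.parity_mem_wt hw))
        · have hc : E * ρ.grading.parity = ρ.grading.parity * E :=
            LinearMap.ext fun w => (ρ.parity_op_zero (rootVec_mem none i).1 w).symm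
          have : ∀ (k : ℕ) (u : Module.End ℂ M),
              (comm E ^ k) (ρ.grading.parity * u * ρ.grading.parity) =
                ρ.grading.parity * (comm E ^ k) u * ρ.grading.parity := by
            intro k
            induction k with
            | zero => intro u; rfl
            | succ k ih =>
              intro u
              rw [pow_succ, Module.End.mul_apply, Module.End.mul_apply, ← ih]
              congr 1
              rw [comm_mul, comm_mul, comm_apply E ρ.grading.parity, hc, sub_self, zero_mul,
                zero_add, mul_zero, add_zero]
          rw [this, hk, mul_zero, zero_mul]
        · rw [hE, ← ρ.parity_op_zero (rootVec_mem none i).1, ← hE, hdv, map_zero]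
      exact hle hw
    · have hle : Submodule.span ℂ G ≤ (Submodule.span ℂ G).comap (ρ.op j y) := by
        rw [Submodule.span_le]
        rintro _ ⟨γ, u, ⟨hu, k, hk⟩, j', β, x, hx, v, hv, hdv, rfl⟩
        obtain ⟨l, hl⟩ := ρ.comm_op_pow_eq_zero (rootVec_mem none i).1
          (fun p z hz => rootVec_nilpotent (by simp) hz) hy.1
        refine Submodule.subset_span ⟨γ + α, ρ.op j y * u, ⟨fun ν w hw => ?_, l + k, ?_⟩, j', β, x,
          hx, v, hv, hdv, rfl⟩
        · rw [← add_assoc]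
          exact ρ.op_mem_wt hy (hu _ _ hw)
        · exact pow_mul_eq_zero (comm_mul E) hl hk
      exact hle hw
  -- A generator has weight `μ + β + γ`, equal to `μ` only if `γ = -β`, and then it is zero by
  -- `apply_apply_eq_zero`.
  have hle : Submodule.span ℂ G ≤ weightSum ρ.cartan {μ}ᶜ := by
    rw [Submodule.span_le]
    rintro _ ⟨γ, u, hu, j, β, x, hx, v, hv, hdv, rfl⟩
    by_cases hγ : γ = -β
    · subst hγ
      rw [apply_apply_eq_zero hμ hv hdv hu hx]
      exact zero_mem _
    · refine jointSpace_le_weightSum ?_ (hu.1 _ _ (ρ.op_mem_wt hx hv))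
      intro h
      refine hγ (eq_neg_of_add_eq_zero_right ?_)
      have h' : μ + β + γ = μ := h
      rwa [add_assoc, add_eq_left] at h'
  rcases hs.2 _ hX with h | h
  · refine hs.isTrivial_of_invariant h0 fun j α x hx => ?_
    rw [← Submodule.mem_bot ℂ, ← h]
    exact Submodule.subset_span ⟨0, 1, ⟨fun ν w hw => by rwa [add_zero], 1, by
      rw [pow_one, comm_apply, mul_one, one_mul, sub_self]⟩, j, α, x, hx, v, hv, hdv, rfl⟩
  · have hd := weightSum_disjoint (h := ρ.cartan) (disjoint_compl_right (a := ({μ} : Set (Wt m))))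
    rw [h, top_le_iff] at hle
    rw [hle, disjoint_top] at hd
    have h1 : v ∈ weightSum ρ.cartan {μ} := jointSpace_le_weightSum (Set.mem_singleton μ) hv
    rw [hd] at h1
    exact absurd ((Submodule.mem_bot ℂ).1 h1) h0

/-- If `∂/∂t_i` is locally nilpotent on a nontrivial simple module, the support is stable under the
translation by `ε_i`. -/
theorem IsSimple.add_ε_of_nilpotent (hs : ρ.IsSimple) (hnt : ¬ρ.IsTrivial) {i : Fin m}
    (hnil : ∀ v, ∃ k, (ρ.op 0 (rootVec m n none i) ^ k) v = 0) {μ : Wt m} (hμ : ρ.wt μ ≠ ⊥) :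
    ρ.wt (μ + ε i) ≠ ⊥ := by
  intro hb
  -- The vector fields `t_i^r ∂_i` with `r ≤ k + 2` kill weight `μ - k ε_i`. For `r = k + 2` the
  -- image has the missing weight `μ + ε_i`. For smaller `r`, use `[∂_i, t_i^{r+1} ∂_i] = (r+1)
  -- t_i^r ∂_i`, descending on `s = k + 2 - r` and on the nilpotency order `l` of `v`. The case `k =
  -- r = 0` says that `∂_i` kills `M_μ`.
  have key : ∀ s l k : ℕ, ∀ v ∈ ρ.wt (μ - k • ε i), (ρ.op 0 (rootVec m n none i) ^ l) v = 0 →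
      ∀ r, r + s = k + 2 → ρ.op 0 (lineVec m n i r) v = 0 := by
    intro s
    induction s with
    | zero =>
      intro l k v hv _ r hr
      obtain rfl : r = k + 2 := hr
      have := ρ.op_mem_wt (lineVec_mem i (k + 2)) hv
      rwa [show μ - k • ε i + (((k + 2 : ℕ) : ℂ) • ε i - ε i) = μ + ε i by push_cast; module, hb,
        Submodule.mem_bot] at this
    | succ s ihs =>
      intro l
      induction l with
      | zero =>
        intro k v hv h0 r _
        simp only [pow_zero, Module.End.one_apply] at h0
        rw [h0, map_zero]
      | succ l ihl =>
        intro k v hv h0 r hr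
        have h1 := ihs (l + 1) k v hv h0 (r + 1) (by omega)
        have hdv : ρ.op 0 (rootVec m n none i) v ∈ ρ.wt (μ - (k + 1) • ε i) := by
          have := partial_apply_wt i hv
          rwa [show μ - k • ε i - ε i = μ - (k + 1) • ε i by module] at this
        have h2 := ihl (k + 1) _ hdv (by rwa [pow_succ, Module.End.mul_apply] at h0) (r + 1)
          (by omega)
        have h3 := ρ.op_comm (rootVec_mem none i).1 (lineVec_mem (n := n) i (r + 1)).1
        rw [← lineVec_zero, comm_lineVec, map_smul, lineVec_zero] at h3
        have h4 := LinearMap.congr_fun h3 v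
        rw [comm_apply, LinearMap.sub_apply, Module.End.mul_apply, Module.End.mul_apply, h1, h2,
          map_zero, sub_zero, LinearMap.smul_apply, smul_eq_zero] at h4
        exact h4.resolve_left (by exact_mod_cast Nat.succ_ne_zero r)
  obtain ⟨v, hv, h0⟩ := (Submodule.ne_bot_iff _).1 hμ
  refine hnt (hs.isTrivial_of_partial_eq_zero hb hv h0 ?_)
  obtain ⟨l, hl⟩ := hnil v
  rw [← lineVec_zero]
  exact key 2 l 0 v (by simpa using hv) hl 0 rfl

end Trivial

end SuperModule

/-! ### The shape of the support and constancy of dimensions -/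

namespace SuperModule

section Support

variable {m n : ℕ} {M : Type*} [AddCommGroup M] [Module ℂ M] {ρ : SuperModule (W m n) M}

theorem triple_some {a b : Fin m} (hab : a ≠ b) :
    Triple ρ (nodeRoot (some a) (some b)) (rootVec m n (some a) b) (rootVec m n (some b) a)
      fun μ => μ a - μ b where
  e_mem := rootVec_mem _ _
  f_mem := by rw [neg_nodeRoot]; exact rootVec_mem _ _
  apply_add μ := by
    simp [nodeRoot, nodeWt_apply, hab, hab.symm]
    ring
  comm_eq μ v hv := by
    rw [← ρ.op_comm (rootVec_mem _ _).1 (rootVec_mem _ _).1, comm_rootVec, map_sub, sub_smul,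
      ← ρ.mem_wt.1 hv a, ← ρ.mem_wt.1 hv b]
    rfl

/-- The projective 𝔰𝔩₂ on the line: `∂`, `-t² ∂` and `[∂, -t² ∂] = -2 t ∂`. -/
theorem triple_none (i : Fin m) :
    Triple ρ (nodeRoot none (some i)) (rootVec m n none i) (-lineVec m n i 2)
      fun μ => -2 * μ i where
  e_mem := rootVec_mem _ _
  f_mem := by
    have h := lineVec_mem (n := n) i 2
    have e : -nodeRoot none (some i) = ((2 : ℕ) : ℂ) • ε i - ε i := by
      rw [nodeRoot, nodeWt, nodeWt]
      push_cast
      module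
    rw [e]
    exact neg_mem h
  apply_add μ := by
    simp [nodeRoot, nodeWt_apply]
    ring
  comm_eq μ v hv := by
    have h := ρ.op_comm (rootVec_mem (n := n) none i).1 (lineVec_mem (n := n) i 2).1
    rw [comm_lineVec_two, map_smul] at h
    have h' := LinearMap.congr_fun h v
    have h'' : ρ.op 0 (d m n i) v = μ i • v := ρ.mem_wt.1 hv i
    rw [LinearMap.smul_apply, h''] at h'
    rw [map_neg, map_neg, LinearMap.neg_apply, ← h', smul_smul, ← neg_smul]
    congr 1
    ring

theorem exists_triple {i : Option (Fin m)} {j : Fin m} (hij : i ≠ some j) :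
    ∃ f c, Triple ρ (nodeRoot i (some j)) (rootVec m n i j) f c := by
  rcases i with _ | i
  · exact ⟨_, _, triple_none j⟩
  · exact ⟨_, _, triple_some fun h => hij (by rw [h])⟩

theorem ne_bot_of_injective {e : Module.End ℂ (A m n)} {α : Wt m} (he : e ∈ rootSpace m n α 0)
    (hinj : Function.Injective (ρ.op 0 e)) {μ : Wt m} (hμ : ρ.wt μ ≠ ⊥) : ρ.wt (μ + α) ≠ ⊥ := by
  obtain ⟨v, hv, h0⟩ := (Submodule.ne_bot_iff _).1 hμ
  exact (Submodule.ne_bot_iff _).2 ⟨_, ρ.op_mem_wt he hv,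
    fun h => h0 (hinj (by rw [h, map_zero]))⟩

theorem mem_wt_of_op_mem {e : Module.End ℂ (A m n)} {α : Wt m} (he : e ∈ rootSpace m n α 0)
    (hinj : Function.Injective (ρ.op 0 e)) {μ : Wt m} {v : M} (hv : ρ.op 0 e v ∈ ρ.wt (μ + α)) :
    v ∈ ρ.wt μ := by
  rw [mem_wt] at *
  intro i
  have h := LinearMap.congr_fun (ρ.op_comm (d_mem m n i) he.1) v
  rw [show comm (d m n i) e = α i • e from he.2 i] at h
  simp only [map_smul, comm_apply, LinearMap.smul_apply, LinearMap.sub_apply,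
    Module.End.mul_apply] at h
  have h1 : ρ.op 0 (d m n i) (ρ.op 0 e v) = (μ + α) i • ρ.op 0 e v := hv i
  apply hinj
  rw [h1, Pi.add_apply, add_smul] at h
  rw [map_smul, cartan]
  have h2 := eq_sub_iff_add_eq.1 h
  rw [add_comm] at h2
  exact add_right_cancel h2

variable (hs : ρ.IsSimple) (hnt : ¬ρ.IsTrivial) (hw : weightSum ρ.cartan Set.univ = ⊤)
  (hfin : ∀ μ, FiniteDimensional ℂ (ρ.wt μ))
include hs

theorem IsSimple.rootVec_cases {i : Option (Fin m)} {j : Fin m} (hij : i ≠ some j) :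
    Function.Injective (ρ.op 0 (rootVec m n i j)) ∨
      ∀ v, ∃ k, (ρ.op 0 (rootVec m n i j) ^ k) v = 0 :=
  hs.injective_or_nilpotent (rootVec_mem i j).1 fun _ _ hx => rootVec_nilpotent hij hx

include hnt hw hfin in
-- Injective root vectors give shift-stability, locally nilpotent ones give boundedness, and in a
-- finite pair both opposite root vectors are locally nilpotent, which yields strings.
theorem IsSimple.suppShape : SuppShape {μ | ρ.wt μ ≠ ⊥} where
  nonempty := by
    by_contra h
    have hb : weightSum ρ.cartan Set.univ = ⊥ := by
      rw [eq_bot_iff]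
      refine iSup₂_le fun μ _ => ?_
      by_contra hμ
      exact h ⟨μ, fun h' => hμ h'.le⟩
    have := hs.1
    exact bot_ne_top (α := Submodule ℂ M) (hb ▸ hw)
  integral μ hμ ν hν := hs.exists_intWt hμ hν
  closed_or_bounded i j hij := by
    rcases j with _ | j
    · rcases i with _ | i
      · exact absurd rfl hij
      -- The direction `ε_i` is read off from `∂_i`, whose weight is `-ε_i`. If `∂_i` is injective,
      -- then it is either surjective, so that weights can be lifted by `ε_i`, or S is bounded in
      -- that direction. If it is locally nilpotent, S is stable under `ε_i`.
      have e : nodeRoot (some i) none = -nodeRoot none (some i) := (neg_nodeRoot _ _).symm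
      rcases hs.rootVec_cases (i := none) (j := i) (by simp) with h | h
      · rcases hs.surjective_or_bounded hfin (rootVec_mem none i)
          (fun _ _ hx => rootVec_nilpotent (by simp) hx) h with h' | h'
        · left
          intro μ hμ hb
          obtain ⟨v, hv, h0⟩ := (Submodule.ne_bot_iff _).1 hμ
          obtain ⟨u, rfl⟩ := h' v
          have hu := mem_wt_of_op_mem (μ := μ + nodeRoot (some i) none) (rootVec_mem none i) h
            (by rwa [e, neg_add_cancel_right])
          rw [hb, Submodule.mem_bot] at hu
          exact h0 (by rw [hu, map_zero])
        · right
          intro μ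
          obtain ⟨B, hB⟩ := h' μ
          refine ⟨B, fun k hk hmem => hmem ?_⟩
          have := hB k hk
          rwa [sub_eq_add_neg, ← smul_neg, ← e] at this
      · left
        intro μ hμ
        have := hs.add_ε_of_nilpotent hnt h hμ
        rwa [show nodeRoot (some i) none = ε i by simp [nodeRoot, nodeWt]]
    · rcases hs.rootVec_cases hij with h | h
      · exact Or.inl fun μ hμ => ne_bot_of_injective (rootVec_mem i j) h hμ
      · right
        intro μ
        obtain ⟨f, c, ht⟩ := exists_triple (ρ := ρ) hij
        obtain ⟨B, hB⟩ := ht.bounded hfin h μ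
        exact ⟨B, fun k hk hmem => hmem (hB k hk)⟩
  closed_none i := by
    rcases hs.rootVec_cases (i := none) (j := i) (by simp) with h | h
    · exact Or.inr fun μ hμ => ne_bot_of_injective (rootVec_mem none i) h hμ
    · left
      intro μ hμ
      have := hs.add_ε_of_nilpotent hnt h hμ
      rwa [show nodeRoot (some i) none = ε i by simp [nodeRoot, nodeWt]]
  string a b hF μ hμ := by
    have hab : a ≠ b := fun h => hF.ne (by rw [h])
    have hnil : ∀ {a b : Fin m}, a ≠ b → ¬ShiftClosed {μ | ρ.wt μ ≠ ⊥} (some a) (some b) →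
        ∀ v, ∃ k, (ρ.op 0 (rootVec m n (some a) b) ^ k) v = 0 := by
      intro a b hab hc
      refine (hs.rootVec_cases (i := some a) (j := b) (by simpa using hab)).resolve_left fun h => ?_
      exact hc fun μ hμ => ne_bot_of_injective (rootVec_mem (some a) b) h hμ
    exact (triple_some hab).string (hnil hab hF.1) (hnil hab.symm hF.2) hμ

include hfin in
-- Unboundedness along the root excludes local nilpotency, so the root vector is injective;
-- unboundedness along the opposite root excludes the bounded alternative, so it is surjective. It
-- then identifies the two weight spaces.
theorem IsSimple.finrank_wt_add_nodeRoot (hS : ({μ | ρ.wt μ ≠ ⊥} : Set (Wt m)).Nonempty)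
    {i : Option (Fin m)} {j : Fin m} (hij : i ≠ some j)
    (h1 : ShiftClosed {μ | ρ.wt μ ≠ ⊥} i (some j)) (h2 : ShiftClosed {μ | ρ.wt μ ≠ ⊥} (some j) i)
    (μ : Wt m) : Module.finrank ℂ (ρ.wt (μ + nodeRoot i (some j))) =
      Module.finrank ℂ (ρ.wt μ) := by
  obtain ⟨ν, hν⟩ := hS
  have hinj : Function.Injective (ρ.op 0 (rootVec m n i j)) := by
    refine (hs.rootVec_cases hij).resolve_right fun h => ?_
    obtain ⟨f, c, ht⟩ := exists_triple (ρ := ρ) hij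
    obtain ⟨B, hB⟩ := ht.bounded hfin h ν
    exact h1.nsmul hν B (hB B le_rfl)
  have hsurj : Function.Surjective (ρ.op 0 (rootVec m n i j)) := by
    refine (hs.surjective_or_bounded hfin (rootVec_mem i j)
      (fun _ _ hx => rootVec_nilpotent hij hx) hinj).resolve_right fun h => ?_
    obtain ⟨B, hB⟩ := h ν
    have := h2.nsmul hν B
    rw [← neg_nodeRoot, smul_neg, ← sub_eq_add_neg] at this
    exact this (hB B le_rfl)
  have e : (ρ.wt μ).map (ρ.op 0 (rootVec m n i j)) = ρ.wt (μ + nodeRoot i (some j)) := by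
    ext v
    constructor
    · rintro ⟨u, hu, rfl⟩
      exact ρ.op_mem_wt (rootVec_mem i j) hu
    · intro hv
      obtain ⟨u, rfl⟩ := hsurj v
      exact ⟨u, mem_wt_of_op_mem (rootVec_mem i j) hinj hv, rfl⟩
  rw [← e]
  exact (Submodule.equivMapOfInjective _ hinj _).finrank_eq.symm

include hfin in
/-- The dimensions of the weight spaces are constant along the lattice generated by `Δ'^I`. -/
theorem IsSimple.finrank_wt_add (hS : SuppShape {μ | ρ.wt μ ≠ ⊥}) {μ : Wt m} (hμ : ρ.wt μ ≠ ⊥)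
    {γ : Wt m} (hγ : γ ∈ AddSubgroup.closure (RootI {μ | ρ.wt μ ≠ ⊥} μ)) :
    ∀ ν, Module.finrank ℂ (ρ.wt (ν + γ)) = Module.finrank ℂ (ρ.wt ν) := by
  induction hγ using AddSubgroup.closure_induction with
  | mem α hα =>
    intro ν
    obtain ⟨i, j, hij, h1, h2, rfl⟩ := (hS.mem_RootI hμ).1 hα
    -- The available root vectors `t_i ∂_j` and `∂_j` never have `none` as second node, so the root
    -- `ε_i` is treated through `-ε_i`.
    rcases j with _ | j
    · rcases i with _ | i
      · exact absurd rfl hij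
      have := hs.finrank_wt_add_nodeRoot hfin hS.nonempty hij.symm h2 h1
        (ν + nodeRoot (some i) none)
      rw [add_assoc, nodeRoot_add, nodeRoot_self, add_zero] at this
      exact this.symm
    · exact hs.finrank_wt_add_nodeRoot hfin hS.nonempty hij h1 h2 ν
  | zero => intro ν; rw [add_zero]
  | add x y _ _ hx hy => intro ν; rw [← add_assoc, hy, hx]
  | neg x _ hx =>
    intro ν
    have := hx (ν + -x)
    rw [neg_add_cancel_right] at this
    exact this.symm

end Support

end SuperModule

/-! ### Submodules generated from one coset of weights -/

/-- A decomposition of the roots of `W_{m,n}` into a set `T` and a set `T'` which is closed under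
addition and stable under the translations by a subgroup `R`. -/
structure Split {m : ℕ} (n : ℕ) (R : AddSubgroup (Wt m)) (T T' : Set (Wt m)) : Prop where
  add_mem : ∀ x ∈ T', ∀ y ∈ T', x + y ∈ T'
  add_mem' : ∀ x ∈ T', ∀ γ ∈ R, x + γ ∈ T'
  not_mem : ∀ γ ∈ R, γ ∉ T'
  cover : ∀ α j, rootSpace m n α j ≠ ⊥ → α ∈ T ∨ α ∈ T'

namespace SuperModule

variable {m n : ℕ} {M : Type*} [AddCommGroup M] [Module ℂ M] (ρ : SuperModule (W m n) M)

/-- The subspaces obtained from `Y` by repeatedly applying the root vectors with roots in `T'`. -/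
def tower (T' : Set (Wt m)) (Y : Submodule ℂ M) : ℕ → Submodule ℂ M
  | 0 => Y
  | k + 1 => tower T' Y k ⊔ Submodule.span ℂ {w | ∃ j, ∃ β ∈ T', ∃ x ∈ rootSpace m n β j,
      ∃ v ∈ tower T' Y k, w = ρ.op j x v}

variable {ρ} {R : AddSubgroup (Wt m)} {T T' : Set (Wt m)}

theorem op_mem_tower {Y : Submodule ℂ M} {β : Wt m} (hβ : β ∈ T') {j : ZMod 2}
    {x : Module.End ℂ (A m n)} (hx : x ∈ rootSpace m n β j) {k : ℕ} {v : M}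
    (hv : v ∈ ρ.tower T' Y k) : ρ.op j x v ∈ ρ.tower T' Y (k + 1) :=
  Submodule.mem_sup_right (Submodule.subset_span ⟨j, β, hβ, x, hx, v, hv, rfl⟩)

theorem tower_le_succ {Y : Submodule ℂ M} {k : ℕ} : ρ.tower T' Y k ≤ ρ.tower T' Y (k + 1) :=
  le_sup_left

theorem parity_mem_tower {Y : Submodule ℂ M} (hpar : ∀ v ∈ Y, ρ.grading.parity v ∈ Y) (k : ℕ) :
    ∀ v ∈ ρ.tower T' Y k, ρ.grading.parity v ∈ ρ.tower T' Y k := by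
  induction k with
  | zero => exact hpar
  | succ k ih =>
    change ρ.tower T' Y (k + 1) ≤ (ρ.tower T' Y (k + 1)).comap ρ.grading.parity
    refine sup_le (fun v hv => tower_le_succ (ih v hv)) (Submodule.span_le.2 ?_)
    rintro _ ⟨j, β, hβ, x, hx, v, hv, rfl⟩
    rw [SetLike.mem_coe, Submodule.mem_comap, ρ.parity_op hx.1]
    exact Submodule.smul_mem _ _ (op_mem_tower hβ hx (ih v hv))

theorem op_op {α β : Wt m} {i j : ZMod 2} {x y : Module.End ℂ (A m n)}
    (hx : x ∈ rootSpace m n α i) (hy : y ∈ rootSpace m n β j) (v : M) :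
    ρ.op i x (ρ.op j y v) = ρ.op (i + j) (x * y - sgn (i * j) • (y * x)) v +
      sgn (i * j) • ρ.op j y (ρ.op i x v) := by
  rw [ρ.op_bracket hx.1 hy.1]
  simp

/-- A root vector with root in T is moved past one with root in `T'`. Their bracket is zero or has
its root in T or in `T'`; in either case it lands within the next step of the tower. -/
theorem op_mem_tower' (h : Split n R T T') {Y : Submodule ℂ M}
    (hY : ∀ j, ∀ α ∈ T, ∀ x ∈ rootSpace m n α j, ∀ v ∈ Y, ρ.op j x v ∈ Y) (k : ℕ) :
    ∀ j, ∀ α ∈ T, ∀ x ∈ rootSpace m n α j, ∀ v ∈ ρ.tower T' Y k, ρ.op j x v ∈ ρ.tower T' Y k := by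
  induction k with
  | zero => exact hY
  | succ k ih =>
    intro i α hα x hx
    change ρ.tower T' Y (k + 1) ≤ (ρ.tower T' Y (k + 1)).comap (ρ.op i x)
    refine sup_le (fun v hv => tower_le_succ (ih i α hα x hx v hv)) (Submodule.span_le.2 ?_)
    rintro _ ⟨j, β, hβ, y, hy, v, hv, rfl⟩
    rw [SetLike.mem_coe, Submodule.mem_comap, op_op hx hy]
    refine add_mem ?_ (Submodule.smul_mem _ _ (op_mem_tower hβ hy (ih i α hα x hx v hv)))
    have hz := rootSpace_bracket hx hy
    by_cases h0 : rootSpace m n (α + β) (i + j) = ⊥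
    · rw [h0, Submodule.mem_bot] at hz
      rw [hz, map_zero]
      exact zero_mem _
    rcases h.cover _ _ h0 with hT | hT
    · exact tower_le_succ (ih _ _ hT _ hz v hv)
    · exact op_mem_tower hT hz hv

/-- The submodule generated by a graded subspace which is stable under the root vectors with roots
in `T`. -/
theorem exists_submodule (h : Split n R T T') {μ : Wt m} {Y : Submodule ℂ M}
    (hw : Y ≤ weightSum ρ.cartan {ν | ν - μ ∈ R}) (hpar : ∀ v ∈ Y, ρ.grading.parity v ∈ Y)
    (hY : ∀ j, ∀ α ∈ T, ∀ x ∈ rootSpace m n α j, ∀ v ∈ Y, ρ.op j x v ∈ Y) :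
    ∃ X, ρ.IsSubmodule X ∧ Y ≤ X ∧ X ≤ Y ⊔ weightSum ρ.cartan {ν | ν - μ ∈ T'} := by
  have hle : ∀ k, ρ.tower T' Y k ≤ ⨆ k, ρ.tower T' Y k := fun k => le_iSup _ k
  refine ⟨⨆ k, ρ.tower T' Y k, ρ.isSubmodule_of_rootSpace ?_ ?_, hle 0, iSup_le fun k => ?_⟩
  · change (⨆ k, ρ.tower T' Y k) ≤ (⨆ k, ρ.tower T' Y k).comap ρ.grading.parity
    exact iSup_le fun k v hv => hle k (parity_mem_tower hpar k v hv)
  · intro j α x hx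
    change (⨆ k, ρ.tower T' Y k) ≤ (⨆ k, ρ.tower T' Y k).comap (ρ.op j x)
    refine iSup_le fun k v hv => ?_
    rw [Submodule.mem_comap]
    by_cases h0 : rootSpace m n α j = ⊥
    · rw [h0, Submodule.mem_bot] at hx
      rw [hx, map_zero]
      exact zero_mem _
    rcases h.cover _ _ h0 with hT | hT
    · exact hle k (op_mem_tower' h hY k j α hT x hx v hv)
    · exact hle (k + 1) (op_mem_tower hT hx hv)
  · induction k with
    | zero => exact le_sup_left
    | succ k ih =>
      refine sup_le ih (Submodule.span_le.2 ?_)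
      rintro _ ⟨j, β, hβ, y, hy, v, hv, rfl⟩
      obtain ⟨v₁, hv₁, v₂, hv₂, rfl⟩ := Submodule.mem_sup.1 (ih hv)
      rw [map_add]
      refine Submodule.mem_sup_right (add_mem ?_ ?_)
      · refine ρ.op_mem_weightSum hy (fun ν hν => Or.inl ?_) (hw hv₁)
        have := h.add_mem' β hβ _ hν
        rwa [show β + (ν - μ) = ν + β - μ by abel] at this
      · refine ρ.op_mem_weightSum hy (fun ν hν => Or.inl ?_) hv₂
        have := h.add_mem β hβ _ hν
        rwa [show β + (ν - μ) = ν + β - μ by abel] at this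

theorem weightSum_disjoint_of_split (h : Split n R T T') (μ : Wt m) :
    Disjoint (weightSum ρ.cartan {ν | ν - μ ∈ R}) (weightSum ρ.cartan {ν | ν - μ ∈ T'}) :=
  weightSum_disjoint (Set.disjoint_left.2 fun _ hν => h.not_mem _ hν)

/-- In a simple module, the sum of the weight spaces in a coset of `R` is simple for the root
vectors in `T ∩ R`, if the other root vectors in `T` act on it by zero. -/
theorem IsSimple.eq_bot_or_eq_weightSum (hs : ρ.IsSimple) (h : Split n R T T') {μ : Wt m}
    (hpos : ∀ α ∈ T, α ∉ R → ∀ ν, ν - μ ∈ R → ρ.wt (ν + α) = ⊥) {Y : Submodule ℂ M}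
    (hw : Y ≤ weightSum ρ.cartan {ν | ν - μ ∈ R}) (hpar : ∀ v ∈ Y, ρ.grading.parity v ∈ Y)
    (hY : ∀ j, ∀ α ∈ T, α ∈ R → ∀ x ∈ rootSpace m n α j, ∀ v ∈ Y, ρ.op j x v ∈ Y) :
    Y = ⊥ ∨ Y = weightSum ρ.cartan {ν | ν - μ ∈ R} := by
  -- Root vectors with root in T outside R kill the whole coset, so Y is stable under all of T.
  obtain ⟨X, hX, hYX, hXY⟩ := exists_submodule h hw hpar fun j α hα x hx v hv => by
    by_cases hR : α ∈ R
    · exact hY j α hα hR x hx v hv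
    · have := ρ.op_mem_weightSum (T' := ∅) hx (fun ν hν => Or.inr (hpos α hα hR ν hν)) (hw hv)
      rw [weightSum] at this
      simp only [Set.mem_empty_iff_false, iSup_false, iSup_bot, Submodule.mem_bot] at this
      rw [this]
      exact zero_mem _
  rcases hs.2 X hX with h' | h'
  · exact Or.inl (le_bot_iff.1 (h' ▸ hYX))
  · refine Or.inr (le_antisymm hw fun v hv => ?_)
    have hvX : v ∈ X := h' ▸ Submodule.mem_top
    -- If X is everything, a vector of the coset is an element of Y plus a part with weights in
    -- `T'`; the latter vanishes because the coset of R and `T'` are disjoint.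
    obtain ⟨y, hy, z, hz, rfl⟩ := Submodule.mem_sup.1 (hXY hvX)
    have hz' : z ∈ weightSum ρ.cartan {ν | ν - μ ∈ R} := by
      have := sub_mem hv (hw hy)
      rwa [add_sub_cancel_left] at this
    rw [Submodule.disjoint_def.1 (weightSum_disjoint_of_split h μ) z hz' hz, add_zero]
    exact hy

end SuperModule

theorem Superspace.parity_ofInvolution {V : Type*} [AddCommGroup V] [Module ℂ V] {σ : V →ₗ[ℂ] V}
    (hσ : ∀ v, σ (σ v) = v) (v : V) : (Superspace.ofInvolution σ hσ).parity v = σ v := by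
  obtain ⟨y, hy, z, hz, rfl⟩ := (Superspace.ofInvolution σ hσ).exists_add v
  rw [map_add, map_add, Superspace.parity_apply _ hy, Superspace.parity_apply _ hz,
    Superspace.mem_ofInvolution.1 hy, Superspace.mem_ofInvolution.1 hz]

/-! ### Action of the enveloping algebra -/

section Enveloping

variable {V : Type*} [AddCommGroup V] [Module ℂ V] {γ : Superspace V} {g : LieSuper γ}

theorem Env.induction {p : Env g → Prop} (h1 : p 1) (hadd : ∀ a b, p a → p b → p (a + b))
    (hsmul : ∀ (c : ℂ) a, p a → p (c • a)) (hι : ∀ i x, p (Env.ι g i x))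
    (hmul : ∀ a b, p a → p b → p (a * b)) (a : Env g) : p a := by
  obtain ⟨a, rfl⟩ : ∃ b, Env.mk g b = a := RingQuot.mkAlgHom_surjective ℂ (EnvRel g) a
  induction a using TensorAlgebra.induction with
  | algebraMap r =>
    rw [Algebra.algebraMap_eq_smul_one, map_smul, map_one]
    exact hsmul _ _ h1
  | ι x =>
    induction x using DirectSum.induction_on with
    | zero =>
      rw [map_zero, map_zero]
      simpa using hsmul 0 _ h1
    | of i x => exact hι i x
    | add x y hx hy =>
      rw [map_add, map_add]
      exact hadd _ _ hx hy
  | mul a b ha hb => rw [map_mul]; exact hmul _ _ ha hb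
  | add a b ha hb => rw [map_add]; exact hadd _ _ ha hb

variable {M : Type*} [AddCommGroup M] [Module ℂ M] (ρ : SuperModule g M)

/-- The action of the enveloping algebra. -/
def SuperModule.envAct : Env g →ₐ[ℂ] Module.End ℂ M :=
  RingQuot.liftAlgHom ℂ
    ⟨TensorAlgebra.lift ℂ (DirectSum.toModule ℂ (ZMod 2) (Module.End ℂ M) fun i => ρ.act i), by
      rintro _ _ ⟨x, y⟩
      simp only [map_sub, map_mul, map_smul, TensorAlgebra.lift_ι_apply, DirectSum.toModule_lof,
        ρ.act_bracket]⟩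

theorem SuperModule.envAct_ι (i : ZMod 2) (x : g.part i) : ρ.envAct (Env.ι g i x) = ρ.act i x := by
  have e : ρ.envAct (Env.ι g i x) = TensorAlgebra.lift ℂ
      (DirectSum.toModule ℂ (ZMod 2) (Module.End ℂ M) fun i => ρ.act i)
      (TensorAlgebra.ι ℂ (DirectSum.lof ℂ (ZMod 2) (fun i => g.part i) i x)) :=
    RingQuot.liftAlgHom_mkAlgHom_apply ℂ _ _ _
  rw [e]
  simp

theorem SuperModule.parity_envAct (a : Env g) : ∀ v : M,
    ρ.grading.parity (ρ.envAct a v) = ρ.envAct (Env.parity g a) (ρ.grading.parity v) := by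
  refine Env.induction (p := fun a => ∀ v : M,
    ρ.grading.parity (ρ.envAct a v) = ρ.envAct (Env.parity g a) (ρ.grading.parity v))
    ?_ ?_ ?_ ?_ ?_ a
  · intro v; simp
  · intro a b ha hb v; simp [ha, hb]
  · intro c a ha v; simp [ha]
  · intro i x v
    rw [Env.parity_ι, map_smul, ρ.envAct_ι, ← ρ.op_coe, ρ.parity_op x.2, LinearMap.smul_apply]
  · intro a b ha hb v
    rw [map_mul, map_mul, map_mul, Module.End.mul_apply, Module.End.mul_apply, ha, hb]

end Enveloping

/-! ### Universal property of the induced module -/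

section Induced

variable {V : Type*} [AddCommGroup V] [Module ℂ V] {γ : Superspace V} {p g : LieSuper γ}
  (h : p.IsSub g) {N : Type*} [AddCommGroup N] [Module ℂ N] (η : SuperModule p N)

/-- The map `v ↦ 1 ⊗ v`. -/
def indUnit : N →ₗ[ℂ] IndSpace h η := (indRel h η).mkQ ∘ₗ TensorProduct.mk ℂ (Env g) N 1

theorem indMul_indUnit (a : Env g) (v : N) :
    indMul h η a (indUnit h η v) = (indRel h η).mkQ (a ⊗ₜ v) := by
  rw [indUnit, LinearMap.comp_apply, TensorProduct.mk_apply, indMul_mk, mul_one]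

theorem ind_op (i : ZMod 2) {x : Module.End ℂ V} (hx : x ∈ g.part i) (z : IndSpace h η) :
    (ind h η).op i x z = indMul h η (Env.ι g i ⟨x, hx⟩) z := by
  rw [SuperModule.op_eq _ hx]
  rfl

theorem ind_op_indUnit (i : ZMod 2) {x : Module.End ℂ V} (hx : x ∈ p.part i) (v : N) :
    (ind h η).op i x (indUnit h η v) = indUnit h η (η.act i ⟨x, hx⟩ v) := by
  rw [ind_op h η i (h i hx), indMul_indUnit, indUnit, LinearMap.comp_apply,
    TensorProduct.mk_apply, ← sub_eq_zero, ← map_sub, Submodule.mkQ_apply,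
    Submodule.Quotient.mk_eq_zero]
  refine Submodule.subset_span ⟨1, i, ⟨x, hx⟩, v, ?_⟩
  rw [one_mul]
  rfl

theorem ind_parity (z : IndSpace h η) : (ind h η).grading.parity z = indParity h η z :=
  Superspace.parity_ofInvolution (indParity_indParity h η) z

theorem ind_parity_indUnit (v : N) :
    (ind h η).grading.parity (indUnit h η v) = indUnit h η (η.grading.parity v) := by
  rw [ind_parity]
  simp [indUnit, indParity]

theorem indMul_mul (a b : Env g) (z : IndSpace h η) :
    indMul h η (a * b) z = indMul h η a (indMul h η b z) := by
  have e : indMul h η (a * b) = indMul h η a ∘ₗ indMul h η b := by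
    apply ind_ext
    intro u v
    rw [LinearMap.comp_apply, indMul_mk, indMul_mk, indMul_mk, mul_assoc]
  exact LinearMap.congr_fun e z

/-- The induced module is generated by `1 ⊗ N`. -/
theorem eq_top_of_indUnit_mem {X : Submodule ℂ (IndSpace h η)} (hX : (ind h η).IsSubmodule X)
    (hN : ∀ v, indUnit h η v ∈ X) : X = ⊤ := by
  have key : ∀ (a : Env g), ∀ z ∈ X, indMul h η a z ∈ X := by
    intro a
    refine Env.induction (p := fun a => ∀ z ∈ X, indMul h η a z ∈ X) ?_ ?_ ?_ ?_ ?_ a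
    · intro z hz
      have e : indMul h η 1 = LinearMap.id := by
        apply ind_ext
        intro u v
        rw [indMul_mk, one_mul, LinearMap.id_apply]
      rwa [e]
    · intro a b ha hb z hz
      have e : indMul h η (a + b) = indMul h η a + indMul h η b := by
        apply ind_ext
        intro u v
        rw [LinearMap.add_apply, indMul_mk, indMul_mk, indMul_mk, add_mul, TensorProduct.add_tmul,
          map_add]
      rw [e]
      exact add_mem (ha z hz) (hb z hz)
    · intro c a ha z hz
      have e : indMul h η (c • a) = c • indMul h η a := by
        apply ind_ext
        intro u v
        rw [LinearMap.smul_apply, indMul_mk, indMul_mk, smul_mul_assoc, ← TensorProduct.smul_tmul',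
          map_smul]
      rw [e]
      exact X.smul_mem c (ha z hz)
    · intro i x z hz
      exact hX.2 i x z hz
    · intro a b ha hb z hz
      rw [indMul_mul]
      exact ha _ (hb z hz)
  rw [eq_top_iff]
  rintro z -
  obtain ⟨z, rfl⟩ := Submodule.mkQ_surjective _ z
  induction z using TensorProduct.induction_on with
  | zero => rw [map_zero]; exact zero_mem _
  | add a b ha hb => rw [map_add]; exact add_mem ha hb
  | tmul u v =>
    rw [← indMul_indUnit]
    exact key u _ (hN v)

variable {M : Type*} [AddCommGroup M] [Module ℂ M] (ρ : SuperModule g M) {f : N →ₗ[ℂ] M}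
  (hf : ∀ (i : ZMod 2) (x : p.part i) (v : N), f (η.act i x v) = ρ.op i x (f v))

/-- The map `u ⊗ v ↦ u f(v)` from the induced module. -/
def indLift : IndSpace h η →ₗ[ℂ] M :=
  (indRel h η).liftQ (TensorProduct.lift (LinearMap.lcomp ℂ M f ∘ₗ ρ.envAct.toLinearMap)) (by
    rw [indRel, Submodule.span_le]
    rintro _ ⟨u, i, x, v, rfl⟩
    rw [SetLike.mem_coe, LinearMap.mem_ker, map_sub, TensorProduct.lift.tmul,
      TensorProduct.lift.tmul, sub_eq_zero]
    simp only [LinearMap.comp_apply, AlgHom.toLinearMap_apply, LinearMap.lcomp_apply, map_mul,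
      Module.End.mul_apply, ρ.envAct_ι, hf]
    rw [← ρ.op_coe]
    rfl)

theorem indLift_mk (u : Env g) (v : N) :
    indLift h η ρ hf ((indRel h η).mkQ (u ⊗ₜ v)) = ρ.envAct u (f v) := by
  simp [indLift]

theorem indLift_indUnit (v : N) : indLift h η ρ hf (indUnit h η v) = f v := by
  rw [indUnit, LinearMap.comp_apply, TensorProduct.mk_apply, indLift_mk, map_one]
  rfl

theorem indLift_isHom (hpar : ∀ v, f (η.grading.parity v) = ρ.grading.parity (f v)) :
    (ind h η).IsHom ρ (indLift h η ρ hf) := by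
  refine ⟨fun i z hz => ?_, fun i x z => ?_⟩
  · apply ρ.grading.mem_of_parity_eq
    have e : indLift h η ρ hf ∘ₗ indParity h η = ρ.grading.parity ∘ₗ indLift h η ρ hf := by
      apply ind_ext
      intro u v
      rw [LinearMap.comp_apply, LinearMap.comp_apply, indLift_mk, ρ.parity_envAct, ← hpar,
        ← indLift_mk h η ρ hf]
      congr 1
    have := LinearMap.congr_fun e z
    rw [LinearMap.comp_apply, LinearMap.comp_apply, ← ind_parity,
      (ind h η).grading.parity_apply hz, map_smul] at this
    exact this.symm
  · have e : indLift h η ρ hf ∘ₗ indMul h η (Env.ι g i x) = ρ.act i x ∘ₗ indLift h η ρ hf := by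
      apply ind_ext
      intro u v
      rw [LinearMap.comp_apply, LinearMap.comp_apply, indMul_mk, indLift_mk, indLift_mk, map_mul,
        ρ.envAct_ι]
      rfl
    exact LinearMap.congr_fun e z

end Induced

/-! ### Homomorphisms and unique simple quotients -/

section Homs

variable {V : Type*} [AddCommGroup V] [Module ℂ V] {γ : Superspace V} {g : LieSuper γ}
  {M N : Type*} [AddCommGroup M] [Module ℂ M] [AddCommGroup N] [Module ℂ N]
  {ρ : SuperModule g M} {η : SuperModule g N} {φ : M →ₗ[ℂ] N}

namespace SuperModule

theorem IsHom.map_parity (hφ : ρ.IsHom η φ) (v : M) :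
    φ (ρ.grading.parity v) = η.grading.parity (φ v) := by
  obtain ⟨y, hy, z, hz, rfl⟩ := ρ.grading.exists_add v
  rw [map_add, map_add, map_add, map_add, ρ.grading.parity_apply hy, ρ.grading.parity_apply hz,
    η.grading.parity_apply (hφ.1 _ y hy), η.grading.parity_apply (hφ.1 _ z hz), map_smul, map_smul]

theorem IsHom.map_op (hφ : ρ.IsHom η φ) {i : ZMod 2} {x : Module.End ℂ V} (hx : x ∈ g.part i)
    (v : M) : φ (ρ.op i x v) = η.op i x (φ v) := by
  rw [ρ.op_eq hx, η.op_eq hx, hφ.2]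

theorem IsHom.isSubmodule_ker (hφ : ρ.IsHom η φ) : ρ.IsSubmodule (LinearMap.ker φ) := by
  refine ρ.isSubmodule_of_parity_mem (fun v hv => ?_) fun j x hx v hv => ?_
  · rw [LinearMap.mem_ker] at *
    rw [hφ.map_parity, hv, map_zero]
  · rw [LinearMap.mem_ker] at *
    rw [hφ.map_op hx, hv, map_zero]

theorem IsHom.isSubmodule_map (hφ : ρ.IsHom η φ) {X : Submodule ℂ M} (hX : ρ.IsSubmodule X) :
    η.IsSubmodule (X.map φ) := by
  refine η.isSubmodule_of_parity_mem ?_ ?_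
  · rintro _ ⟨v, hv, rfl⟩
    exact ⟨_, hX.parity_mem hv, hφ.map_parity v⟩
  · rintro j x hx _ ⟨v, hv, rfl⟩
    exact ⟨_, hX.op_mem hx hv, hφ.map_op hx v⟩

/-- The image of a submodule in the simple target is zero or everything. By `hX` the second occurs
only for the whole module, so every proper submodule is contained in the kernel. -/
theorem IsHom.hasUniqueSimpleQuotient (hφ : ρ.IsHom η φ) (hs : η.IsSimple)
    (hne : φ ≠ 0) (hX : ∀ X, ρ.IsSubmodule X → X.map φ = ⊤ → X = ⊤) :
    ρ.HasUniqueSimpleQuotient η := by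
  have htop : ρ.IsSubmodule ⊤ :=
    ρ.isSubmodule_of_parity_mem (fun _ _ => Submodule.mem_top) fun _ _ _ _ _ => Submodule.mem_top
  have hcases : ∀ X, ρ.IsSubmodule X → X ≤ LinearMap.ker φ ∨ X = ⊤ := by
    intro X h
    rcases hs.2 _ (hφ.isSubmodule_map h) with h' | h'
    · exact Or.inl (LinearMap.le_ker_iff_map.2 h')
    · exact Or.inr (hX X h h')
  have hker : LinearMap.ker φ ≠ ⊤ := fun h => hne (LinearMap.ker_eq_top.1 h)
  refine ⟨hs, φ, hφ, ?_, fun X => ⟨fun h => ?_, ?_⟩⟩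
  · rw [← LinearMap.range_eq_top, ← Submodule.map_top]
    refine (hs.2 _ (hφ.isSubmodule_map htop)).resolve_left fun h => hne ?_
    rwa [Submodule.map_top, LinearMap.range_eq_bot] at h
  · have hle := (hcases X h.1).resolve_right h.2.1
    exact ((h.2.2 _ hφ.isSubmodule_ker hle).resolve_right hker).symm
  · rintro rfl
    exact ⟨hφ.isSubmodule_ker, hker, fun Y hY hle =>
      (hcases Y hY).imp_left fun h => le_antisymm h hle⟩

end SuperModule

end Homs

/-! ### Weights of the induced module -/

section InducedWeights

variable {m n : ℕ} {R : AddSubgroup (Wt m)} {T T' : Set (Wt m)}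
  {hT : ∀ α ∈ T, ∀ β ∈ T, α + β ∈ insert 0 (Root m n) → α + β ∈ T} (h0 : 0 ∈ T)
  {N : Type*} [AddCommGroup N] [Module ℂ N] (η : SuperModule (ofRoots (n := n) T hT) N)

theorem rootSpace_le_ofRoots {α : Wt m} (hα : α ∈ T) (j : ZMod 2) :
    rootSpace m n α j ≤ (ofRoots (n := n) T hT).part j :=
  le_iSup₂_of_le (f := fun α (_ : α ∈ T) => rootSpace m n α j) α hα le_rfl

theorem indUnit_mem_wt {ν : Wt m} {v : N} (hv : v ∈ weightSpace (ofRoots_hasCartan h0) η ν) :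
    indUnit ofRoots_isSub_W η v ∈ (ind (g := W m n) ofRoots_isSub_W η).wt ν := by
  rw [SuperModule.mem_wt]
  rw [mem_weightSpace] at hv
  intro i
  rw [SuperModule.cartan, ind_op_indUnit _ _ _ (ofRoots_hasCartan (n := n) (hT := hT) h0 i), hv, map_smul]

/-- The induced module is the sum of `1 ⊗ N` and weight spaces with lower weights. -/
theorem exists_indUnit_add (h : Split n R T T') {μ : Wt m}
    (hw : ⨆ ν ∈ {ν | ν - μ ∈ R}, weightSpace (ofRoots_hasCartan h0) η ν = ⊤)
    (z : IndSpace (g := W m n) ofRoots_isSub_W η) :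
    ∃ v, ∃ w ∈ weightSum (ind (g := W m n) ofRoots_isSub_W η).cartan {ν | ν - μ ∈ T'},
      indUnit ofRoots_isSub_W η v + w = z := by
  obtain ⟨X, hX, hYX, hXY⟩ := SuperModule.exists_submodule
    (ρ := ind (g := W m n) ofRoots_isSub_W η) h
    (Y := LinearMap.range (indUnit (g := W m n) ofRoots_isSub_W η)) (μ := μ) (by
      rw [← Submodule.map_top, ← hw, Submodule.map_le_iff_le_comap]
      exact iSup₂_le fun ν hν v hv => jointSpace_le_weightSum hν (indUnit_mem_wt h0 η hv)) (by
      rintro _ ⟨v, rfl⟩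
      exact ⟨_, (ind_parity_indUnit _ _ v).symm⟩) (by
      rintro j α hα x hx _ ⟨v, rfl⟩
      exact ⟨_, (ind_op_indUnit _ _ j (rootSpace_le_ofRoots hα j hx) v).symm⟩)
  have hXt := eq_top_of_indUnit_mem _ _ hX fun v => hYX ⟨v, rfl⟩
  obtain ⟨_, ⟨v, rfl⟩, w, hw', e⟩ := Submodule.mem_sup.1 (hXY (hXt ▸ Submodule.mem_top (x := z)))
  exact ⟨v, w, hw', e⟩

end InducedWeights

/-! ### The module N on a coset of weights -/

namespace SuperModule

section Sub

variable {V : Type*} [AddCommGroup V] [Module ℂ V] {γ : Superspace V} {g k : LieSuper γ}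
  {M : Type*} [AddCommGroup M] [Module ℂ M] (ρ : SuperModule g M) (hk : k.IsSub g)
  {X : Submodule ℂ M} (hX : ∀ v ∈ X, ρ.grading.parity v ∈ X)
  (hop : ∀ (j : ZMod 2) (x : k.part j), ∀ v ∈ X, ρ.act j (LieSuper.incl hk j x) v ∈ X)

theorem sub_act_coe (j : ZMod 2) (x : k.part j) (v : X) :
    ((ρ.sub hk X hX hop).act j x v : M) = ρ.op j x v := by
  rw [ρ.op_eq (hk j x.2)]
  rfl

theorem sub_parity_coe (v : X) :
    ((ρ.sub hk X hX hop).grading.parity v : M) = ρ.grading.parity v := by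
  obtain ⟨y, hy, z, hz, rfl⟩ := (ρ.sub hk X hX hop).grading.exists_add v
  have hy' : (y : M) ∈ ρ.grading.part 0 := hy
  have hz' : (z : M) ∈ ρ.grading.part 1 := hz
  rw [map_add, Superspace.parity_apply _ hy, Superspace.parity_apply _ hz, Submodule.coe_add,
    Submodule.coe_add, map_add, ρ.grading.parity_apply hy', ρ.grading.parity_apply hz']
  rfl

theorem IsSimple.of_restrict {ρ : SuperModule g M} (h : (ρ.restrict hk).IsSimple) :
    ρ.IsSimple :=
  ⟨h.1, fun Y hY => h.2 Y ⟨hY.1, fun i x v hv => hY.2 i (LieSuper.incl hk i x) v hv⟩⟩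

end Sub

section Coset

variable {m n : ℕ} {M : Type*} [AddCommGroup M] [Module ℂ M] (ρ : SuperModule (W m n) M)
  {R : AddSubgroup (Wt m)} {T T' T₀ : Set (Wt m)}
  (hT : ∀ α ∈ T, ∀ β ∈ T, α + β ∈ insert 0 (Root m n) → α + β ∈ T)
  (hT₀ : ∀ α ∈ T₀, ∀ β ∈ T₀, α + β ∈ insert 0 (Root m n) → α + β ∈ T₀) {μ : Wt m}
  (hpos : ∀ α ∈ T, α ∉ R → ∀ ν, ν - μ ∈ R → ρ.wt (ν + α) = ⊥)

/-- The module over the subalgebra with roots `T` on the sum of the weight spaces in a coset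
of `R`. -/
def cosetModule : SuperModule (ofRoots (n := n) T hT) (weightSum ρ.cartan {ν | ν - μ ∈ R}) :=
  ρ.sub ofRoots_isSub_W _ (fun _ hv => ρ.parity_mem_weightSum _ hv) (by
    intro j x v hv
    have hle : (⨆ α ∈ T, rootSpace m n α j) ≤
        (weightSum ρ.cartan {ν | ν - μ ∈ R}).comap (LinearMap.applyₗ v ∘ₗ ρ.op j) := by
      refine iSup₂_le fun α hα x hx => ρ.op_mem_weightSum hx (fun ν hν => ?_) hv
      by_cases hR : α ∈ R
      · left
        have := R.add_mem hν hR
        rwa [show ν - μ + α = ν + α - μ by abel] at this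
      · exact Or.inr (hpos α hα hR ν hν)
    have := hle x.2
    rw [← ρ.op_coe]
    exact this)

theorem cosetModule_act_coe (j : ZMod 2) (x : (ofRoots (n := n) T hT).part j)
    (v : weightSum ρ.cartan {ν | ν - μ ∈ R}) :
    ((ρ.cosetModule hT hpos).act j x v : M) = ρ.op j x v := ρ.sub_act_coe _ _ _ j x v

theorem cosetModule_weightSpace (h0 : 0 ∈ T) (ν : Wt m) :
    weightSpace (ofRoots_hasCartan h0) (ρ.cosetModule hT hpos) ν =
      (ρ.wt ν).comap (weightSum ρ.cartan {ν | ν - μ ∈ R}).subtype := by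
  ext v
  rw [mem_weightSpace, Submodule.mem_comap, mem_wt]
  refine forall_congr' fun i => ?_
  rw [Subtype.ext_iff, cosetModule_act_coe]
  rfl

theorem finrank_cosetModule_weightSpace (h0 : 0 ∈ T) {ν : Wt m} (hν : ν - μ ∈ R) :
    Module.finrank ℂ (weightSpace (ofRoots_hasCartan h0) (ρ.cosetModule hT hpos) ν) =
      Module.finrank ℂ (ρ.wt ν) := by
  have hle : ρ.wt ν ≤ weightSum ρ.cartan {ν | ν - μ ∈ R} :=
    jointSpace_le_weightSum (T := {ν | ν - μ ∈ R}) hν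
  rw [ρ.cosetModule_weightSpace hT hpos h0]
  exact (Submodule.comapSubtypeEquivOfLe hle).finrank_eq

theorem cosetModule_weightSpace_eq_bot (h0 : 0 ∈ T) {ν : Wt m} (hν : ν - μ ∉ R) :
    weightSpace (ofRoots_hasCartan h0) (ρ.cosetModule hT hpos) ν = ⊥ := by
  rw [ρ.cosetModule_weightSpace hT hpos h0, eq_bot_iff]
  intro v hv
  have hd : Disjoint ({ν} : Set (Wt m)) {ν | ν - μ ∈ R} := Set.disjoint_singleton_left.2 hν
  refine (Submodule.mem_bot ℂ).2 (Subtype.ext ?_)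
  exact Submodule.disjoint_def.1 (weightSum_disjoint (h := ρ.cartan) hd) _
    (jointSpace_le_weightSum (Set.mem_singleton ν) hv) v.2

theorem iSup_cosetModule_weightSpace (h0 : 0 ∈ T) :
    ⨆ ν ∈ {ν | ν - μ ∈ R}, weightSpace (ofRoots_hasCartan h0) (ρ.cosetModule hT hpos) ν = ⊤ := by
  rw [eq_top_iff]
  rintro ⟨v, hv⟩ -
  obtain ⟨f, hf, hfR, rfl⟩ := mem_weightSum.1 hv
  have e : (⟨∑ μ ∈ f.support, f μ, hv⟩ : weightSum ρ.cartan {ν | ν - μ ∈ R}) =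
      ∑ ν ∈ f.support.attach, ⟨f ν, jointSpace_le_weightSum (hfR ν ν.2) (hf ν)⟩ := by
    apply Subtype.ext
    rw [AddSubmonoidClass.coe_finsetSum]
    exact (Finset.sum_attach f.support fun ν => f ν).symm
  rw [e]
  refine Submodule.sum_mem _ fun ν _ => ?_
  refine Submodule.mem_iSup_of_mem ν.1 (Submodule.mem_iSup_of_mem (hfR ν ν.2) ?_)
  rw [ρ.cosetModule_weightSpace hT hpos h0]
  exact hf ν

theorem weightSpace_restrict_cosetModule (h0 : 0 ∈ T) (h0' : 0 ∈ T₀)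
    (hk : (ofRoots (n := n) T₀ hT₀).IsSub (ofRoots T hT)) (ν : Wt m) :
    weightSpace (ofRoots_hasCartan h0') ((ρ.cosetModule hT hpos).restrict hk) ν =
      weightSpace (ofRoots_hasCartan h0) (ρ.cosetModule hT hpos) ν := by
  ext v
  rw [mem_weightSpace, mem_weightSpace]
  rfl

variable {ρ}

/-- A submodule over the smaller algebra is stable under all root vectors with root in `T ∩ R`;
`IsSimple.eq_bot_or_eq_weightSum` applies to its image in M. -/
theorem IsSimple.restrict_cosetModule (hs : ρ.IsSimple) (h : Split n R T T')
    (hT' : ∀ α ∈ T, α ∈ R → α ∈ T₀) (hμ : ρ.wt μ ≠ ⊥)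
    (hk : (ofRoots (n := n) T₀ hT₀).IsSub (ofRoots T hT)) :
    ((ρ.cosetModule hT hpos).restrict hk).IsSimple := by
  constructor
  · obtain ⟨v, hv, h0⟩ := (Submodule.ne_bot_iff _).1 hμ
    have hv' : v ∈ weightSum ρ.cartan {ν | ν - μ ∈ R} :=
      jointSpace_le_weightSum (by change μ - μ ∈ R; rw [sub_self]; exact zero_mem R) hv
    exact ⟨⟨⟨v, hv'⟩, 0, fun e => h0 (congrArg Subtype.val e)⟩⟩
  · intro Y hY
    have hpar : ∀ v ∈ Y, (ρ.cosetModule hT hpos).grading.parity v ∈ Y :=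
      fun v hv => hY.parity_mem hv
    rcases hs.eq_bot_or_eq_weightSum h hpos (Y := Y.map (Submodule.subtype _))
      (Submodule.map_subtype_le _ _) (by
        rintro _ ⟨v, hv, rfl⟩
        exact ⟨_, hpar v hv, ρ.sub_parity_coe _ _ _ v⟩) (by
        rintro j α hα hR x hx _ ⟨v, hv, rfl⟩
        have hx' : x ∈ (ofRoots (n := n) T₀ hT₀).part j := rootSpace_le_ofRoots (hT' α hα hR) j hx
        exact ⟨_, hY.2 j ⟨x, hx'⟩ v hv, ρ.cosetModule_act_coe hT hpos j ⟨x, hk j hx'⟩ v⟩) with h' | h'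
    · left
      rw [← LinearMap.le_ker_iff_map, Submodule.ker_subtype, le_bot_iff] at h'
      exact h'
    · right
      rw [eq_top_iff]
      intro v _
      have hv : (v : M) ∈ Y.map (Submodule.subtype _) := by
        rw [h']
        exact v.2
      obtain ⟨w, hw, e⟩ := hv
      rwa [← Subtype.ext e]

/-- The inclusion of N in M extends to the induced module. A submodule mapping onto M must contain
`1 ⊗ N`, which generates, because weights in the coset can be separated from those in the negative
set. -/
theorem IsSimple.hasUniqueSimpleQuotient_ind_cosetModule (hs : ρ.IsSimple) (h : Split n R T T')
    (h0 : 0 ∈ T) (hμ : ρ.wt μ ≠ ⊥) :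
    (ind (g := W m n) ofRoots_isSub_W (ρ.cosetModule hT hpos)).HasUniqueSimpleQuotient ρ := by
  set η := ρ.cosetModule hT hpos with hη
  let f : weightSum ρ.cartan {ν | ν - μ ∈ R} →ₗ[ℂ] M := Submodule.subtype _
  have hf : ∀ (i : ZMod 2) (x : (ofRoots (n := n) T hT).part i) v,
      f (η.act i x v) = ρ.op i x (f v) := ρ.cosetModule_act_coe hT hpos
  have hφ := indLift_isHom (g := W m n) ofRoots_isSub_W η ρ hf
    fun v => ρ.sub_parity_coe _ _ _ v
  have hφ1 := indLift_indUnit (g := W m n) ofRoots_isSub_W η ρ hf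
  set φ := indLift (g := W m n) ofRoots_isSub_W η ρ hf
  refine hφ.hasUniqueSimpleQuotient hs ?_ fun X hX hXt => ?_
  · intro hz
    obtain ⟨v, hv, hv0⟩ := (Submodule.ne_bot_iff _).1 hμ
    have hv' : v ∈ weightSum ρ.cartan {ν | ν - μ ∈ R} :=
      jointSpace_le_weightSum (by change μ - μ ∈ R; rw [sub_self]; exact zero_mem R) hv
    have := hφ1 ⟨v, hv'⟩
    rw [hz] at this
    exact hv0 this.symm
  · refine eq_top_of_indUnit_mem _ _ hX fun v => ?_
    have hvX : f v ∈ X.map φ := hXt ▸ Submodule.mem_top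
    obtain ⟨x, hx, hxv⟩ := hvX
    obtain ⟨v', w, hw, rfl⟩ := exists_indUnit_add h0 η h (μ := μ)
      (ρ.iSup_cosetModule_weightSpace hT hpos h0) x
    have hw' : φ w ∈ weightSum ρ.cartan {ν | ν - μ ∈ T'} := by
      have hle : weightSum (ind (g := W m n) ofRoots_isSub_W η).cartan {ν | ν - μ ∈ T'} ≤
          (weightSum ρ.cartan {ν | ν - μ ∈ T'}).comap φ := by
        refine iSup₂_le fun ν hν z hz => jointSpace_le_weightSum hν ?_
        change φ z ∈ ρ.wt ν
        have hz' := (SuperModule.mem_wt _).1 hz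
        rw [mem_wt]
        intro i
        rw [cartan, ← hφ.map_op (d_mem m n i), ← map_smul, ← hz' i]
        rfl
      exact hle hw
    rw [map_add, hφ1] at hxv
    have h1 : φ w ∈ weightSum ρ.cartan {ν | ν - μ ∈ R} := by
      rw [← eq_sub_iff_add_eq'] at hxv
      rw [hxv]
      exact sub_mem v.2 v'.2
    -- The image of `w` has weights both in the coset and in the negative set, so it is zero and `v'
    -- = v`.
    have h2 := Submodule.disjoint_def.1 (weightSum_disjoint_of_split h μ) _ h1 hw'
    rw [h2, add_zero] at hxv
    obtain rfl : v' = v := Subtype.ext hxv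
    -- X is stable under the Cartan subalgebra, so with `x` it contains the part of `x` over the
    -- coset, which is `1 ⊗ v`.
    refine mem_of_add_mem (h := (ind (g := W m n) ofRoots_isSub_W η).cartan)
      (fun i z hz => hX.op_mem (d_mem m n i) hz) (T := {ν | ν - μ ∈ R}) (T' := {ν | ν - μ ∈ T'})
      (Set.disjoint_left.2 fun ν hν => h.not_mem _ hν) ?_ hw hx
    have hle : (⊤ : Submodule ℂ (weightSum ρ.cartan {ν | ν - μ ∈ R})) ≤
        (weightSum (ind (g := W m n) ofRoots_isSub_W η).cartan {ν | ν - μ ∈ R}).comap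
          (indUnit ofRoots_isSub_W η) := by
      rw [← ρ.iSup_cosetModule_weightSpace hT hpos h0]
      exact iSup₂_le fun ν hν v hv => jointSpace_le_weightSum hν (indUnit_mem_wt h0 η hv)
    exact hle Submodule.mem_top

end Coset

end SuperModule

/-- Each root has the form treated in `exists_negative`. If it lies in the cone of positive roots
and `Δ'^I`, then it belongs to `Δ⁰` or `Δ⁺` according to whether it is in the lattice of `Δ'^I`. -/
theorem IsBlocked.exists_split {m : ℕ} {S : Set (Wt m)} {μ : Wt m} {P Q : Set (Wt m)}
    (hμ : IsBlocked S μ) (hS : SuppShape S) (hPQ : IsTriangular (RootF0 S μ) P Q) (n : ℕ) :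
    ∃ Neg : Set (Wt m), Split n (AddSubgroup.closure (RootI S μ))
      (insert 0 (zeroRoot S μ n ∪ posRoot S μ P n)) Neg := by
  obtain ⟨Neg, h1, h2, h3, h4⟩ := hμ.exists_negative hS hPQ
  refine ⟨Neg, h1, h2, h3, fun α j hα => ?_⟩
  obtain ⟨a, i, e⟩ := exists_of_rootSpace_ne_bot hα
  have h := h4 a i
  rw [← e] at h
  refine h.imp_left fun hc => ?_
  by_cases h0 : α = 0
  · exact Or.inl h0
  · have hr : α ∈ Root m n := ⟨h0, j, hα⟩
    by_cases hR : α ∈ AddSubgroup.closure (RootI S μ)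
    · exact Or.inr (Or.inl ⟨hr, hR⟩)
    · exact Or.inr (Or.inr ⟨⟨hr, hc⟩, fun hz => hR hz.2⟩)

end CartanW

end

/-! ### The main theorem -/

open CartanW in
theorem mainTheorem3 {m n : ℕ} (hmn : (m, n) ≠ (0, 0))
    {M : Type u} [AddCommGroup M] [Module ℂ M] (ρ : CartanW.SuperModule (CartanW.W m n) M)
    (hHC : CartanW.IsHarishChandra (CartanW.W_hasCartan m n) ρ)
    (hsimple : ρ.IsSimple) (hnontrivial : ¬ρ.IsTrivial)
    (S : Set (CartanW.Wt m)) (hS : S = CartanW.supp (CartanW.W_hasCartan m n) ρ) :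
    ∃ μ : CartanW.Wt m, CartanW.IsExtremal S μ ∧
      ∀ P Q : Set (CartanW.Wt m), CartanW.IsTriangular (CartanW.RootF0 S μ) P Q →
        (∀ α ∈ CartanW.posRoot S μ P n, μ + α ∉ S) ∧
        ∃ (N : Type u) (_ : AddCommGroup N) (_ : Module ℂ N)
          (η : CartanW.SuperModule (CartanW.parabolic S μ P n) N),
          η.IsSimple ∧
          CartanW.IsWeight (CartanW.parabolic_hasCartan S μ P n) η ∧
          CartanW.supp (CartanW.parabolic_hasCartan S μ P n) η =
            {ν | ν - μ ∈ AddSubgroup.closure (CartanW.RootI S μ)} ∧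
          (CartanW.ind (CartanW.parabolic_isSub S μ P n) η).HasUniqueSimpleQuotient ρ ∧
          (η.restrict (CartanW.levi_isSub S μ P n)).IsSimple ∧
          CartanW.IsBounded (CartanW.levi_hasCartan S μ n)
            (η.restrict (CartanW.levi_isSub S μ P n)) ∧
          ∀ ν₁ ∈ CartanW.supp (CartanW.parabolic_hasCartan S μ P n) η,
            ∀ ν₂ ∈ CartanW.supp (CartanW.parabolic_hasCartan S μ P n) η,
              Module.finrank ℂ (CartanW.weightSpace (CartanW.parabolic_hasCartan S μ P n) η ν₁) =
                Module.finrank ℂ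
                  (CartanW.weightSpace (CartanW.parabolic_hasCartan S μ P n) η ν₂) := by
  have hSwt : S = {μ | ρ.wt μ ≠ ⊥} := by
    rw [hS]
    ext ν
    change weightSpace (W_hasCartan m n) ρ ν ≠ ⊥ ↔ _
    rw [ρ.weightSpace_eq_wt]
    rfl
  have hw : weightSum ρ.cartan Set.univ = ⊤ := by
    have := hHC.1
    simp only [IsWeight, ρ.weightSpace_eq_wt] at this
    have h : ⨆ μ, jointSpace ρ.cartan μ = ⊤ := this
    simpa [weightSum] using h
  have hfin : ∀ ν, FiniteDimensional ℂ (ρ.wt ν) := fun ν => by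
    rw [← ρ.weightSpace_eq_wt]
    exact hHC.2 ν
  have hShape : SuppShape S := by
    rw [hSwt]
    exact hsimple.suppShape hnontrivial hw hfin
  obtain ⟨μ, hext, hblock⟩ := hShape.exists_extremal
  have hμ : ρ.wt μ ≠ ⊥ := by
    have := hext.1
    rwa [hSwt] at this
  refine ⟨μ, hext, fun P Q hPQ => ?_⟩
  obtain ⟨Neg, hsplit⟩ := hblock.exists_split hShape hPQ n
  have hneg : ∀ α ∈ posRoot S μ P n, α ∉ AddSubgroup.closure (RootI S μ) :=
    fun α hα h => hα.2 ⟨hα.1.1, h⟩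
  have hpos : ∀ α ∈ insert 0 (zeroRoot S μ n ∪ posRoot S μ P n),
      α ∉ AddSubgroup.closure (RootI S μ) → ∀ ν, ν - μ ∈ AddSubgroup.closure (RootI S μ) →
        ρ.wt (ν + α) = ⊥ := by
    rintro α (rfl | hα | hα) hR ν hν
    · exact absurd (zero_mem _) hR
    · exact absurd hα.2 hR
    -- Blocking at `μ` covers the whole coset: the lattice element `ν - μ` is itself a sum of roots
    -- of `Δ'^I`, so it can be absorbed into the positive sum.
    · have h1 := hblock.add_not_mem hShape hPQ (β := (ν - μ) + α)
        (add_mem (closure_RootI_le S μ P hν) hα.1.2)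
        fun h => hR (by simpa using sub_mem h hν)
      rw [show μ + (ν - μ + α) = ν + α by abel, hSwt] at h1
      by_contra h
      exact h1 h
  have hdim : ∀ ν, ν - μ ∈ AddSubgroup.closure (RootI S μ) →
      Module.finrank ℂ (ρ.wt ν) = Module.finrank ℂ (ρ.wt μ) := by
    intro ν hν
    rw [hSwt] at hν hShape
    have := hsimple.finrank_wt_add hfin hShape hμ hν μ
    rwa [add_sub_cancel] at this
  have h0 : (0 : Wt m) ∈ insert 0 (zeroRoot S μ n ∪ posRoot S μ P n) := Set.mem_insert _ _
  have h0' : (0 : Wt m) ∈ insert 0 (zeroRoot S μ n) := Set.mem_insert _ _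
  have hmem : ∀ α ∈ insert 0 (zeroRoot S μ n ∪ posRoot S μ P n),
      α ∈ AddSubgroup.closure (RootI S μ) → α ∈ insert 0 (zeroRoot S μ n) := by
    rintro α (rfl | hα | hα) hR
    · exact Or.inl rfl
    · exact Or.inr hα
    · exact absurd hR (hneg α hα)
  have hT := parabolic_closed S μ P n
  have hrank : ∀ ν, ν - μ ∈ AddSubgroup.closure (RootI S μ) → Module.finrank ℂ
      (weightSpace (ofRoots_hasCartan h0) (ρ.cosetModule hT hpos) ν) =
        Module.finrank ℂ (ρ.wt μ) := fun ν hν => by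
    rw [ρ.finrank_cosetModule_weightSpace hT hpos h0 hν, hdim ν hν]
  have hfinN : ∀ ν, FiniteDimensional ℂ
      (weightSpace (ofRoots_hasCartan h0) (ρ.cosetModule hT hpos) ν) := fun ν => by
    have := hfin ν
    rw [ρ.cosetModule_weightSpace hT hpos h0]
    exact Module.Finite.of_injective ((Submodule.subtype _).submoduleComap (ρ.wt ν))
      fun a b h => Subtype.ext (Subtype.ext (Subtype.ext_iff.1 h :))
  have hsupp : supp (ofRoots_hasCartan h0) (ρ.cosetModule hT hpos) =
      {ν | ν - μ ∈ AddSubgroup.closure (RootI S μ)} := by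
    ext ν
    change weightSpace (ofRoots_hasCartan h0) (ρ.cosetModule hT hpos) ν ≠ ⊥ ↔
      ν - μ ∈ AddSubgroup.closure (RootI S μ)
    constructor
    · intro h
      by_contra hν
      exact h (ρ.cosetModule_weightSpace_eq_bot hT hpos h0 hν)
    · intro hν h
      have h1 := hrank ν hν
      have := hfin μ
      rw [h, finrank_bot, eq_comm, Submodule.finrank_eq_zero] at h1
      exact hμ h1
  have hweight : IsWeight (ofRoots_hasCartan h0) (ρ.cosetModule hT hpos) := by
    rw [IsWeight, eq_top_iff, ← ρ.iSup_cosetModule_weightSpace hT hpos h0]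
    exact iSup₂_le fun ν _ => le_iSup _ ν
  have hlevi := hsimple.restrict_cosetModule hT (zeroRoot_closed S μ n) hpos hsplit hmem hμ
    (levi_isSub S μ P n)
  have hres := ρ.weightSpace_restrict_cosetModule hT (zeroRoot_closed S μ n) hpos h0 h0'
    (levi_isSub S μ P n)
  -- N is the sum of the weight spaces of M over `μ` plus the lattice of `Δ'^I`. Its simplicity over
  -- the parabolic follows from that over the Levi subalgebra, and the common dimension of its
  -- weight spaces, that of `M_μ`, is the uniform bound.
  refine ⟨fun α hα => hblock.add_not_mem hShape hPQ hα.1.2 (hneg α hα), _, _, _,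
    ρ.cosetModule hT hpos, SuperModule.IsSimple.of_restrict _ hlevi, hweight, hsupp,
    hsimple.hasUniqueSimpleQuotient_ind_cosetModule hT hpos hsplit h0 hμ, hlevi,
    ⟨⟨?_, fun ν => ?_⟩, Module.finrank ℂ (ρ.wt μ), fun ν => ?_⟩, fun ν₁ h1 ν₂ h2 => ?_⟩
  · have : ⨆ ν, weightSpace (ofRoots_hasCartan h0) (ρ.cosetModule hT hpos) ν = ⊤ := hweight
    simp only [← hres] at this
    exact this
  · have := hfinN ν
    rw [← hres] at this
    exact this
  · have : Module.finrank ℂ (weightSpace (ofRoots_hasCartan h0) (ρ.cosetModule hT hpos) ν) ≤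
        Module.finrank ℂ (ρ.wt μ) := by
      by_cases hν : ν - μ ∈ AddSubgroup.closure (RootI S μ)
      · exact (hrank ν hν).le
      · rw [ρ.cosetModule_weightSpace_eq_bot hT hpos h0 hν, finrank_bot]
        exact Nat.zero_le _
    rw [← hres] at this
    exact this
  · rw [show supp (parabolic_hasCartan S μ P n) (ρ.cosetModule hT hpos) = _ from hsupp] at h1 h2
    exact (hrank ν₁ h1).trans (hrank ν₂ h2).symm
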